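/- Let $G$ be a group and $\Bbbk$ a commutative ring. **Conventions.** A *pivotal category* is a monoidal category in which each object $X$ has a dual $X^*$ with morphisms $\mathrm{ev}_X\colon X^*\otimes X\to\mathbb 1$, $\mathrm{coev}_X\colon \mathbb 1\to X\otimes X^*$ (left duality) and $\widetilde{\mathrm{ev}}_X\colon X\otimes X^*\to\mathbb 1$, $\widetilde{\mathrm{coev}}_X\colon\mathbb 1\to X^*\otimes X$ (right duality) such that the left and right dual functors coincide as monoidal functors. The left and right traces of $g\in\mathrm{End}(X)$ are $\mathrm{tr}_l(g)=\mathrm{ev}_X(\mathrm{id}\otimes g)\widetilde{\mathrm{coev}}_X$ and $\mathrm{tr}_r(g)=\widetilde{\mathrm{ev}}_X(g\otimes\mathrm{id})\mathrm{coev}_X$; the category is *spherical* if $\mathrm{tr}_l=\mathrm{tr}_r$, and $d_X=\mathrm{tr}_l(\mathrm{id}_X)$. A *$G$-graded category* (over $\Bbbk$) is a $\Bbbk$-additive monoidal category $\mathcal D$ with pairwise disjoint full $\Bbbk$-additive subcategories $\mathcal D_\alpha$ ($\alpha\in G$) such that every object is a finite direct sum of objects of these subcategories, $\mathcal D_\alpha\otimes\mathcal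 D_\beta\subset\mathcal D_{\alpha\beta}$, $\mathrm{Hom}(\mathcal D_\alpha,\mathcal D_\beta)=0$ for $\alpha\ne\beta$, and $\mathbb 1\in\mathcal D_1$; in the pivotal case $X^*$ is chosen in $\mathcal D_{\alpha^{-1}}$ for $X\in\mathcal D_\alpha$. Write $|X|=\alpha$ for $X\in\mathcal D_\alpha$; such $X$ are *homogeneous*. An object is *simple* if its endomorphisms form a free $\Bbbk$-module of rank $1$. A *$G$-pre-fusion category* is a pivotal $G$-graded category $\mathcal C$ such that $\mathbb 1$ is simple, every object is a finite direct sum of simple objects, $\mathrm{Hom}(i,j)=0$ for non-isomorphic simple objects $i,j$, and every $\mathcal C_\alpha$ contains a simple object. A *crossing* in a $G$-graded category $\mathcal D$ is a family of $\Bbbk$-linear strong monoidal autoequivalences $\varphi_\alpha$ of $\mathcal D$ with $\varphi_\alpha(\mathcal D_\beta)\subset\mathcal D_{\alpha^{-1}\beta\alpha}$ and monoidal natural isomorphisms $\varphi_2(\alpha,\beta)\colon\varphi_\alpha\varphi_\beta\to\varphi_{\beta\alpha}$, $\varphi_0\colon 1_{\mathcal D}\to\varphi_1$ satisfying the associativity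 and unit axioms of a monoidal functor. A *$G$-braiding* is a family of isomorphisms $\tau_{X,Y}\colon X\otimes Y\to Y\otimes\varphi_{|Y|}(X)$, for $X\in\mathcal D$ and $Y$ homogeneous, natural in $X$ and $Y$, such that (suppressing associativity constraints) $$\tau_{X,Y\otimes Z}=(\mathrm{id}\otimes\varphi_2(|Z|,|Y|)_X)(\mathrm{id}_Y\otimes\tau_{\varphi_{|Y|}(X),Z})(\tau_{X,Y}\otimes\mathrm{id}_Z),$$ $$\tau_{X\otimes Y,Z}=(\mathrm{id}_Z\otimes(\varphi_{|Z|})_2(X,Y))(\tau_{X,Z}\otimes\mathrm{id})(\mathrm{id}_X\otimes\tau_{Y,Z}),$$ $$\varphi_\alpha(\tau_{X,Y})(\varphi_\alpha)_2(X,Y)=(\varphi_\alpha)_2(Y,\varphi_{|Y|}(X))\bigl(\mathrm{id}\otimes\varphi_2(\alpha,|Y|)_X^{-1}\varphi_2(\alpha^{-1}|Y|\alpha,\alpha)_X\bigr)\tau_{\varphi_\alpha(X),\varphi_\alpha(Y)}.$$ A strong monoidal functor $F$ between pivotal categories is *pivotal* if the two isomorphisms $F(X^*)\to F(X)^*$ built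 from the left and from the right duality coincide for all $X$; they are then denoted $F^1(X)$. A pivotal $G$-graded category with a crossing and a $G$-braiding is *$G$-ribbon* if all $\varphi_\alpha$ are pivotal and the twist $$\theta_X=(\mathrm{ev}_X\otimes\mathrm{id})(\mathrm{id}_{X^*}\otimes\tau_{X,X})(\widetilde{\mathrm{coev}}_X\otimes\mathrm{id}_X)\colon X\to\varphi_{|X|}(X)$$ satisfies, for all homogeneous $X$, $$(\theta_X)^*=(\varphi_0)_X^*\,(\varphi_2(|X|^{-1},|X|)_X^{-1})^*\,\varphi^1_{|X|^{-1}}(\varphi_{|X|}(X))\,\theta_{\varphi_{|X|}(X)^*}.$$ **The $G$-center.** For a pivotal $G$-graded category $\mathcal C$, the objects of $\mathcal Z_G(\mathcal C)$ are pairs $(A,\sigma)$ with $A\in\mathcal C$ and $\sigma=\{\sigma_X\colon A\otimes X\to X\otimes A\}_{X\in\mathcal C_1}$ a natural family of isomorphisms with $\sigma_{X\otimes Y}=(\mathrm{id}_X\otimes\sigma_Y)(\sigma_X\otimes\mathrm{id}_Y)$; morphisms are the morphisms of $\mathcal C$ commuting with the half braidings; $(A,\sigma)\otimes(B,\rho)=(A\otimes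 B,(\sigma\otimes\mathrm{id}_B)(\mathrm{id}_A\otimes\rho))$; duals and (co)evaluations are those of $\mathcal C$; and $|(A,\sigma)|=|A|$. For $\alpha\in G$ let $\mathcal E_\alpha$ be the class of $V\in\mathcal C_\alpha$ with $d_V$ invertible. Given $A=(A,\sigma)\in\mathcal Z_G(\mathcal C)$ and $U,V\in\mathcal E_\alpha$, let $$s^{V,U}_A=d_V^{-1}(\mathrm{ev}_V\otimes\mathrm{id}_{U^*\otimes A\otimes U})(\mathrm{id}_{V^*}\otimes\sigma_{V\otimes U^*}\otimes\mathrm{id}_U)(\mathrm{id}_{V^*\otimes A\otimes V}\otimes\widetilde{\mathrm{coev}}_U)\colon V^*\otimes A\otimes V\to U^*\otimes A\otimes U .$$ The *canonical* crossing and $G$-braiding on $\mathcal Z_G(\mathcal C)$ (determined up to isomorphism) are those $(\varphi,\tau)$ for which there are morphisms $p^V_A\colon V^*\otimes A\otimes V\to\varphi_\alpha(A)$ and $q^V_A\colon\varphi_\alpha(A)\to V^*\otimes A\otimes V$ in $\mathcal C$, for all $A$, $\alpha\in G$ and $V\in\mathcal E_\alpha$, such that $q^V_Ap^V_A=s^{V,V}_A$,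 $p^V_Aq^V_A=\mathrm{id}$, $p^U_As^{V,U}_Aq^V_A=\mathrm{id}$ for $U,V\in\mathcal E_\alpha$, and, for all choices of objects of the indicated classes: * the half braiding of $\varphi_\alpha(A)$ at $X\in\mathcal C_1$ is $d_V^{-1}(\mathrm{id}_X\otimes p^V_A)(\mathrm{ev}_V\otimes\mathrm{id})(\mathrm{id}_{V^*}\otimes\sigma_{V\otimes X\otimes V^*}\otimes\mathrm{id}_V)(\mathrm{id}_{V^*\otimes A\otimes V\otimes X}\otimes\widetilde{\mathrm{coev}}_V)(q^V_A\otimes\mathrm{id}_X)$; * $\varphi_\alpha(f)=p^V_B(\mathrm{id}_{V^*}\otimes f\otimes\mathrm{id}_V)q^V_A$ for $f\colon A\to B$; * $(\varphi_\alpha)_2(A,B)=p^V_{A\otimes B}(\mathrm{id}_{V^*\otimes A}\otimes\widetilde{\mathrm{ev}}_V\otimes\mathrm{id}_{B\otimes V})(q^V_A\otimes q^V_B)$ and $(\varphi_\alpha)_0=p^V_{\mathbb 1}\widetilde{\mathrm{coev}}_V$; * for $U\in\mathcal E_\alpha$, $V\in\mathcal E_\beta$, $W\in\mathcal E_{\beta\alpha}$,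 $\varphi_2(\alpha,\beta)_A=d_U^{-1}d_V^{-1}\,p^W_A\,(\mathrm{ev}_U\otimes\mathrm{id})(\mathrm{id}_{U^*}\otimes\mathrm{ev}_V\otimes\mathrm{id})(\mathrm{id}_{U^*\otimes V^*}\otimes\sigma_{V\otimes U\otimes W^*}\otimes\mathrm{id}_W)(\mathrm{id}\otimes\widetilde{\mathrm{coev}}_W)(\mathrm{id}_{U^*}\otimes q^V_A\otimes\mathrm{id}_U)\,q^U_{\varphi_\beta(A)}$; * for $U\in\mathcal E_1$, $(\varphi_0)_A=p^U_A(\sigma_{U^*}\otimes\mathrm{id}_U)(\mathrm{id}_A\otimes\widetilde{\mathrm{coev}}_U)$; * for $(B,\rho)$ of degree $\alpha$ and $V\in\mathcal E_\alpha$, $\tau_{A,B}=(\mathrm{id}_B\otimes p^V_A)(\sigma_{B\otimes V^*}\otimes\mathrm{id}_V)(\mathrm{id}_{A\otimes B}\otimes\widetilde{\mathrm{coev}}_V)$. **Lemma.** Let $\mathcal C$ be a spherical $G$-pre-fusion category over $\Bbbk$ in which all idempotents split. Then $\mathcal Z_G(\mathcal C)$ has a canonical crossing and $G$-braiding, and with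 any such canonical crossing and $G$-braiding it is a $G$-ribbon category. -/

import Mathlib

open CategoryTheory MonoidalCategory Limits

/- The quiver underlying a category should be found directly. -/
attribute [-instance] catToReflQuiver

namespace GCenterRibbon

universe v u w

/-! ### Duality and pivotal categories -/

section Duality

/-- A choice, for every object `X`, of an object `dual X` that is both a left dual of `X`
(through `ev`, `coev`) and a right dual of `X` (through `evR`, `coevR`). -/
class DualityData (C : Type u) [Category.{v} C] [MonoidalCategory C] where
  dual : C → C
  ev (X : C) : dual X ⊗ X ⟶ 𝟙_ C
  coev (X : C) : 𝟙_ C ⟶ X ⊗ dual X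
  evR (X : C) : X ⊗ dual X ⟶ 𝟙_ C
  coevR (X : C) : 𝟙_ C ⟶ dual X ⊗ X
  zigzag (X : C) :
    (λ_ X).inv ≫ coev X ▷ X ≫ (α_ _ _ _).hom ≫ X ◁ ev X ≫ (ρ_ X).hom = 𝟙 X
  zigzag_dual (X : C) :
    (ρ_ (dual X)).inv ≫ dual X ◁ coev X ≫ (α_ _ _ _).inv ≫ ev X ▷ dual X ≫
      (λ_ (dual X)).hom = 𝟙 (dual X)
  zigzagR (X : C) :
    (ρ_ X).inv ≫ X ◁ coevR X ≫ (α_ _ _ _).inv ≫ evR X ▷ X ≫ (λ_ X).hom = 𝟙 X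
  zigzagR_dual (X : C) :
    (λ_ (dual X)).inv ≫ coevR X ▷ dual X ≫ (α_ _ _ _).hom ≫ dual X ◁ evR X ≫
      (ρ_ (dual X)).hom = 𝟙 (dual X)

open DualityData

variable {C : Type u} [Category.{v} C] [MonoidalCategory C] [DualityData C]

/-- The action of the left dual functor on morphisms. -/
def dualMapL {X Y : C} (f : X ⟶ Y) : dual Y ⟶ dual X :=
  (ρ_ _).inv ≫ dual Y ◁ coev X ≫ dual Y ◁ f ▷ dual X ≫ (α_ _ _ _).inv ≫
    ev Y ▷ dual X ≫ (λ_ _).hom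

/-- The action of the right dual functor on morphisms. -/
def dualMapR {X Y : C} (f : X ⟶ Y) : dual Y ⟶ dual X :=
  (λ_ _).inv ≫ coevR X ▷ dual Y ≫ (α_ _ _ _).hom ≫ dual X ◁ f ▷ dual Y ≫
    dual X ◁ evR Y ≫ (ρ_ _).hom

/-- The nested evaluation `X* ⊗ Y* ⊗ Y ⊗ X ⟶ 𝟙`. -/
def evTensor (X Y : C) : (dual X ⊗ dual Y) ⊗ (Y ⊗ X) ⟶ 𝟙_ C :=
  (α_ _ _ _).hom ≫ dual X ◁ ((α_ _ _ _).inv ≫ ev Y ▷ X ≫ (λ_ X).hom) ≫ ev X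

/-- The nested right evaluation `Y ⊗ X ⊗ X* ⊗ Y* ⟶ 𝟙`. -/
def evRTensor (X Y : C) : (Y ⊗ X) ⊗ (dual X ⊗ dual Y) ⟶ 𝟙_ C :=
  (α_ _ _ _).hom ≫ Y ◁ ((α_ _ _ _).inv ≫ evR X ▷ dual Y ≫ (λ_ _).hom) ≫ evR Y

/-- The left monoidal constraint `X* ⊗ Y* ⟶ (Y ⊗ X)*`. -/
def dualTensorL (X Y : C) : dual X ⊗ dual Y ⟶ dual (Y ⊗ X) :=
  (ρ_ _).inv ≫ (dual X ⊗ dual Y) ◁ coev (Y ⊗ X) ≫ (α_ _ _ _).inv ≫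
    evTensor X Y ▷ dual (Y ⊗ X) ≫ (λ_ _).hom

/-- The right monoidal constraint `X* ⊗ Y* ⟶ (Y ⊗ X)*`. -/
def dualTensorR (X Y : C) : dual X ⊗ dual Y ⟶ dual (Y ⊗ X) :=
  (λ_ _).inv ≫ coevR (Y ⊗ X) ▷ (dual X ⊗ dual Y) ≫ (α_ _ _ _).hom ≫
    dual (Y ⊗ X) ◁ evRTensor X Y ≫ (ρ_ _).hom

end Duality

open DualityData

/-- A pivotal category: the left and the right dual functors are equal as monoidal functors
(on objects, on morphisms, and with the same monoidal constraints). -/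
class PivotalCat (C : Type u) [Category.{v} C] [MonoidalCategory C] extends DualityData C where
  dualMap_eq {X Y : C} (f : X ⟶ Y) : dualMapL f = dualMapR f
  dualTensor_eq (X Y : C) : dualTensorL X Y = dualTensorR X Y
  dualUnit_eq : coev (𝟙_ C) ≫ (λ_ (dual (𝟙_ C))).hom = coevR (𝟙_ C) ≫ (ρ_ (dual (𝟙_ C))).hom

section Pivotal

variable {C : Type u} [Category.{v} C] [MonoidalCategory C] [PivotalCat C]

/-- The left trace of an endomorphism. -/
def trL {X : C} (g : X ⟶ X) : 𝟙_ C ⟶ 𝟙_ C := coevR X ≫ dual X ◁ g ≫ ev X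

/-- The right trace of an endomorphism. -/
def trR {X : C} (g : X ⟶ X) : 𝟙_ C ⟶ 𝟙_ C := coev X ≫ g ▷ dual X ≫ evR X

/-- The left dimension of an object. -/
def dimL (X : C) : 𝟙_ C ⟶ 𝟙_ C := trL (𝟙 X)

lemma dualMapL_ev {X Y : C} (f : X ⟶ Y) :
    dualMapL f ▷ X ≫ ev X = dual Y ◁ f ≫ ev Y := by
  have key : (λ_ X).inv ≫ coev X ▷ X ≫ (α_ _ _ _).hom ≫ X ◁ ev X ≫ (ρ_ X).hom = 𝟙 X := zigzag X
  calc dualMapL f ▷ X ≫ ev X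
      = 𝟙 _ ⊗≫ dual Y ◁ coev X ▷ X ⊗≫ dual Y ◁ f ▷ dual X ▷ X ⊗≫
          (ev Y ▷ (dual X ⊗ X) ≫ 𝟙_ C ◁ ev X) ⊗≫ 𝟙 _ := by
        unfold dualMapL; monoidal
    _ = 𝟙 _ ⊗≫ dual Y ◁ coev X ▷ X ⊗≫ dual Y ◁ (f ▷ (dual X ⊗ X) ≫ Y ◁ ev X) ⊗≫ ev Y ⊗≫ 𝟙 _ := by
        rw [← whisker_exchange]; monoidal
    _ = 𝟙 _ ⊗≫ dual Y ◁ (((λ_ X).inv ≫ coev X ▷ X ≫ (α_ _ _ _).hom ≫ X ◁ ev X ≫ (ρ_ X).hom) ≫ f)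
          ⊗≫ ev Y ⊗≫ 𝟙 _ := by
        rw [← whisker_exchange]; monoidal
    _ = dual Y ◁ f ≫ ev Y := by
        rw [key]; monoidal

lemma evR_dualMapR {X Y : C} (f : X ⟶ Y) :
    X ◁ dualMapR f ≫ evR X = f ▷ dual Y ≫ evR Y := by
  have key := zigzagR X
  calc X ◁ dualMapR f ≫ evR X
      = 𝟙 _ ⊗≫ X ◁ coevR X ▷ dual Y ⊗≫ X ◁ dual X ◁ f ▷ dual Y ⊗≫
          ((X ⊗ dual X) ◁ evR Y ≫ evR X ▷ 𝟙_ C) ⊗≫ 𝟙 _ := by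
        unfold dualMapR; monoidal
    _ = 𝟙 _ ⊗≫ X ◁ coevR X ▷ dual Y ⊗≫ ((X ⊗ dual X) ◁ f ≫ evR X ▷ Y) ▷ dual Y ⊗≫ evR Y ⊗≫ 𝟙 _ := by
        rw [whisker_exchange]; monoidal
    _ = 𝟙 _ ⊗≫ (((ρ_ X).inv ≫ X ◁ coevR X ≫ (α_ _ _ _).inv ≫ evR X ▷ X ≫ (λ_ X).hom) ≫ f)
          ▷ dual Y ⊗≫ evR Y ⊗≫ 𝟙 _ := by
        rw [whisker_exchange]; monoidal
    _ = f ▷ dual Y ≫ evR Y := by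
        rw [key]; monoidal

lemma dualTensorL_ev (X Y : C) :
    dualTensorL X Y ▷ (Y ⊗ X) ≫ ev (Y ⊗ X) = evTensor X Y := by
  have key := zigzag (Y ⊗ X)
  calc dualTensorL X Y ▷ (Y ⊗ X) ≫ ev (Y ⊗ X)
      = 𝟙 _ ⊗≫ (dual X ⊗ dual Y) ◁ coev (Y ⊗ X) ▷ (Y ⊗ X) ⊗≫
          (evTensor X Y ▷ (dual (Y ⊗ X) ⊗ (Y ⊗ X)) ≫ 𝟙_ C ◁ ev (Y ⊗ X)) ⊗≫ 𝟙 _ := by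
        unfold dualTensorL; monoidal
    _ = 𝟙 _ ⊗≫ (dual X ⊗ dual Y) ◁ ((λ_ _).inv ≫ coev (Y ⊗ X) ▷ (Y ⊗ X) ≫ (α_ _ _ _).hom ≫
          (Y ⊗ X) ◁ ev (Y ⊗ X) ≫ (ρ_ _).hom) ⊗≫ evTensor X Y ⊗≫ 𝟙 _ := by
        rw [← whisker_exchange]; monoidal
    _ = evTensor X Y := by
        rw [key]; monoidal

lemma evR_dualTensorR (X Y : C) :
    (Y ⊗ X) ◁ dualTensorR X Y ≫ evR (Y ⊗ X) = evRTensor X Y := by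
  have key := zigzagR (Y ⊗ X)
  calc (Y ⊗ X) ◁ dualTensorR X Y ≫ evR (Y ⊗ X)
      = 𝟙 _ ⊗≫ (Y ⊗ X) ◁ coevR (Y ⊗ X) ▷ (dual X ⊗ dual Y) ⊗≫
          (((Y ⊗ X) ⊗ dual (Y ⊗ X)) ◁ evRTensor X Y ≫ evR (Y ⊗ X) ▷ 𝟙_ C) ⊗≫ 𝟙 _ := by
        unfold dualTensorR; monoidal
    _ = 𝟙 _ ⊗≫ ((ρ_ _).inv ≫ (Y ⊗ X) ◁ coevR (Y ⊗ X) ≫ (α_ _ _ _).inv ≫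
          evR (Y ⊗ X) ▷ (Y ⊗ X) ≫ (λ_ _).hom) ▷ (dual X ⊗ dual Y) ⊗≫ evRTensor X Y ⊗≫ 𝟙 _ := by
        rw [whisker_exchange]; monoidal
    _ = evRTensor X Y := by
        rw [key]; monoidal

/-- A morphism into `dual X` is determined by its composite with `ev X`. -/
lemma ext_ev {X T : C} {g h : T ⟶ dual X} (e : g ▷ X ≫ ev X = h ▷ X ≫ ev X) : g = h := by
  have aux (g : T ⟶ dual X) : g = 𝟙 _ ⊗≫ T ◁ coev X ⊗≫ (g ▷ X ≫ ev X) ▷ dual X ⊗≫ 𝟙 _ := by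
    have key := zigzag_dual X
    calc g = g ≫ ((ρ_ _).inv ≫ dual X ◁ coev X ≫ (α_ _ _ _).inv ≫ ev X ▷ dual X ≫ (λ_ _).hom) := by
          rw [key, Category.comp_id]
      _ = 𝟙 _ ⊗≫ (g ▷ 𝟙_ C ≫ dual X ◁ coev X) ⊗≫ ev X ▷ dual X ⊗≫ 𝟙 _ := by monoidal
      _ = _ := by rw [← whisker_exchange]; monoidal
  rw [aux g, aux h, e]

/-- A morphism into `dual X` is determined by its composite with `evR X`. -/
lemma ext_evR {X T : C} {g h : T ⟶ dual X} (e : X ◁ g ≫ evR X = X ◁ h ≫ evR X) : g = h := by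
  have aux (g : T ⟶ dual X) : g = 𝟙 _ ⊗≫ coevR X ▷ T ⊗≫ dual X ◁ (X ◁ g ≫ evR X) ⊗≫ 𝟙 _ := by
    have key := zigzagR_dual X
    calc g = g ≫ ((λ_ _).inv ≫ coevR X ▷ dual X ≫ (α_ _ _ _).hom ≫ dual X ◁ evR X ≫ (ρ_ _).hom) := by
          rw [key, Category.comp_id]
      _ = 𝟙 _ ⊗≫ (𝟙_ C ◁ g ≫ coevR X ▷ dual X) ⊗≫ dual X ◁ evR X ⊗≫ 𝟙 _ := by monoidal
      _ = _ := by rw [whisker_exchange]; monoidal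
  rw [aux g, aux h, e]

/-- A morphism into `X* ⊗ Y*` is determined by its composite with the nested evaluation. -/
lemma ext_evTensor {X Y T : C} {g h : T ⟶ dual X ⊗ dual Y}
    (e : g ▷ (Y ⊗ X) ≫ evTensor X Y = h ▷ (Y ⊗ X) ≫ evTensor X Y) : g = h := by
  have aux (g : T ⟶ dual X ⊗ dual Y) :
      g = 𝟙 _ ⊗≫ T ◁ coev Y ⊗≫ T ◁ Y ◁ coev X ▷ dual Y ⊗≫
        (g ▷ (Y ⊗ X) ≫ evTensor X Y) ▷ (dual X ⊗ dual Y) ⊗≫ 𝟙 _ := by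
    have kX := zigzag_dual X
    have kY := zigzag_dual Y
    symm
    calc 𝟙 _ ⊗≫ T ◁ coev Y ⊗≫ T ◁ Y ◁ coev X ▷ dual Y ⊗≫
        (g ▷ (Y ⊗ X) ≫ evTensor X Y) ▷ (dual X ⊗ dual Y) ⊗≫ 𝟙 _
        = 𝟙 _ ⊗≫ T ◁ (coev Y ≫ Y ◁ ((λ_ _).inv ≫ coev X ▷ dual Y)) ⊗≫
            g ▷ (Y ⊗ (X ⊗ dual X) ⊗ dual Y) ⊗≫
            evTensor X Y ▷ (dual X ⊗ dual Y) ⊗≫ 𝟙 _ := by monoidal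
      _ = 𝟙 _ ⊗≫ (T ◁ (coev Y ≫ Y ◁ ((λ_ _).inv ≫ coev X ▷ dual Y ≫ (α_ _ _ _).hom)) ≫
            g ▷ (Y ⊗ (X ⊗ dual X ⊗ dual Y))) ⊗≫
            evTensor X Y ▷ (dual X ⊗ dual Y) ⊗≫ 𝟙 _ := by monoidal
      _ = 𝟙 _ ⊗≫ g ⊗≫ dual X ◁ dual Y ◁ coev Y ⊗≫
            dual X ◁ ((dual Y ⊗ Y) ◁ coev X ≫ ev Y ▷ (X ⊗ dual X)) ▷ dual Y ⊗≫
            ev X ▷ (dual X ⊗ dual Y) ⊗≫ 𝟙 _ := by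
          rw [whisker_exchange]; unfold evTensor; monoidal
      _ = 𝟙 _ ⊗≫ g ⊗≫ dual X ◁ ((ρ_ _).inv ≫ dual Y ◁ coev Y ≫ (α_ _ _ _).inv ≫
            ev Y ▷ dual Y ≫ (λ_ _).hom) ⊗≫
            ((ρ_ _).inv ≫ dual X ◁ coev X ≫ (α_ _ _ _).inv ≫ ev X ▷ dual X ≫ (λ_ _).hom)
              ▷ dual Y ⊗≫ 𝟙 _ := by
          rw [whisker_exchange]; monoidal
      _ = g := by rw [kX, kY]; monoidal
  rw [aux g, aux h, e]

/-- In a pivotal category, the left and the right full rotations of a morphism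
`P ⊗ Q ⟶ R ⊗ S` agree. -/
lemma rotation_eq {P Q R S : C} (f : P ⊗ Q ⟶ R ⊗ S) (g h : dual S ⊗ dual R ⟶ dual Q ⊗ dual P)
    (hg : g ▷ (P ⊗ Q) ≫ evTensor Q P = (dual S ⊗ dual R) ◁ f ≫ evTensor S R)
    (hh : (P ⊗ Q) ◁ h ≫ evRTensor Q P = f ▷ (dual S ⊗ dual R) ≫ evRTensor S R) : g = h := by
  have e1 : g ≫ dualTensorL Q P = dualTensorL S R ≫ dualMapL f := by
    apply ext_ev
    rw [comp_whiskerRight, Category.assoc, dualTensorL_ev, hg, comp_whiskerRight, Category.assoc,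
      dualMapL_ev, ← whisker_exchange_assoc, dualTensorL_ev]
  have e2 : h ≫ dualTensorR Q P = dualTensorR S R ≫ dualMapR f := by
    apply ext_evR
    rw [MonoidalCategory.whiskerLeft_comp, Category.assoc, evR_dualTensorR, hh,
      MonoidalCategory.whiskerLeft_comp, Category.assoc,
      evR_dualMapR, whisker_exchange_assoc, evR_dualTensorR]
  have e3 : g ≫ dualTensorL Q P = h ≫ dualTensorL Q P := by
    rw [e1, PivotalCat.dualTensor_eq Q P, e2, PivotalCat.dualTensor_eq S R,
      PivotalCat.dualMap_eq]
  apply ext_evTensor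
  rw [← dualTensorL_ev, ← comp_whiskerRight_assoc, e3, comp_whiskerRight_assoc]

end Pivotal

/-! ### Relative centers -/

/-- The objects of the center of `C` relative to the full subcategory of the objects satisfying
`P`: pairs of an object `A` of `C` and a half braiding
`A ⊗ X ≅ X ⊗ A`, for `X` satisfying `P`. -/
structure RelCenter {C : Type u} [Category.{v} C] [MonoidalCategory C]
    (P : ObjectProperty C) where
  obj : C
  β (X : C) (hX : P X) : obj ⊗ X ≅ X ⊗ obj
  naturality {X Y : C} (hX : P X) (hY : P Y) (f : X ⟶ Y) :
    obj ◁ f ≫ (β Y hY).hom = (β X hX).hom ≫ f ▷ obj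
  monoidal {X Y : C} (hX : P X) (hY : P Y) (hXY : P (X ⊗ Y)) :
    (β (X ⊗ Y) hXY).hom = (α_ _ _ _).inv ≫ (β X hX).hom ▷ Y ≫ (α_ _ _ _).hom ≫
      X ◁ (β Y hY).hom ≫ (α_ _ _ _).inv

namespace RelCenter

section Basic

variable {C : Type u} [Category.{v} C] [MonoidalCategory C] {P : ObjectProperty C}

/-- Morphisms of half braidings. -/
@[ext]
structure Hom (A B : RelCenter P) where
  f : A.obj ⟶ B.obj
  comm (X : C) (hX : P X) : f ▷ X ≫ (B.β X hX).hom = (A.β X hX).hom ≫ X ◁ f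

instance : Category (RelCenter P) where
  Hom := Hom
  id A := { f := 𝟙 A.obj, comm := fun X hX => by simp }
  comp f g :=
    { f := f.f ≫ g.f
      comm := fun X hX => by
        rw [comp_whiskerRight, Category.assoc, g.comm, ← Category.assoc, f.comm, Category.assoc,
          MonoidalCategory.whiskerLeft_comp] }
  id_comp f := Hom.ext (Category.id_comp f.f)
  comp_id f := Hom.ext (Category.comp_id f.f)
  assoc f g h := Hom.ext (Category.assoc f.f g.f h.f)

lemma hom_ext {A B : RelCenter P} {f g : A ⟶ B} (h : f.f = g.f) : f = g := Hom.ext h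

@[simp] lemma id_f (A : RelCenter P) : Hom.f (𝟙 A) = 𝟙 A.obj := rfl

@[simp] lemma comp_f {A B D : RelCenter P} (f : A ⟶ B) (g : B ⟶ D) :
    (f ≫ g).f = f.f ≫ g.f := rfl

lemma hom_comm {A B : RelCenter P} (f : A ⟶ B) (X : C) (hX : P X) :
    f.f ▷ X ≫ (B.β X hX).hom = (A.β X hX).hom ≫ X ◁ f.f := Hom.comm f X hX

/-- An isomorphism of `C` that is a morphism of half braidings is an isomorphism of half
braidings. -/
def isoMk {A B : RelCenter P} (e : A.obj ≅ B.obj)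
    (h : ∀ (X : C) (hX : P X), e.hom ▷ X ≫ (B.β X hX).hom = (A.β X hX).hom ≫ X ◁ e.hom) :
    A ≅ B where
  hom := { f := e.hom, comm := h }
  inv :=
    { f := e.inv
      comm := fun X hX => by
        rw [← cancel_epi (e.hom ▷ X), hom_inv_whiskerRight_assoc, ← Category.assoc, h,
          Category.assoc, whiskerLeft_hom_inv, Category.comp_id] }
  hom_inv_id := Hom.ext e.hom_inv_id
  inv_hom_id := Hom.ext e.inv_hom_id

/-- The half braiding of a tensor product. -/
def tensorβ (A B : RelCenter P) (X : C) (hX : P X) :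
    (A.obj ⊗ B.obj) ⊗ X ≅ X ⊗ (A.obj ⊗ B.obj) :=
  α_ _ _ _ ≪≫ whiskerLeftIso A.obj (B.β X hX) ≪≫ (α_ _ _ _).symm ≪≫
    whiskerRightIso (A.β X hX) B.obj ≪≫ α_ _ _ _

lemma tensorβ_hom (A B : RelCenter P) (X : C) (hX : P X) :
    (tensorβ A B X hX).hom = (α_ _ _ _).hom ≫ A.obj ◁ (B.β X hX).hom ≫ (α_ _ _ _).inv ≫
      (A.β X hX).hom ▷ B.obj ≫ (α_ _ _ _).hom := rfl

/-- The tensor product of two half braidings. -/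
def tensorObj' (A B : RelCenter P) : RelCenter P where
  obj := A.obj ⊗ B.obj
  β := tensorβ A B
  naturality {X Y} hX hY f := by
    rw [tensorβ_hom, tensorβ_hom]
    calc
      _ = 𝟙 _ ⊗≫ (A.obj ◁ (B.obj ◁ f ≫ (B.β Y hY).hom)) ⊗≫
            (A.β Y hY).hom ▷ B.obj ⊗≫ 𝟙 _ := by monoidal
      _ = 𝟙 _ ⊗≫ A.obj ◁ (B.β X hX).hom ⊗≫
            (A.obj ◁ f ≫ (A.β Y hY).hom) ▷ B.obj ⊗≫ 𝟙 _ := by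
          rw [B.naturality hX hY]; monoidal
      _ = _ := by rw [A.naturality hX hY]; monoidal
  monoidal {X Y} hX hY hXY := by
    rw [tensorβ_hom, tensorβ_hom, tensorβ_hom, A.monoidal hX hY, B.monoidal hX hY]
    calc
      _ = 𝟙 _ ⊗≫ A.obj ◁ (B.β X hX).hom ▷ Y ⊗≫
            (_ ◁ (B.β Y hY).hom ≫ (A.β X hX).hom ▷ _) ⊗≫
              X ◁ (A.β Y hY).hom ▷ B.obj ⊗≫ 𝟙 _ := by monoidal
      _ = _ := by rw [whisker_exchange]; monoidal

/-- The unit half braiding. -/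
def tensorUnit' : RelCenter P where
  obj := 𝟙_ C
  β X _ := λ_ X ≪≫ (ρ_ X).symm
  naturality _ _ f := by simp
  monoidal _ _ _ := by
    dsimp only [Iso.trans_hom, Iso.symm_hom]
    monoidal

lemma tensor_comm {A₁ A₂ B₁ B₂ : RelCenter P} (f : A₁ ⟶ B₁) (g : A₂ ⟶ B₂) (X : C) (hX : P X) :
    (f.f ⊗ₘ g.f) ▷ X ≫ (tensorβ B₁ B₂ X hX).hom =
      (tensorβ A₁ A₂ X hX).hom ≫ X ◁ (f.f ⊗ₘ g.f) := by
  rw [tensorβ_hom, tensorβ_hom]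
  calc
    _ = 𝟙 _ ⊗≫ f.f ▷ (A₂.obj ⊗ X) ⊗≫ B₁.obj ◁ (g.f ▷ X ≫ (B₂.β X hX).hom) ⊗≫
          (B₁.β X hX).hom ▷ B₂.obj ⊗≫ 𝟙 _ := by
        rw [MonoidalCategory.tensorHom_def]; monoidal
    _ = 𝟙 _ ⊗≫ (f.f ▷ (A₂.obj ⊗ X) ≫ B₁.obj ◁ (A₂.β X hX).hom) ⊗≫ ((B₁.obj ⊗ X) ◁ g.f ≫
          (B₁.β X hX).hom ▷ B₂.obj) ⊗≫ 𝟙 _ := by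
        rw [hom_comm]; monoidal
    _ = 𝟙 _ ⊗≫ A₁.obj ◁ (A₂.β X hX).hom ⊗≫ (f.f ▷ X ≫
          (B₁.β X hX).hom) ▷ A₂.obj ⊗≫ X ◁ B₁.obj ◁ g.f ⊗≫ 𝟙 _ := by
        rw [← whisker_exchange f.f (A₂.β X hX).hom, whisker_exchange (B₁.β X hX).hom g.f]; monoidal
    _ = _ := by
        rw [hom_comm, MonoidalCategory.tensorHom_def]; monoidal

lemma whiskerLeft_comm (A : RelCenter P) {B₁ B₂ : RelCenter P} (g : B₁ ⟶ B₂) (X : C) (hX : P X) :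
    (A.obj ◁ g.f) ▷ X ≫ (tensorβ A B₂ X hX).hom =
      (tensorβ A B₁ X hX).hom ≫ X ◁ (A.obj ◁ g.f) := by
  have h := tensor_comm (𝟙 A) g X hX
  rwa [id_f, MonoidalCategory.id_tensorHom] at h

lemma whiskerRight_comm {A₁ A₂ : RelCenter P} (f : A₁ ⟶ A₂) (B : RelCenter P) (X : C) (hX : P X) :
    (f.f ▷ B.obj) ▷ X ≫ (tensorβ A₂ B X hX).hom =
      (tensorβ A₁ B X hX).hom ≫ X ◁ (f.f ▷ B.obj) := by
  have h := tensor_comm f (𝟙 B) X hX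
  rwa [id_f, MonoidalCategory.tensorHom_id] at h

lemma associator_comm (A B D : RelCenter P) (X : C) (hX : P X) :
    (α_ A.obj B.obj D.obj).hom ▷ X ≫ (tensorβ A (tensorObj' B D) X hX).hom =
      (tensorβ (tensorObj' A B) D X hX).hom ≫ X ◁ (α_ A.obj B.obj D.obj).hom := by
  change (α_ A.obj B.obj D.obj).hom ▷ X ≫ ((α_ A.obj (B.obj ⊗ D.obj) X).hom ≫
      A.obj ◁ (tensorβ B D X hX).hom ≫ (α_ _ _ _).inv ≫
      (A.β X hX).hom ▷ (B.obj ⊗ D.obj) ≫ (α_ _ _ _).hom) =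
    ((α_ (A.obj ⊗ B.obj) D.obj X).hom ≫ (A.obj ⊗ B.obj) ◁ (D.β X hX).hom ≫ (α_ _ _ _).inv ≫
      (tensorβ A B X hX).hom ▷ D.obj ≫ (α_ _ _ _).hom) ≫ X ◁ (α_ A.obj B.obj D.obj).hom
  rw [tensorβ_hom, tensorβ_hom]
  monoidal

lemma leftUnitor_comm (A : RelCenter P) (X : C) (hX : P X) :
    (λ_ A.obj).hom ▷ X ≫ (A.β X hX).hom =
      (tensorβ tensorUnit' A X hX).hom ≫ X ◁ (λ_ A.obj).hom := by
  change _ = ((α_ (𝟙_ C) A.obj X).hom ≫ 𝟙_ C ◁ (A.β X hX).hom ≫ (α_ _ _ _).inv ≫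
      ((λ_ X).hom ≫ (ρ_ X).inv) ▷ A.obj ≫ (α_ _ _ _).hom) ≫ _
  monoidal

lemma rightUnitor_comm (A : RelCenter P) (X : C) (hX : P X) :
    (ρ_ A.obj).hom ▷ X ≫ (A.β X hX).hom =
      (tensorβ A tensorUnit' X hX).hom ≫ X ◁ (ρ_ A.obj).hom := by
  change _ = ((α_ A.obj (𝟙_ C) X).hom ≫ A.obj ◁ ((λ_ X).hom ≫ (ρ_ X).inv) ≫ (α_ _ _ _).inv ≫
      (A.β X hX).hom ▷ 𝟙_ C ≫ (α_ _ _ _).hom) ≫ _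
  monoidal

/-- The monoidal product `(A, σ) ⊗ (B, ρ) = (A ⊗ B, (σ ⊗ B)(A ⊗ ρ))`. -/
instance : MonoidalCategory (RelCenter P) where
  tensorObj := tensorObj'
  tensorUnit := tensorUnit'
  tensorHom f g := { f := f.f ⊗ₘ g.f, comm := tensor_comm f g }
  whiskerLeft A _ _ g := { f := A.obj ◁ g.f, comm := whiskerLeft_comm A g }
  whiskerRight f B := { f := f.f ▷ B.obj, comm := whiskerRight_comm f B }
  associator A B D := isoMk (α_ A.obj B.obj D.obj) (associator_comm A B D)
  leftUnitor A := isoMk (λ_ A.obj) (leftUnitor_comm A)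
  rightUnitor A := isoMk (ρ_ A.obj) (rightUnitor_comm A)
  tensorHom_def f g := Hom.ext (MonoidalCategory.tensorHom_def f.f g.f)
  id_tensorHom_id A B := Hom.ext (MonoidalCategory.id_tensorHom_id A.obj B.obj)
  tensorHom_comp_tensorHom f₁ f₂ g₁ g₂ :=
    Hom.ext (MonoidalCategory.tensorHom_comp_tensorHom f₁.f f₂.f g₁.f g₂.f)
  whiskerLeft_id A B := Hom.ext (MonoidalCategory.whiskerLeft_id A.obj B.obj)
  id_whiskerRight A B := Hom.ext (MonoidalCategory.id_whiskerRight A.obj B.obj)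
  associator_naturality f g h := Hom.ext (MonoidalCategory.associator_naturality f.f g.f h.f)
  leftUnitor_naturality f := Hom.ext (MonoidalCategory.leftUnitor_naturality f.f)
  rightUnitor_naturality f := Hom.ext (MonoidalCategory.rightUnitor_naturality f.f)
  pentagon A B D E := Hom.ext (MonoidalCategory.pentagon A.obj B.obj D.obj E.obj)
  triangle A B := Hom.ext (MonoidalCategory.triangle A.obj B.obj)

@[simp] lemma tensor_obj (A B : RelCenter P) : (A ⊗ B).obj = A.obj ⊗ B.obj := rfl

@[simp] lemma unit_obj : (𝟙_ (RelCenter P)).obj = 𝟙_ C := rfl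

/-- The half braiding with the unit object is trivial. -/
lemma β_unit (A : RelCenter P) (h : P (𝟙_ C)) (h' : P (𝟙_ C ⊗ 𝟙_ C)) :
    (A.β (𝟙_ C) h).hom = (ρ_ _).hom ≫ (λ_ _).inv := by
  have e1 := A.monoidal h h h'
  have e2 := A.naturality h' h (λ_ (𝟙_ C)).hom
  rw [e1] at e2
  have e3 : A.obj ◁ (λ_ (𝟙_ C)).hom ≫ (A.β (𝟙_ C) h).hom ≫ (λ_ A.obj).hom =
      A.obj ◁ (λ_ (𝟙_ C)).hom ≫ (A.β (𝟙_ C) h).hom ≫ (λ_ A.obj).hom ≫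
        (ρ_ A.obj).inv ≫ (A.β (𝟙_ C) h).hom ≫ (λ_ A.obj).hom := by
    have e4 : A.obj ◁ (λ_ (𝟙_ C)).hom ≫ (A.β (𝟙_ C) h).hom ≫ (λ_ A.obj).hom =
        𝟙 _ ⊗≫ (A.β (𝟙_ C) h).hom ▷ 𝟙_ C ⊗≫ 𝟙_ C ◁ (A.β (𝟙_ C) h).hom ⊗≫ 𝟙 _ := by
      rw [reassoc_of% e2]; monoidal
    rw [e4]; monoidal
  have e5 : 𝟙 (A.obj) = (ρ_ A.obj).inv ≫ (A.β (𝟙_ C) h).hom ≫ (λ_ A.obj).hom := by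
    rw [cancel_epi, ← Category.assoc, ← Category.assoc] at e3
    rw [← cancel_epi ((A.β (𝟙_ C) h).hom ≫ (λ_ A.obj).hom), Category.comp_id]
    simpa using e3
  rw [← cancel_epi (ρ_ A.obj).inv, ← cancel_mono (λ_ A.obj).hom, Category.assoc, ← e5]
  simp

end Basic

lemma f_injective {C : Type u} [Category.{v} C] [MonoidalCategory C] {P : ObjectProperty C}
    (A B : RelCenter P) : Function.Injective (fun f : A ⟶ B => (f.f : A.obj ⟶ B.obj)) :=
  fun _ _ h => hom_ext h

section Linear

variable {C : Type u} [Category.{v} C] [Preadditive C] [MonoidalCategory C]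
  [MonoidalPreadditive C] {P : ObjectProperty C}

instance (A B : RelCenter P) : Zero (A ⟶ B) := ⟨{ f := 0, comm := fun X hX => by simp }⟩
instance (A B : RelCenter P) : Add (A ⟶ B) :=
  ⟨fun f g =>
    { f := f.f + g.f
      comm := fun X hX => by
        rw [MonoidalPreadditive.add_whiskerRight, MonoidalPreadditive.whiskerLeft_add,
          Preadditive.add_comp, Preadditive.comp_add, hom_comm f X hX, hom_comm g X hX] }⟩
instance (A B : RelCenter P) : Neg (A ⟶ B) :=
  ⟨fun f =>
    { f := -f.f
      comm := fun X hX => by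
        change (tensorRight X).map (-f.f) ≫ _ = _ ≫ (tensorLeft X).map (-f.f)
        rw [Functor.map_neg, Functor.map_neg, Preadditive.neg_comp, Preadditive.comp_neg]
        exact congrArg (fun z => -z) (hom_comm f X hX) }⟩
instance (A B : RelCenter P) : Sub (A ⟶ B) :=
  ⟨fun f g =>
    { f := f.f - g.f
      comm := fun X hX => by
        change (tensorRight X).map (f.f - g.f) ≫ _ = _ ≫ (tensorLeft X).map (f.f - g.f)
        rw [Functor.map_sub, Functor.map_sub, Preadditive.sub_comp, Preadditive.comp_sub]
        exact congrArg₂ (fun z z' => z - z') (hom_comm f X hX) (hom_comm g X hX) }⟩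
instance (A B : RelCenter P) : SMul ℕ (A ⟶ B) :=
  ⟨fun n f =>
    { f := n • f.f
      comm := fun X hX => by
        change (tensorRight X).map (n • f.f) ≫ _ = _ ≫ (tensorLeft X).map (n • f.f)
        rw [Functor.map_nsmul, Functor.map_nsmul, Preadditive.nsmul_comp, Preadditive.comp_nsmul]
        exact congrArg (n • ·) (hom_comm f X hX) }⟩
instance (A B : RelCenter P) : SMul ℤ (A ⟶ B) :=
  ⟨fun n f =>
    { f := n • f.f
      comm := fun X hX => by
        change (tensorRight X).map (n • f.f) ≫ _ = _ ≫ (tensorLeft X).map (n • f.f)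
        rw [Functor.map_zsmul, Functor.map_zsmul, Preadditive.zsmul_comp, Preadditive.comp_zsmul]
        exact congrArg (n • ·) (hom_comm f X hX) }⟩

instance (A B : RelCenter P) : AddCommGroup (A ⟶ B) :=
  Function.Injective.addCommGroup (fun f : A ⟶ B => (f.f : A.obj ⟶ B.obj)) (f_injective A B) rfl
    (fun _ _ => rfl) (fun _ => rfl) (fun _ _ => rfl) (fun _ _ => rfl) (fun _ _ => rfl)

@[simp] lemma zero_f (A B : RelCenter P) : (0 : A ⟶ B).f = 0 := rfl

@[simp] lemma add_f {A B : RelCenter P} (f g : A ⟶ B) : (f + g).f = f.f + g.f := rfl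

/-- Taking the underlying morphism, as an additive map. -/
def fAdd (A B : RelCenter P) : (A ⟶ B) →+ (A.obj ⟶ B.obj) where
  toFun f := f.f
  map_zero' := rfl
  map_add' _ _ := rfl

lemma sum_f {A B : RelCenter P} {J : Type*} (s : Finset J) (g : J → (A ⟶ B)) :
    (∑ j ∈ s, g j).f = ∑ j ∈ s, (g j).f := map_sum (fAdd A B) g s

instance : Preadditive (RelCenter P) where
  add_comp _ _ _ f f' g := hom_ext (Preadditive.add_comp _ _ _ f.f f'.f g.f)
  comp_add _ _ _ f g g' := hom_ext (Preadditive.comp_add _ _ _ f.f g.f g'.f)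

instance : MonoidalPreadditive (RelCenter P) where
  whiskerLeft_zero {A _ _} := hom_ext (MonoidalPreadditive.whiskerLeft_zero (X := A.obj))
  zero_whiskerRight {A _ _} := hom_ext (MonoidalPreadditive.zero_whiskerRight (X := A.obj))
  whiskerLeft_add {A _ _} f g :=
    hom_ext (MonoidalPreadditive.whiskerLeft_add (X := A.obj) f.f g.f)
  add_whiskerRight {A _ _} f g :=
    hom_ext (MonoidalPreadditive.add_whiskerRight (X := A.obj) f.f g.f)

variable {k : Type w} [CommRing k] [CategoryTheory.Linear k C] [MonoidalLinear k C]

instance (A B : RelCenter P) : SMul k (A ⟶ B) :=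
  ⟨fun r f =>
    { f := r • f.f
      comm := fun X hX => by
        rw [MonoidalLinear.smul_whiskerRight, MonoidalLinear.whiskerLeft_smul,
          CategoryTheory.Linear.smul_comp, CategoryTheory.Linear.comp_smul, hom_comm f X hX] }⟩

instance (A B : RelCenter P) : Module k (A ⟶ B) :=
  Function.Injective.module k (fAdd A B) (f_injective A B) (fun _ _ => rfl)

instance : CategoryTheory.Linear k (RelCenter P) where
  smul_comp _ _ _ r f g := hom_ext (CategoryTheory.Linear.smul_comp _ _ _ r f.f g.f)
  comp_smul _ _ _ f r g := hom_ext (CategoryTheory.Linear.comp_smul _ _ _ f.f r g.f)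

instance : MonoidalLinear k (RelCenter P) where
  whiskerLeft_smul A _ _ r f := hom_ext (MonoidalLinear.whiskerLeft_smul A.obj r f.f)
  smul_whiskerRight r _ _ f A := hom_ext (MonoidalLinear.smul_whiskerRight r f.f A.obj)

end Linear

section Inv

variable {C : Type u} [Category.{v} C] [MonoidalCategory C] {P : ObjectProperty C}

lemma inv_naturality (A : RelCenter P) {X Y : C} (hX : P X) (hY : P Y) (f : X ⟶ Y) :
    (A.β X hX).inv ≫ A.obj ◁ f = f ▷ A.obj ≫ (A.β Y hY).inv := by
  rw [Iso.inv_comp_eq, ← Category.assoc, Iso.eq_comp_inv, A.naturality hX hY]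

lemma inv_monoidal (A : RelCenter P) {X Y : C} (hX : P X) (hY : P Y) (hXY : P (X ⊗ Y)) :
    (A.β (X ⊗ Y) hXY).inv = (α_ _ _ _).hom ≫ X ◁ (A.β Y hY).inv ≫ (α_ _ _ _).inv ≫
      (A.β X hX).inv ▷ Y ≫ (α_ _ _ _).hom := by
  rw [← cancel_epi (A.β (X ⊗ Y) hXY).hom, Iso.hom_inv_id, A.monoidal hX hY]
  simp

end Inv

section Dual

variable {C : Type u} [Category.{v} C] [MonoidalCategory C] [PivotalCat C]
  {P : ObjectProperty C}

/-- The half braiding `σ†_X : A* ⊗ X ⟶ X ⊗ A*` of the dual: the partial transpose of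
`σ_X⁻¹`. -/
def dualβHom (A : RelCenter P) (X : C) (hX : P X) : dual A.obj ⊗ X ⟶ X ⊗ dual A.obj :=
  (ρ_ _).inv ≫ (dual A.obj ⊗ X) ◁ coev A.obj ≫ (α_ _ _ _).hom ≫
    dual A.obj ◁ ((α_ _ _ _).inv ≫ (A.β X hX).inv ▷ dual A.obj ≫ (α_ _ _ _).hom) ≫
      (α_ _ _ _).inv ≫ ev A.obj ▷ (X ⊗ dual A.obj) ≫ (λ_ _).hom

/-- The inverse of `σ†_X`: the other partial transpose of `σ_X`. -/
def dualβInv (A : RelCenter P) (X : C) (hX : P X) : X ⊗ dual A.obj ⟶ dual A.obj ⊗ X :=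
  (λ_ _).inv ≫ coevR A.obj ▷ (X ⊗ dual A.obj) ≫ (α_ _ _ _).hom ≫
    dual A.obj ◁ ((α_ _ _ _).inv ≫ (A.β X hX).hom ▷ dual A.obj ≫ (α_ _ _ _).hom) ≫
      dual A.obj ◁ X ◁ evR A.obj ≫ dual A.obj ◁ (ρ_ _).hom

lemma dualβHom_naturality (A : RelCenter P) {X Y : C} (hX : P X) (hY : P Y) (f : X ⟶ Y) :
    dual A.obj ◁ f ≫ dualβHom A Y hY = dualβHom A X hX ≫ f ▷ dual A.obj := by
  unfold dualβHom
  calc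
    _ = 𝟙 _ ⊗≫ dual A.obj ◁ (f ▷ 𝟙_ C ≫ Y ◁ coev A.obj) ⊗≫
          dual A.obj ◁ (A.β Y hY).inv ▷ dual A.obj ⊗≫ ev A.obj ▷ (Y ⊗ dual A.obj) ⊗≫ 𝟙 _ := by
        monoidal
    _ = 𝟙 _ ⊗≫ dual A.obj ◁ (X ◁ coev A.obj) ⊗≫
          dual A.obj ◁ (f ▷ A.obj ≫ (A.β Y hY).inv) ▷ dual A.obj ⊗≫
            ev A.obj ▷ (Y ⊗ dual A.obj) ⊗≫ 𝟙 _ := by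
        rw [← whisker_exchange]; monoidal
    _ = 𝟙 _ ⊗≫ dual A.obj ◁ (X ◁ coev A.obj) ⊗≫
          dual A.obj ◁ (A.β X hX).inv ▷ dual A.obj ⊗≫
            ((dual A.obj ⊗ A.obj) ◁ (f ▷ dual A.obj) ≫ ev A.obj ▷ (Y ⊗ dual A.obj)) ⊗≫ 𝟙 _ := by
        rw [← inv_naturality A hX hY]; monoidal
    _ = _ := by rw [whisker_exchange]; monoidal

lemma dualβHom_monoidal (A : RelCenter P) {X Y : C} (hX : P X) (hY : P Y) (hXY : P (X ⊗ Y)) :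
    dualβHom A (X ⊗ Y) hXY = (α_ _ _ _).inv ≫ dualβHom A X hX ▷ Y ≫ (α_ _ _ _).hom ≫
      X ◁ dualβHom A Y hY ≫ (α_ _ _ _).inv := by
  have key := zigzag A.obj
  symm
  unfold dualβHom
  calc
    _ = 𝟙 _ ⊗≫ dual A.obj ◁ X ◁ coev A.obj ▷ Y ⊗≫
          dual A.obj ◁ (A.β X hX).inv ▷ dual A.obj ▷ Y ⊗≫
          ((ev A.obj ▷ (X ⊗ dual A.obj ⊗ Y)) ≫ 𝟙_ C ◁ (X ◁ dual A.obj ◁ ((ρ_ Y).inv ≫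
            Y ◁ coev A.obj ≫ (α_ _ _ _).inv ≫ (A.β Y hY).inv ▷ dual A.obj ≫ (α_ _ _ _).hom))) ⊗≫
          X ◁ ev A.obj ▷ (Y ⊗ dual A.obj) ⊗≫ 𝟙 _ := by monoidal
    _ = 𝟙 _ ⊗≫ dual A.obj ◁ X ◁ coev A.obj ▷ Y ⊗≫
          dual A.obj ◁ ((A.β X hX).inv ▷ (dual A.obj ⊗ Y) ≫ (A.obj ⊗ X) ◁ (dual A.obj ◁ ((ρ_ Y).inv ≫
            Y ◁ coev A.obj ≫ (α_ _ _ _).inv ≫ (A.β Y hY).inv ▷ dual A.obj ≫ (α_ _ _ _).hom))) ⊗≫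
          (ev A.obj ▷ (X ⊗ (dual A.obj ⊗ A.obj) ⊗ Y ⊗ dual A.obj) ≫ 𝟙_ C ◁
          X ◁ ev A.obj ▷ (Y ⊗ dual A.obj)) ⊗≫ 𝟙 _ := by rw [← whisker_exchange]; monoidal
    _ = 𝟙 _ ⊗≫ dual A.obj ◁ X ◁ (coev A.obj ▷ Y ≫ (A.obj ⊗ dual A.obj) ◁ ((ρ_ Y).inv ≫
            Y ◁ coev A.obj ≫ (α_ _ _ _).inv ≫ (A.β Y hY).inv ▷ dual A.obj ≫ (α_ _ _ _).hom)) ⊗≫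
          dual A.obj ◁ ((A.β X hX).inv ▷ ((dual A.obj ⊗ A.obj) ⊗ (Y ⊗ dual A.obj)) ≫
            (A.obj ⊗ X) ◁ ev A.obj ▷ (Y ⊗ dual A.obj)) ⊗≫
          ev A.obj ▷ (X ⊗ Y ⊗ dual A.obj) ⊗≫ 𝟙 _ := by
        rw [← whisker_exchange, ← whisker_exchange]; monoidal
    _ = 𝟙 _ ⊗≫ dual A.obj ◁ X ◁ (𝟙_ C ◁ ((ρ_ Y).inv ≫
            Y ◁ coev A.obj ≫ (α_ _ _ _).inv ≫ (A.β Y hY).inv ▷ dual A.obj ≫ (α_ _ _ _).hom)) ⊗≫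
          dual A.obj ◁ X ◁ ((λ_ _).inv ≫ coev A.obj ▷ A.obj ≫ (α_ _ _ _).hom ≫ A.obj ◁ ev A.obj ≫
            (ρ_ _).hom) ▷ (Y ⊗ dual A.obj) ⊗≫
          dual A.obj ◁ ((A.β X hX).inv ▷ (Y ⊗ dual A.obj)) ⊗≫
          ev A.obj ▷ (X ⊗ Y ⊗ dual A.obj) ⊗≫ 𝟙 _ := by
        rw [← whisker_exchange, ← whisker_exchange]; monoidal
    _ = _ := by
        rw [key, inv_monoidal A hX hY]; monoidal

lemma dualβHom_unit (A : RelCenter P) (h : P (𝟙_ C)) (h' : P (𝟙_ C ⊗ 𝟙_ C)) :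
    dualβHom A (𝟙_ C) h = (ρ_ _).hom ≫ (λ_ _).inv := by
  have e : (A.β (𝟙_ C) h).inv = (λ_ _).hom ≫ (ρ_ _).inv := by
    rw [← cancel_epi (A.β (𝟙_ C) h).hom, Iso.hom_inv_id, β_unit A h h']
    simp
  have key := zigzag_dual A.obj
  unfold dualβHom
  rw [e]
  calc
    _ = 𝟙 _ ⊗≫ ((ρ_ _).inv ≫ dual A.obj ◁ coev A.obj ≫ (α_ _ _ _).inv ≫ ev A.obj ▷ dual A.obj ≫
      (λ_ _).hom) ⊗≫ 𝟙 _ := by monoidal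
    _ = _ := by rw [key]; monoidal

/-- The inverse of `σ†_X` expressed through `σ†_{X*}`. -/
def dualβAux (A : RelCenter P) (X : C) (hX' : P (dual X)) :
    X ⊗ dual A.obj ⟶ dual A.obj ⊗ X :=
  𝟙 _ ⊗≫ (X ⊗ dual A.obj) ◁ coevR X ⊗≫ X ◁ dualβHom A (dual X) hX' ▷ X ⊗≫
    evR X ▷ (dual A.obj ⊗ X) ⊗≫ 𝟙 _

lemma dualβHom_aux [P.IsMonoidal] (A : RelCenter P) (X : C) (hX : P X) (hX' : P (dual X)) :
    dualβHom A X hX ≫ dualβAux A X hX' = 𝟙 _ := by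
  have h1 : P (𝟙_ C) := P.prop_unit
  have h2 : P (X ⊗ dual X) := ObjectProperty.prop_tensor hX hX'
  have key := zigzagR X
  unfold dualβAux
  calc
    _ = 𝟙 _ ⊗≫ (dualβHom A X hX ▷ 𝟙_ C ≫ (X ⊗ dual A.obj) ◁ coevR X) ⊗≫
          X ◁ dualβHom A (dual X) hX' ▷ X ⊗≫ evR X ▷ (dual A.obj ⊗ X) ⊗≫ 𝟙 _ := by monoidal
    _ = 𝟙 _ ⊗≫ dual A.obj ◁ X ◁ coevR X ⊗≫ (((α_ _ _ _).inv ≫ dualβHom A X hX ▷ dual X ≫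
          (α_ _ _ _).hom ≫ X ◁ dualβHom A (dual X) hX' ≫ (α_ _ _ _).inv) ≫ evR X ▷ dual A.obj) ▷ X
            ⊗≫ 𝟙 _ := by rw [← whisker_exchange]; monoidal
    _ = 𝟙 _ ⊗≫ dual A.obj ◁ ((ρ_ _).inv ≫ X ◁ coevR X ≫ (α_ _ _ _).inv ≫ evR X ▷ X ≫ (λ_ X).hom)
          ⊗≫ 𝟙 _ := by
        rw [← dualβHom_monoidal A hX hX' h2, ← dualβHom_naturality A h2 h1,
          dualβHom_unit A h1 (ObjectProperty.prop_tensor h1 h1)]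
        monoidal
    _ = _ := by rw [key]; monoidal

lemma dualβAux_hom [P.IsMonoidal] (A : RelCenter P) (X : C) (hX : P X) (hX' : P (dual X)) :
    dualβAux A X hX' ≫ dualβHom A X hX = 𝟙 _ := by
  have h1 : P (𝟙_ C) := P.prop_unit
  have h2 : P (dual X ⊗ X) := ObjectProperty.prop_tensor hX' hX
  have key := zigzagR X
  unfold dualβAux
  calc
    _ = 𝟙 _ ⊗≫ (X ⊗ dual A.obj) ◁ coevR X ⊗≫ X ◁ dualβHom A (dual X) hX' ▷ X ⊗≫
          (evR X ▷ (dual A.obj ⊗ X) ≫ 𝟙_ C ◁ dualβHom A X hX) ⊗≫ 𝟙 _ := by monoidal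
    _ = 𝟙 _ ⊗≫ X ◁ (dual A.obj ◁ coevR X ≫ ((α_ _ _ _).inv ≫ dualβHom A (dual X) hX' ▷ X ≫
          (α_ _ _ _).hom ≫ dual X ◁ dualβHom A X hX ≫ (α_ _ _ _).inv)) ⊗≫
          evR X ▷ (X ⊗ dual A.obj) ⊗≫ 𝟙 _ := by rw [← whisker_exchange]; monoidal
    _ = 𝟙 _ ⊗≫ ((ρ_ _).inv ≫ X ◁ coevR X ≫ (α_ _ _ _).inv ≫ evR X ▷ X ≫ (λ_ X).hom) ▷ dual A.obj
          ⊗≫ 𝟙 _ := by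
        rw [← dualβHom_monoidal A hX' hX h2, dualβHom_naturality A h1 h2,
          dualβHom_unit A h1 (ObjectProperty.prop_tensor h1 h1)]
        monoidal
    _ = _ := by rw [key]; monoidal

/-- The transpose of `dualβInv` with respect to `X`. -/
def dualβRot (A : RelCenter P) (X : C) (hX : P X) :
    dual A.obj ⊗ dual X ⟶ dual X ⊗ dual A.obj :=
  𝟙 _ ⊗≫ coevR X ▷ (dual A.obj ⊗ dual X) ⊗≫ dual X ◁ dualβInv A X hX ▷ dual X ⊗≫
    (dual X ⊗ dual A.obj) ◁ evR X ⊗≫ 𝟙 _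

lemma dualβHom_evTensor [P.IsMonoidal] (A : RelCenter P) (X : C) (hX : P X) (hX' : P (dual X)) :
    dualβHom A (dual X) hX' ▷ (A.obj ⊗ X) ≫ evTensor X A.obj =
      (dual A.obj ⊗ dual X) ◁ (A.β X hX).hom ≫ evTensor A.obj X := by
  have h1 : P (𝟙_ C) := P.prop_unit
  have h2 : P (dual X ⊗ X) := ObjectProperty.prop_tensor hX' hX
  have key := zigzag A.obj
  have e : (A.β (𝟙_ C) h1).inv = (λ_ _).hom ≫ (ρ_ _).inv := by
    rw [← cancel_epi (A.β (𝟙_ C) h1).hom, Iso.hom_inv_id,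
      β_unit A h1 (ObjectProperty.prop_tensor h1 h1)]
    simp
  have nat : (α_ _ _ _).inv ≫ (A.β (dual X) hX').inv ▷ X ≫ (α_ _ _ _).hom ≫ A.obj ◁ ev X =
      dual X ◁ (A.β X hX).hom ≫ (α_ _ _ _).inv ≫ ev X ▷ A.obj ≫ (λ_ _).hom ≫ (ρ_ _).inv := by
    have n := inv_naturality A h2 h1 (ev X)
    rw [inv_monoidal A hX' hX h2, e] at n
    rw [← n]
    simp
  calc
    _ = 𝟙 _ ⊗≫ dual A.obj ◁ dual X ◁ coev A.obj ▷ (A.obj ⊗ X) ⊗≫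
          dual A.obj ◁ (A.β (dual X) hX').inv ▷ (dual A.obj ⊗ A.obj ⊗ X) ⊗≫
          (ev A.obj ▷ (dual X ⊗ (dual A.obj ⊗ A.obj) ⊗ X) ≫ 𝟙_ C ◁ dual X ◁ ev A.obj ▷ X) ⊗≫
            ev X ⊗≫ 𝟙 _ := by
        unfold dualβHom evTensor; monoidal
    _ = 𝟙 _ ⊗≫ dual A.obj ◁ dual X ◁ coev A.obj ▷ (A.obj ⊗ X) ⊗≫
          dual A.obj ◁ ((A.β (dual X) hX').inv ▷ ((dual A.obj ⊗ A.obj) ⊗ X) ≫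
            (A.obj ⊗ dual X) ◁ ev A.obj ▷ X) ⊗≫
            (ev A.obj ▷ (dual X ⊗ X) ≫ 𝟙_ C ◁ ev X) ⊗≫ 𝟙 _ := by
        rw [← whisker_exchange]; monoidal
    _ = 𝟙 _ ⊗≫ dual A.obj ◁ dual X ◁ ((λ_ _).inv ≫ coev A.obj ▷ A.obj ≫ (α_ _ _ _).hom ≫
          A.obj ◁ ev A.obj ≫ (ρ_ _).hom) ▷ X ⊗≫
          dual A.obj ◁ ((α_ _ _ _).inv ≫ (A.β (dual X) hX').inv ▷ X ≫ (α_ _ _ _).hom ≫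
            A.obj ◁ ev X) ⊗≫ ev A.obj ⊗≫ 𝟙 _ := by
        rw [← whisker_exchange, ← whisker_exchange]; monoidal
    _ = _ := by
        rw [key, nat]; unfold evTensor; monoidal

lemma dualβInv_evR (A : RelCenter P) (X : C) (hX : P X) :
    A.obj ◁ dualβInv A X hX ⊗≫ evR A.obj ▷ X ⊗≫ 𝟙 X =
      𝟙 _ ⊗≫ (A.β X hX).hom ▷ dual A.obj ⊗≫ X ◁ evR A.obj ⊗≫ 𝟙 X := by
  have kA := zigzagR A.obj
  unfold dualβInv
  calc
    _ = 𝟙 _ ⊗≫ A.obj ◁ coevR A.obj ▷ (X ⊗ dual A.obj) ⊗≫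
          ((A.obj ⊗ dual A.obj) ◁ ((A.β X hX).hom ▷ dual A.obj ≫ (α_ _ _ _).hom ≫
            X ◁ evR A.obj ≫ (ρ_ _).hom) ≫ evR A.obj ▷ X) ⊗≫ 𝟙 _ := by monoidal
    _ = 𝟙 _ ⊗≫ ((ρ_ _).inv ≫ A.obj ◁ coevR A.obj ≫ (α_ _ _ _).inv ≫ evR A.obj ▷ A.obj ≫
          (λ_ _).hom) ▷ (X ⊗ dual A.obj) ⊗≫ (A.β X hX).hom ▷ dual A.obj ⊗≫ X ◁ evR A.obj
            ⊗≫ 𝟙 _ := by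
        rw [whisker_exchange]; monoidal
    _ = _ := by rw [kA]; monoidal

lemma coevR_dualβInv (A : RelCenter P) (X : C) (hX : P X) :
    𝟙 X ⊗≫ X ◁ coevR A.obj ⊗≫ dualβInv A X hX ▷ A.obj ⊗≫
        𝟙 (dual A.obj ⊗ X ⊗ A.obj) =
      𝟙 X ⊗≫ coevR A.obj ▷ X ⊗≫ dual A.obj ◁ (A.β X hX).hom ⊗≫
        𝟙 (dual A.obj ⊗ X ⊗ A.obj) := by
  have kA := zigzagR A.obj
  unfold dualβInv
  calc
    _ = 𝟙 _ ⊗≫ (𝟙_ C ◁ X ◁ coevR A.obj ≫ coevR A.obj ▷ (X ⊗ dual A.obj ⊗ A.obj)) ⊗≫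
          dual A.obj ◁ (A.β X hX).hom ▷ (dual A.obj ⊗ A.obj) ⊗≫
          dual A.obj ◁ X ◁ evR A.obj ▷ A.obj ⊗≫ 𝟙 _ := by monoidal
    _ = 𝟙 _ ⊗≫ coevR A.obj ▷ X ⊗≫ dual A.obj ◁ ((A.obj ⊗ X) ◁ coevR A.obj ≫
          (A.β X hX).hom ▷ (dual A.obj ⊗ A.obj)) ⊗≫
          dual A.obj ◁ X ◁ evR A.obj ▷ A.obj ⊗≫ 𝟙 _ := by rw [whisker_exchange]; monoidal
    _ = 𝟙 _ ⊗≫ coevR A.obj ▷ X ⊗≫ dual A.obj ◁ (A.β X hX).hom ⊗≫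
          dual A.obj ◁ X ◁ ((ρ_ _).inv ≫ A.obj ◁ coevR A.obj ≫ (α_ _ _ _).inv ≫
            evR A.obj ▷ A.obj ≫ (λ_ _).hom) ⊗≫ 𝟙 _ := by rw [whisker_exchange]; monoidal
    _ = _ := by rw [kA]; monoidal

lemma evRTensor_dualβRot (A : RelCenter P) (X : C) (hX : P X) :
    (A.obj ⊗ X) ◁ dualβRot A X hX ≫ evRTensor X A.obj =
      (A.β X hX).hom ▷ (dual A.obj ⊗ dual X) ≫ evRTensor A.obj X := by
  have kX := zigzagR X
  unfold dualβRot
  calc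
    _ = 𝟙 _ ⊗≫ A.obj ◁ X ◁ coevR X ▷ (dual A.obj ⊗ dual X) ⊗≫
          A.obj ◁ ((X ⊗ dual X) ◁ (dualβInv A X hX ▷ dual X ≫ (α_ _ _ _).hom ≫
            dual A.obj ◁ evR X ≫ (ρ_ _).hom) ≫ evR X ▷ dual A.obj) ⊗≫ evR A.obj ⊗≫ 𝟙 _ := by
        unfold evRTensor; monoidal
    _ = 𝟙 _ ⊗≫ A.obj ◁ ((ρ_ _).inv ≫ X ◁ coevR X ≫ (α_ _ _ _).inv ≫ evR X ▷ X ≫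
            (λ_ _).hom) ▷ (dual A.obj ⊗ dual X) ⊗≫
          A.obj ◁ dualβInv A X hX ▷ dual X ⊗≫
            ((A.obj ⊗ dual A.obj) ◁ evR X ≫ evR A.obj ▷ 𝟙_ C) ⊗≫ 𝟙 _ := by
        rw [whisker_exchange]; monoidal
    _ = 𝟙 _ ⊗≫ (A.obj ◁ dualβInv A X hX ⊗≫ evR A.obj ▷ X ⊗≫ 𝟙 X) ▷ dual X ⊗≫ evR X ⊗≫ 𝟙 _ := by
        rw [kX, whisker_exchange]; monoidal
    _ = _ := by
        rw [dualβInv_evR]; unfold evRTensor; monoidal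

lemma dualβRot_eq [P.IsMonoidal] (A : RelCenter P) (X : C) (hX : P X) (hX' : P (dual X)) :
    dualβHom A (dual X) hX' = dualβRot A X hX :=
  rotation_eq (A.β X hX).hom _ _ (dualβHom_evTensor A X hX hX') (evRTensor_dualβRot A X hX)

lemma dualβAux_eq [P.IsMonoidal] (A : RelCenter P) (X : C) (hX : P X) (hX' : P (dual X)) :
    dualβAux A X hX' = dualβInv A X hX := by
  have kX := zigzagR X
  unfold dualβAux
  rw [dualβRot_eq A X hX hX']
  unfold dualβRot
  calc
    _ = 𝟙 _ ⊗≫ X ◁ (𝟙_ C ◁ (dual A.obj ◁ coevR X) ≫ coevR X ▷ (dual A.obj ⊗ dual X ⊗ X)) ⊗≫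
          X ◁ dual X ◁ (dualβInv A X hX ▷ (dual X ⊗ X)) ⊗≫
          ((X ⊗ dual X) ◁ (dual A.obj ◁ evR X ▷ X) ≫ evR X ▷ (dual A.obj ⊗ 𝟙_ C ⊗ X)) ⊗≫ 𝟙 _ := by
        monoidal
    _ = 𝟙 _ ⊗≫ X ◁ coevR X ▷ dual A.obj ⊗≫ X ◁ dual X ◁ ((X ⊗ dual A.obj) ◁ coevR X ≫
          dualβInv A X hX ▷ (dual X ⊗ X)) ⊗≫
          evR X ▷ (dual A.obj ⊗ X ⊗ dual X ⊗ X) ⊗≫ dual A.obj ◁ evR X ▷ X ⊗≫ 𝟙 _ := by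
        rw [whisker_exchange, whisker_exchange]; monoidal
    _ = 𝟙 _ ⊗≫ X ◁ coevR X ▷ dual A.obj ⊗≫ ((X ⊗ dual X) ◁ (dualβInv A X hX ≫
          dual A.obj ◁ ((ρ_ _).inv ≫ X ◁ coevR X)) ≫
          evR X ▷ (dual A.obj ⊗ X ⊗ dual X ⊗ X)) ⊗≫ dual A.obj ◁ evR X ▷ X ⊗≫ 𝟙 _ := by
        rw [whisker_exchange (dualβInv A X hX)]; monoidal
    _ = 𝟙 _ ⊗≫ ((ρ_ _).inv ≫ X ◁ coevR X ≫ (α_ _ _ _).inv ≫ evR X ▷ X ≫ (λ_ _).hom) ▷ dual A.obj ⊗≫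
          dualβInv A X hX ⊗≫
          dual A.obj ◁ ((ρ_ _).inv ≫ X ◁ coevR X ≫ (α_ _ _ _).inv ≫ evR X ▷ X ≫ (λ_ _).hom) ⊗≫
            𝟙 _ := by
        rw [whisker_exchange]; monoidal
    _ = _ := by rw [kX]; monoidal

/-- The property `P` is stable under duality. -/
class DualClosed (P : ObjectProperty C) : Prop where
  prop_dual (X : C) (hX : P X) : P (dual X)

variable [P.IsMonoidal] [DualClosed P]

/-- The dual half braiding `(A, σ)* = (A*, σ†)`. -/
def dualObj (A : RelCenter P) : RelCenter P where
  obj := dual A.obj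
  β X hX :=
    { hom := dualβHom A X hX
      inv := dualβInv A X hX
      hom_inv_id := by
        rw [← dualβAux_eq A X hX (DualClosed.prop_dual X hX), dualβHom_aux]
      inv_hom_id := by
        rw [← dualβAux_eq A X hX (DualClosed.prop_dual X hX), dualβAux_hom] }
  naturality := dualβHom_naturality A
  monoidal := dualβHom_monoidal A

lemma dual_ev_comm (A : RelCenter P) (X : C) (hX : P X) :
    ev A.obj ▷ X ≫ ((λ_ X).hom ≫ (ρ_ X).inv) =
      (tensorβ (dualObj A) A X hX).hom ≫ X ◁ ev A.obj := by
  have key := zigzag A.obj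
  symm
  change ((α_ (dual A.obj) A.obj X).hom ≫ dual A.obj ◁ (A.β X hX).hom ≫ (α_ _ _ _).inv ≫
      dualβHom A X hX ▷ A.obj ≫ (α_ _ _ _).hom) ≫ X ◁ ev A.obj = _
  unfold dualβHom
  calc
    _ = 𝟙 _ ⊗≫ dual A.obj ◁ (A.β X hX).hom ⊗≫ dual A.obj ◁ X ◁ coev A.obj ▷ A.obj ⊗≫
          dual A.obj ◁ (A.β X hX).inv ▷ (dual A.obj ⊗ A.obj) ⊗≫
          (ev A.obj ▷ (X ⊗ dual A.obj ⊗ A.obj) ≫ 𝟙_ C ◁ X ◁ ev A.obj) ⊗≫ 𝟙 _ := by monoidal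
    _ = 𝟙 _ ⊗≫ dual A.obj ◁ (A.β X hX).hom ⊗≫ dual A.obj ◁ X ◁ coev A.obj ▷ A.obj ⊗≫
          dual A.obj ◁ ((A.β X hX).inv ▷ (dual A.obj ⊗ A.obj) ≫ (A.obj ⊗ X) ◁ ev A.obj) ⊗≫
          ev A.obj ▷ X ⊗≫ 𝟙 _ := by rw [← whisker_exchange]; monoidal
    _ = 𝟙 _ ⊗≫ dual A.obj ◁ (A.β X hX).hom ⊗≫ dual A.obj ◁ X ◁ ((λ_ _).inv ≫ coev A.obj ▷ A.obj ≫
          (α_ _ _ _).hom ≫ A.obj ◁ ev A.obj ≫ (ρ_ _).hom) ⊗≫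
          dual A.obj ◁ (A.β X hX).inv ⊗≫
          ev A.obj ▷ X ⊗≫ 𝟙 _ := by rw [← whisker_exchange]; monoidal
    _ = 𝟙 _ ⊗≫ dual A.obj ◁ ((A.β X hX).hom ≫ (A.β X hX).inv) ⊗≫ ev A.obj ▷ X ⊗≫ 𝟙 _ := by
        rw [key]; monoidal
    _ = _ := by rw [Iso.hom_inv_id]; monoidal

lemma dual_coev_comm (A : RelCenter P) (X : C) (hX : P X) :
    coev A.obj ▷ X ≫ (tensorβ A (dualObj A) X hX).hom =
      ((λ_ X).hom ≫ (ρ_ X).inv) ≫ X ◁ coev A.obj := by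
  have key := zigzag A.obj
  change coev A.obj ▷ X ≫ ((α_ A.obj (dual A.obj) X).hom ≫ A.obj ◁ dualβHom A X hX ≫
    (α_ _ _ _).inv ≫ (A.β X hX).hom ▷ dual A.obj ≫ (α_ _ _ _).hom) = _
  unfold dualβHom
  calc
    _ = 𝟙 _ ⊗≫ (coev A.obj ▷ (X ⊗ 𝟙_ C) ≫ (A.obj ⊗ dual A.obj) ◁ (X ◁ coev A.obj ≫ (α_ _ _ _).inv ≫
          (A.β X hX).inv ▷ dual A.obj)) ⊗≫
          A.obj ◁ ev A.obj ▷ (X ⊗ dual A.obj) ⊗≫ (A.β X hX).hom ▷ dual A.obj ⊗≫ 𝟙 _ := by monoidal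
    _ = 𝟙 _ ⊗≫ X ◁ coev A.obj ⊗≫ (A.β X hX).inv ▷ dual A.obj ⊗≫
          ((λ_ _).inv ≫ coev A.obj ▷ A.obj ≫ (α_ _ _ _).hom ≫ A.obj ◁ ev A.obj ≫ (ρ_ _).hom) ▷
            (X ⊗ dual A.obj) ⊗≫ (A.β X hX).hom ▷ dual A.obj ⊗≫ 𝟙 _ := by
        rw [← whisker_exchange]; monoidal
    _ = 𝟙 _ ⊗≫ X ◁ coev A.obj ⊗≫ ((A.β X hX).inv ≫ (A.β X hX).hom) ▷ dual A.obj ⊗≫ 𝟙 _ := by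
        rw [key]; monoidal
    _ = _ := by rw [Iso.inv_hom_id]; monoidal

lemma dual_evR_comm (A : RelCenter P) (X : C) (hX : P X) :
    evR A.obj ▷ X ≫ ((λ_ X).hom ≫ (ρ_ X).inv) =
      (tensorβ A (dualObj A) X hX).hom ≫ X ◁ evR A.obj := by
  have h : dualβHom A X hX ≫ dualβInv A X hX = 𝟙 _ := ((dualObj A).β X hX).hom_inv_id
  symm
  change ((α_ A.obj (dual A.obj) X).hom ≫ A.obj ◁ dualβHom A X hX ≫
    (α_ _ _ _).inv ≫ (A.β X hX).hom ▷ dual A.obj ≫ (α_ _ _ _).hom) ≫ X ◁ evR A.obj = _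
  calc
    _ = 𝟙 _ ⊗≫ A.obj ◁ dualβHom A X hX ⊗≫
          (𝟙 (A.obj ⊗ X ⊗ dual A.obj) ⊗≫ (A.β X hX).hom ▷ dual A.obj ⊗≫
            X ◁ evR A.obj ⊗≫ 𝟙 X) ⊗≫ 𝟙 _ := by
        monoidal
    _ = 𝟙 _ ⊗≫ A.obj ◁ (dualβHom A X hX ≫ dualβInv A X hX) ⊗≫ evR A.obj ▷ X ⊗≫ 𝟙 _ := by
        rw [← dualβInv_evR]; monoidal
    _ = _ := by rw [h]; monoidal

lemma dual_coevR_comm (A : RelCenter P) (X : C) (hX : P X) :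
    coevR A.obj ▷ X ≫ (tensorβ (dualObj A) A X hX).hom =
      ((λ_ X).hom ≫ (ρ_ X).inv) ≫ X ◁ coevR A.obj := by
  change coevR A.obj ▷ X ≫ ((α_ (dual A.obj) A.obj X).hom ≫ dual A.obj ◁ (A.β X hX).hom ≫
    (α_ _ _ _).inv ≫ dualβHom A X hX ▷ A.obj ≫ (α_ _ _ _).hom) = _
  have h : dualβInv A X hX ≫ dualβHom A X hX = 𝟙 _ := ((dualObj A).β X hX).inv_hom_id
  calc
    _ = 𝟙 _ ⊗≫ (𝟙 X ⊗≫ coevR A.obj ▷ X ⊗≫ dual A.obj ◁ (A.β X hX).hom ⊗≫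
            𝟙 (dual A.obj ⊗ X ⊗ A.obj)) ⊗≫
          dualβHom A X hX ▷ A.obj ⊗≫ 𝟙 _ := by monoidal
    _ = 𝟙 _ ⊗≫ X ◁ coevR A.obj ⊗≫ (dualβInv A X hX ≫ dualβHom A X hX) ▷ A.obj ⊗≫ 𝟙 _ := by
        rw [← coevR_dualβInv]; monoidal
    _ = _ := by rw [h]; monoidal

/-- The pivotal structure on the relative center, lifted from `C`. -/
instance : PivotalCat (RelCenter P) where
  dual := dualObj
  ev A := { f := ev A.obj, comm := dual_ev_comm A }
  coev A := { f := coev A.obj, comm := dual_coev_comm A }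
  evR A := { f := evR A.obj, comm := dual_evR_comm A }
  coevR A := { f := coevR A.obj, comm := dual_coevR_comm A }
  zigzag A := hom_ext (zigzag A.obj)
  zigzag_dual A := hom_ext (zigzag_dual A.obj)
  zigzagR A := hom_ext (zigzagR A.obj)
  zigzagR_dual A := hom_ext (zigzagR_dual A.obj)
  dualMap_eq f := hom_ext (PivotalCat.dualMap_eq f.f)
  dualTensor_eq A B := hom_ext (PivotalCat.dualTensor_eq A.obj B.obj)
  dualUnit_eq := hom_ext (PivotalCat.dualUnit_eq (C := C))

end Dual

end RelCenter
/-! ### Direct sums of half braidings -/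

namespace RelCenter

section Biproducts

variable {C : Type u} [Category.{v} C] [Preadditive C] [MonoidalCategory C]
  [MonoidalPreadditive C] {P : ObjectProperty C}

lemma bicone_ext {J : Type w} [Fintype J] {F : J → C} (b : Bicone F)
    (tot : ∑ j, b.π j ≫ b.ι j = 𝟙 b.pt) {X T : C} {f g : b.pt ⊗ X ⟶ T}
    (h : ∀ j, b.ι j ▷ X ≫ f = b.ι j ▷ X ≫ g) : f = g := by
  have e (f : b.pt ⊗ X ⟶ T) : f = ∑ j, b.π j ▷ X ≫ b.ι j ▷ X ≫ f := by
    calc f = (∑ j, b.π j ≫ b.ι j) ▷ X ≫ f := by rw [tot]; simp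
      _ = _ := by simp [sum_whiskerRight, Preadditive.sum_comp]
  rw [e f, e g]
  exact Finset.sum_congr rfl fun j _ => by rw [h j]

/-- The half braiding of a direct sum. -/
def biconeβ {J : Type w} [Fintype J] {F : J → RelCenter P} (b : Bicone fun j => (F j).obj)
    (X : C) (hX : P X) : b.pt ⊗ X ⟶ X ⊗ b.pt :=
  ∑ j, b.π j ▷ X ≫ ((F j).β X hX).hom ≫ X ◁ b.ι j

lemma ι_biconeβ {J : Type w} [Fintype J] {F : J → RelCenter P} (b : Bicone fun j => (F j).obj)
    (X : C) (hX : P X) (i : J) :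
    b.ι i ▷ X ≫ biconeβ b X hX = ((F i).β X hX).hom ≫ X ◁ b.ι i := by
  classical
  rw [biconeβ, Preadditive.comp_sum, Finset.sum_eq_single i]
  · rw [← comp_whiskerRight_assoc, bicone_ι_π_self]
    simp
  · intro j _ hj
    rw [← comp_whiskerRight_assoc, bicone_ι_π_ne b (Ne.symm hj)]
    simp
  · simp

/-- The half braiding on the apex of a direct sum diagram. -/
def biconeObj {J : Type w} [Fintype J] (F : J → RelCenter P) (b : Bicone fun j => (F j).obj)
    (tot : ∑ j, b.π j ≫ b.ι j = 𝟙 b.pt) : RelCenter P where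
  obj := b.pt
  β X hX :=
    { hom := biconeβ b X hX
      inv := ∑ j, X ◁ b.π j ≫ ((F j).β X hX).inv ≫ b.ι j ▷ X
      hom_inv_id := by
        classical
        refine bicone_ext b tot fun i => ?_
        rw [reassoc_of% ι_biconeβ, Preadditive.comp_sum, Preadditive.comp_sum,
          Finset.sum_eq_single i]
        · rw [← whiskerLeft_comp_assoc, bicone_ι_π_self]
          simp
        · intro j _ hj
          rw [← whiskerLeft_comp_assoc, bicone_ι_π_ne b (Ne.symm hj)]
          simp
        · simp
      inv_hom_id := by
        rw [Preadditive.sum_comp]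
        simp only [Category.assoc, ι_biconeβ, Iso.inv_hom_id_assoc]
        simp only [← MonoidalCategory.whiskerLeft_comp]
        rw [← whiskerLeft_sum, tot]
        simp }
  naturality {X Y} hX hY f := by
    refine bicone_ext b tot fun i => ?_
    dsimp only
    rw [← whisker_exchange_assoc, ι_biconeβ, reassoc_of% (ι_biconeβ b X hX i),
      ← Category.assoc, (F i).naturality hX hY, Category.assoc, ← whisker_exchange]
  monoidal {X Y} hX hY hXY := by
    refine bicone_ext b tot fun i => ?_
    dsimp only
    rw [ι_biconeβ, (F i).monoidal hX hY]
    calc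
      _ = (α_ _ _ _).inv ≫ ((F i).β X hX).hom ▷ Y ≫ (α_ _ _ _).hom ≫
            X ◁ (((F i).β Y hY).hom ≫ Y ◁ b.ι i) ≫ (α_ _ _ _).inv := by simp
      _ = (α_ _ _ _).inv ≫ (((F i).β X hX).hom ≫ X ◁ b.ι i) ▷ Y ≫ (α_ _ _ _).hom ≫
            X ◁ biconeβ b Y hY ≫ (α_ _ _ _).inv := by rw [← ι_biconeβ]; simp
      _ = _ := by rw [← ι_biconeβ]; simp

lemma biconeβ_π {J : Type w} [Fintype J] {F : J → RelCenter P} (b : Bicone fun j => (F j).obj)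
    (tot : ∑ j, b.π j ≫ b.ι j = 𝟙 b.pt) (X : C) (hX : P X) (j : J) :
    b.π j ▷ X ≫ ((F j).β X hX).hom = biconeβ b X hX ≫ X ◁ b.π j := by
  classical
  refine bicone_ext b tot fun i => ?_
  rw [reassoc_of% ι_biconeβ, ← comp_whiskerRight_assoc, ← MonoidalCategory.whiskerLeft_comp]
  by_cases h : i = j
  · subst h
    rw [bicone_ι_π_self]
    simp
  · rw [bicone_ι_π_ne b h]
    simp

/-- A direct sum diagram of half braidings, lifted from `C`. -/
def biconeLift {J : Type w} [Fintype J] (F : J → RelCenter P) (b : Bicone fun j => (F j).obj)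
    (tot : ∑ j, b.π j ≫ b.ι j = 𝟙 b.pt) : Bicone F where
  pt := biconeObj F b tot
  π j :=
    { f := b.π j
      comm := fun X hX => biconeβ_π b tot X hX j }
  ι j := { f := b.ι j, comm := fun X hX => ι_biconeβ b X hX j }
  ι_π i j := by
    classical
    by_cases h : i = j
    · subst h
      simpa using hom_ext (bicone_ι_π_self b i)
    · simpa [h] using hom_ext (bicone_ι_π_ne b h)

lemma biconeLift_total {J : Type w} [Fintype J] (F : J → RelCenter P)
    (b : Bicone fun j => (F j).obj) (tot : ∑ j, b.π j ≫ b.ι j = 𝟙 b.pt) :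
    ∑ j, (biconeLift F b tot).π j ≫ (biconeLift F b tot).ι j = 𝟙 (biconeLift F b tot).pt := by
  apply hom_ext
  rw [sum_f]
  exact tot

instance [HasFiniteBiproducts C] : HasFiniteBiproducts (RelCenter P) where
  out _ :=
    { has_biproduct := fun F => hasBiproduct_of_total
        (biconeLift F (biproduct.bicone fun j => (F j).obj)
          (IsBilimit.total (biproduct.isBilimit _))) (biconeLift_total _ _ _) }

/-- The half braiding on a direct summand of a half braiding. -/
def summand (A : RelCenter P) {Y : C} (i : Y ⟶ A.obj) (p : A.obj ⟶ Y) (hip : i ≫ p = 𝟙 Y)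
    (h : ∀ (X : C) (hX : P X), (p ≫ i) ▷ X ≫ (A.β X hX).hom = (A.β X hX).hom ≫ X ◁ (p ≫ i)) :
    RelCenter P where
  obj := Y
  β X hX :=
    { hom := i ▷ X ≫ (A.β X hX).hom ≫ X ◁ p
      inv := X ◁ i ≫ (A.β X hX).inv ≫ p ▷ X
      hom_inv_id := by
        have e := h X hX
        calc
          _ = i ▷ X ≫ ((A.β X hX).hom ≫ X ◁ (p ≫ i)) ≫ (A.β X hX).inv ≫ p ▷ X := by simp
          _ = (i ≫ p) ▷ X ≫ (i ≫ p) ▷ X := by rw [← e]; simp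
          _ = _ := by rw [hip]; simp
      inv_hom_id := by
        have e := h X hX
        calc
          _ = X ◁ i ≫ (A.β X hX).inv ≫ ((p ≫ i) ▷ X ≫ (A.β X hX).hom) ≫ X ◁ p := by simp
          _ = X ◁ (i ≫ p) ≫ X ◁ (i ≫ p) := by rw [e]; simp
          _ = _ := by rw [hip]; simp }
  naturality {X Z} hX hZ f := by
    dsimp only
    calc
      _ = i ▷ X ≫ (A.obj ◁ f ≫ (A.β Z hZ).hom) ≫ Z ◁ p := by
        rw [whisker_exchange_assoc]; simp
      _ = i ▷ X ≫ (A.β X hX).hom ≫ (f ▷ A.obj ≫ Z ◁ p) := by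
        rw [A.naturality hX hZ]; simp
      _ = _ := by rw [← whisker_exchange]; simp
  monoidal {X Z} hX hZ hXZ := by
    dsimp only
    rw [A.monoidal hX hZ]
    symm
    calc
      _ = (α_ _ _ _).inv ≫ (i ▷ X) ▷ Z ≫ ((A.β X hX).hom ≫ X ◁ (p ≫ i)) ▷ Z ≫ (α_ _ _ _).hom ≫
            X ◁ (A.β Z hZ).hom ≫ (α_ _ _ _).inv ≫ (X ⊗ Z) ◁ p := by simp
      _ = (α_ _ _ _).inv ≫ (i ≫ p ≫ i) ▷ X ▷ Z ≫ (A.β X hX).hom ▷ Z ≫ (α_ _ _ _).hom ≫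
            X ◁ (A.β Z hZ).hom ≫ (α_ _ _ _).inv ≫ (X ⊗ Z) ◁ p := by rw [← h]; simp
      _ = _ := by rw [reassoc_of% hip]; simp

end Biproducts

end RelCenter

/-! ### `G`-graded categories -/

section Graded

variable (G : Type w) [Group G]

/-- A grading of an additive monoidal category by a group `G`: pairwise disjoint full additive
subcategories `comp α` such that every object is a finite direct sum of homogeneous ones, degrees
multiply under the monoidal product, there are no nonzero morphisms between objects of different
degrees, and the unit object has degree `1`. -/
class GGraded (C : Type u) [Category.{v} C] [Preadditive C] [HasFiniteBiproducts C]
    [MonoidalCategory C] where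
  comp : G → ObjectProperty C
  hasFiniteBiproducts (α : G) : HasFiniteBiproducts (comp α).FullSubcategory
  disjoint {α β : G} (h : α ≠ β) (X : C) (hα : comp α X) : ¬ comp β X
  decomp (X : C) : ∃ (s : Finset G) (Y : s → C),
    (∀ a : s, comp a.1 (Y a)) ∧ Nonempty (X ≅ ⨁ Y)
  tensor_mem {α β : G} {X Y : C} (hX : comp α X) (hY : comp β Y) : comp (α * β) (X ⊗ Y)
  hom_eq_zero {α β : G} (h : α ≠ β) {X Y : C} (hX : comp α X) (hY : comp β Y) (f : X ⟶ Y) : f = 0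
  unit_mem : comp 1 (𝟙_ C)

open GGraded

/-- In a pivotal `G`-graded category, the dual of an object of degree `α` is chosen in
degree `α⁻¹`. -/
class GPivotal (C : Type u) [Category.{v} C] [Preadditive C] [HasFiniteBiproducts C]
    [MonoidalCategory C] [GGraded G C] [PivotalCat C] : Prop where
  dual_mem {α : G} {X : C} (hX : comp α X) : comp α⁻¹ (dual X)

section Neutral

variable (C : Type u) [Category.{v} C] [Preadditive C] [HasFiniteBiproducts C]
    [MonoidalCategory C] [GGraded G C]

/-- The neutral component. -/
abbrev neutral : ObjectProperty C := comp (1 : G)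

instance : (neutral G C).IsMonoidal where
  prop_unit := unit_mem
  prop_tensor X Y hX hY := by simpa using tensor_mem hX hY

instance [PivotalCat C] [GPivotal G C] : RelCenter.DualClosed (neutral G C) where
  prop_dual X hX := by simpa using GPivotal.dual_mem (G := G) hX

/-- The `G`-center of a `G`-graded category: the center relative to the neutral component. -/
abbrev GCenter : Type (max u v) := RelCenter (neutral G C)

variable [MonoidalPreadditive C]

lemma gcenter_hasFiniteBiproducts (α : G) : HasFiniteBiproducts
    (ObjectProperty.FullSubcategory fun A : GCenter G C => comp α A.obj) where
  out _ :=
    { has_biproduct := fun F => by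
        have := GGraded.hasFiniteBiproducts (C := C) α
        let F₁ : _ → (comp (C := C) α).FullSubcategory :=
          fun j => ⟨(F j).obj.obj, (F j).property⟩
        let b₁ := biproduct.bicone F₁
        have tot₁ : ∑ j, b₁.π j ≫ b₁.ι j = 𝟙 b₁.pt := IsBilimit.total (biproduct.isBilimit F₁)
        let b₂ : Bicone fun j => (F j).obj.obj :=
          { pt := b₁.pt.obj
            π := fun j => (b₁.π j).hom
            ι := fun j => (b₁.ι j).hom
            ι_π := fun i j => by
              have e := congrArg (fun f => (comp (C := C) α).ι.map f) (b₁.ι_π i j)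
              by_cases h : i = j
              · subst h
                rw [dif_pos rfl] at e ⊢
                exact e
              · rw [dif_neg h] at e ⊢
                exact e }
        have tot₂ : ∑ j, b₂.π j ≫ b₂.ι j = 𝟙 b₂.pt := by
          have := congrArg (fun f => (comp (C := C) α).ι.map f) tot₁
          exact (Functor.map_sum (comp (C := C) α).ι _ _).symm.trans this
        let b₃ := RelCenter.biconeLift (fun j => (F j).obj) b₂ tot₂
        have tot₃ := RelCenter.biconeLift_total (fun j => (F j).obj) b₂ tot₂
        let b : Bicone F :=
          { pt := ⟨b₃.pt, b₁.pt.property⟩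
            π := fun j => ObjectProperty.homMk (b₃.π j)
            ι := fun j => ObjectProperty.homMk (b₃.ι j)
            ι_π := fun i j => by
              apply (ObjectProperty.ι _).map_injective
              have e := b₃.ι_π i j
              by_cases h : i = j
              · subst h
                rw [dif_pos rfl] at e ⊢
                exact e
              · rw [dif_neg h] at e ⊢
                exact e }
        refine hasBiproduct_of_total b ?_
        apply (ObjectProperty.ι _).map_injective
        rw [Functor.map_sum]
        exact tot₃ }

lemma gcenter_decomp (A : GCenter G C) : ∃ (s : Finset G) (Y : s → GCenter G C),
    (∀ a : s, comp a.1 (Y a).obj) ∧ Nonempty (A ≅ ⨁ Y) := by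
  classical
  obtain ⟨s, Y, hY, ⟨e⟩⟩ := GGraded.decomp (G := G) A.obj
  let i : ∀ a, Y a ⟶ A.obj := fun a => biproduct.ι Y a ≫ e.inv
  let p : ∀ a, A.obj ⟶ Y a := fun a => e.hom ≫ biproduct.π Y a
  have hip : ∀ a, i a ≫ p a = 𝟙 (Y a) := fun a => by simp [i, p]
  have hip' : ∀ a b, a ≠ b → i a ≫ p b = 0 := fun a b h => by simp [i, p, biproduct.ι_π_ne Y h]
  have tot : ∑ a, p a ≫ i a = 𝟙 A.obj := by
    have : ∑ a, p a ≫ i a = e.hom ≫ (∑ a, biproduct.π Y a ≫ biproduct.ι Y a) ≫ e.inv := by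
      simp [i, p, Preadditive.sum_comp, Preadditive.comp_sum]
    have tot' : ∑ a, biproduct.π Y a ≫ biproduct.ι Y a = 𝟙 (⨁ Y) :=
      IsBilimit.total (biproduct.isBilimit Y)
    rw [this, tot']
    simp
  have hzero : ∀ (X : C) (hX : neutral G C X) a b, a ≠ b →
      i a ▷ X ≫ (A.β X hX).hom ≫ X ◁ p b = 0 := fun X hX a b h => by
    refine GGraded.hom_eq_zero (G := G) (α := a.1 * 1) (β := 1 * b.1) ?_
      (tensor_mem (hY a) hX) (tensor_mem hX (hY b)) _
    simpa using fun h' => h (Subtype.ext h')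
  have hcomm : ∀ a (X : C) (hX : neutral G C X),
      (p a ≫ i a) ▷ X ≫ (A.β X hX).hom = (A.β X hX).hom ≫ X ◁ (p a ≫ i a) := fun a X hX => by
    have e1 : (p a ≫ i a) ▷ X ≫ (A.β X hX).hom =
        p a ▷ X ≫ (i a ▷ X ≫ (A.β X hX).hom ≫ X ◁ p a) ≫ X ◁ i a := by
      calc _ = (p a ≫ i a) ▷ X ≫ (A.β X hX).hom ≫ X ◁ (∑ b, p b ≫ i b) := by rw [tot]; simp
        _ = ∑ b, p a ▷ X ≫ (i a ▷ X ≫ (A.β X hX).hom ≫ X ◁ p b) ≫ X ◁ i b := by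
          simp [whiskerLeft_sum, Preadditive.comp_sum]
        _ = _ := by
          rw [Finset.sum_eq_single a]
          · intro b _ hb
            rw [hzero X hX a b (Ne.symm hb)]
            simp
          · simp
    have e2 : (A.β X hX).hom ≫ X ◁ (p a ≫ i a) =
        p a ▷ X ≫ (i a ▷ X ≫ (A.β X hX).hom ≫ X ◁ p a) ≫ X ◁ i a := by
      calc _ = (∑ b, p b ≫ i b) ▷ X ≫ (A.β X hX).hom ≫ X ◁ (p a ≫ i a) := by rw [tot]; simp
        _ = ∑ b, p b ▷ X ≫ (i b ▷ X ≫ (A.β X hX).hom ≫ X ◁ p a) ≫ X ◁ i a := by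
          simp [sum_whiskerRight, Preadditive.sum_comp]
        _ = _ := by
          rw [Finset.sum_eq_single a]
          · intro b _ hb
            rw [hzero X hX b a hb]
            simp
          · simp
    rw [e1, e2]
  let Y' : s → GCenter G C := fun a => RelCenter.summand A (i a) (p a) (hip a) (hcomm a)
  let b : Bicone Y' :=
    { pt := A
      π := fun a =>
        { f := p a
          comm := fun X hX => by
            change p a ▷ X ≫ i a ▷ X ≫ (A.β X hX).hom ≫ X ◁ p a = _
            rw [← comp_whiskerRight_assoc, reassoc_of% (hcomm a X hX),
              ← MonoidalCategory.whiskerLeft_comp, Category.assoc, hip, Category.comp_id]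
            rfl }
      ι := fun a =>
        { f := i a
          comm := fun X hX => by
            change _ = (i a ▷ X ≫ (A.β X hX).hom ≫ X ◁ p a) ≫ X ◁ i a
            rw [Category.assoc, Category.assoc, ← MonoidalCategory.whiskerLeft_comp,
              ← hcomm a X hX, ← comp_whiskerRight_assoc, reassoc_of% (hip a)]
            rfl }
      ι_π := fun a c => by
        by_cases h : a = c
        · subst h
          simpa using RelCenter.hom_ext (hip a)
        · simpa [h] using RelCenter.hom_ext (hip' a c h) }
  have totb : ∑ a, b.π a ≫ b.ι a = 𝟙 b.pt := by
    apply RelCenter.hom_ext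
    rw [RelCenter.sum_f]
    exact tot
  exact ⟨s, Y', hY, ⟨biproduct.uniqueUpToIso Y' (isBilimitOfTotal b totb)⟩⟩

/-- The `G`-grading of the `G`-center: `(A, σ)` has degree `α` if `A` does. -/
instance : GGraded G (GCenter G C) where
  comp α A := comp α A.obj
  hasFiniteBiproducts := gcenter_hasFiniteBiproducts G C
  disjoint h A hα := GGraded.disjoint h A.obj hα
  decomp := gcenter_decomp G C
  tensor_mem hX hY := tensor_mem hX hY
  hom_eq_zero h _ _ hX hY f := RelCenter.hom_ext (hom_eq_zero h hX hY f.f)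
  unit_mem := unit_mem (G := G) (C := C)

instance [PivotalCat C] [GPivotal G C] : GPivotal G (GCenter G C) where
  dual_mem {_ A} hA := GPivotal.dual_mem (G := G) (C := C) (X := A.obj) hA

end Neutral

end Graded


/-! ### Split semisimplicity, sphericity and pre-fusion categories -/

section PreFusion

variable (k : Type w) [CommRing k] {C : Type u} [Category.{v} C] [Preadditive C]
  [CategoryTheory.Linear k C]

/-- An object is simple if its endomorphisms form a free `k`-module of rank one. -/
def IsSimpleObj (i : C) : Prop := Nonempty ((i ⟶ i) ≃ₗ[k] k)

/-- Split semisimplicity: every object is a finite direct sum of simple objects, and there are no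
nonzero morphisms between non-isomorphic simple objects. -/
structure IsSplitSemisimple (C : Type u) [Category.{v} C] [Preadditive C] [HasFiniteBiproducts C]
    [CategoryTheory.Linear k C] : Prop where
  exists_decomp (X : C) : ∃ (n : ℕ) (S : Fin n → C),
    (∀ a, IsSimpleObj k (S a)) ∧ Nonempty (X ≅ ⨁ S)
  hom_eq_zero (i j : C) (hi : IsSimpleObj k i) (hj : IsSimpleObj k j) (hij : ¬ Nonempty (i ≅ j))
    (f : i ⟶ j) : f = 0

/-- `G`-pre-fusion categories, among the pivotal `G`-graded categories over `k`. -/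
structure IsPreFusion (G : Type*) [Group G] (k : Type w) [CommRing k] (C : Type u) [Category.{v} C]
    [Preadditive C] [HasFiniteBiproducts C] [CategoryTheory.Linear k C] [MonoidalCategory C]
    [GGraded G C] : Prop where
  simple_unit : IsSimpleObj k (𝟙_ C)
  splitSemisimple : IsSplitSemisimple k C
  exists_simple (α : G) : ∃ X : C, GGraded.comp α X ∧ IsSimpleObj k X

/-- A pivotal category is spherical if the left and right traces agree. -/
def IsSpherical (C : Type u) [Category.{v} C] [MonoidalCategory C] [PivotalCat C] : Prop :=
  ∀ (X : C) (g : X ⟶ X), trL g = trR g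

end PreFusion

/-! ### Pivotal functors -/

section PivotalFunctor

variable {C : Type u} [Category.{v} C] [MonoidalCategory C] [PivotalCat C]
  {D : Type*} [Category* D] [MonoidalCategory D] [PivotalCat D]

open Functor.LaxMonoidal Functor.OplaxMonoidal

/-- The comparison morphism `F(X*) ⟶ F(X)*` built from the left duality. -/
def compL (F : C ⥤ D) [F.Monoidal] (X : C) : F.obj (dual X) ⟶ dual (F.obj X) :=
  (ρ_ _).inv ≫ F.obj (dual X) ◁ coev (F.obj X) ≫ (α_ _ _ _).inv ≫
    (μ F (dual X) X ≫ F.map (ev X) ≫ η F) ▷ dual (F.obj X) ≫ (λ_ _).hom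

/-- The comparison morphism `F(X*) ⟶ F(X)*` built from the right duality. -/
def compR (F : C ⥤ D) [F.Monoidal] (X : C) : F.obj (dual X) ⟶ dual (F.obj X) :=
  (λ_ _).inv ≫ coevR (F.obj X) ▷ F.obj (dual X) ≫ (α_ _ _ _).hom ≫
    dual (F.obj X) ◁ (μ F X (dual X) ≫ F.map (evR X) ≫ η F) ≫ (ρ_ _).hom

/-- A strong monoidal functor between pivotal categories is pivotal if both comparison morphisms
coincide. -/
def IsPivotalFunctor (F : C ⥤ D) [F.Monoidal] : Prop := ∀ X : C, compL F X = compR F X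

end PivotalFunctor

/-! ### Crossings, `G`-braidings and `G`-ribbon categories -/

section Crossed

open GGraded Functor.LaxMonoidal

variable (G : Type*) [Group G] (k : Type w) [CommRing k] (D : Type u) [Category.{v} D]
  [Preadditive D] [HasFiniteBiproducts D] [CategoryTheory.Linear k D] [MonoidalCategory D]
  [GGraded G D]

/-- A crossing in a `G`-graded category `D` over `k`: a strong monoidal functor from `G`, viewed as
a discrete category with monoidal product `α ⊗ β = β * α`, to the category of `k`-linear strong
monoidal autoequivalences of `D` and monoidal natural isomorphisms, which acts on degrees by
conjugation. The constraint `φ₂(α, β) : φ_α φ_β ≅ φ_{βα}` is `mulIso α β γ h`, where `h` identifies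
`γ` with `β * α`; the constraint `φ₀ : 1 ≅ φ_1` is `oneIso`. -/
structure Crossing where
  F : G → D ⥤ D
  monoidal (α : G) : (F α).Monoidal
  additive (α : G) : (F α).Additive
  linear (α : G) : (F α).Linear k
  isEquivalence (α : G) : (F α).IsEquivalence
  maps {α β : G} {X : D} (hX : comp β X) : comp (α⁻¹ * β * α) ((F α).obj X)
  mulIso (α β γ : G) (h : β * α = γ) : F β ⋙ F α ≅ F γ
  mulIso_monoidal (α β γ : G) (h : β * α = γ) : NatTrans.IsMonoidal (mulIso α β γ h).hom
  oneIso : 𝟭 D ≅ F 1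
  oneIso_monoidal : NatTrans.IsMonoidal oneIso.hom
  mul_assoc (α β γ : G) (X : D) :
    (F α).map ((mulIso β γ (γ * β) rfl).hom.app X) ≫
        (mulIso α (γ * β) (γ * β * α) rfl).hom.app X =
      (mulIso α β (β * α) rfl).hom.app ((F γ).obj X) ≫
        (mulIso (β * α) γ (γ * β * α) (_root_.mul_assoc γ β α).symm).hom.app X
  mul_one (α : G) (X : D) :
    (F α).map (oneIso.hom.app X) ≫ (mulIso α 1 α (one_mul α)).hom.app X = 𝟙 ((F α).obj X)
  one_mul (α : G) (X : D) :
    oneIso.hom.app ((F α).obj X) ≫ (mulIso 1 α α (_root_.mul_one α)).hom.app X = 𝟙 ((F α).obj X)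

attribute [instance] Crossing.monoidal

variable {G k D}

/-- A `G`-braiding: isomorphisms `τ_{X,Y} : X ⊗ Y ≅ Y ⊗ φ_{|Y|}(X)` for `Y` homogeneous, natural in
both variables, with the three compatibility conditions (hexagons in `Y` and in `X`, and
compatibility with the crossing). -/
structure GBraiding (φ : Crossing G k D) where
  τ (X : D) {α : G} (Y : D) (hY : comp α Y) : X ⊗ Y ≅ Y ⊗ (φ.F α).obj X
  naturality_left {X X' : D} (f : X ⟶ X') {α : G} (Y : D) (hY : comp α Y) :
    f ▷ Y ≫ (τ X' Y hY).hom = (τ X Y hY).hom ≫ Y ◁ (φ.F α).map f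
  naturality_right (X : D) {α : G} {Y Y' : D} (hY : comp α Y) (hY' : comp α Y') (f : Y ⟶ Y') :
    X ◁ f ≫ (τ X Y' hY').hom = (τ X Y hY).hom ≫ f ▷ (φ.F α).obj X
  tensor_right (X : D) {β γ : G} {Y Z : D} (hY : comp β Y) (hZ : comp γ Z) :
    (τ X (Y ⊗ Z) (tensor_mem hY hZ)).hom =
      (α_ X Y Z).inv ≫ (τ X Y hY).hom ▷ Z ≫ (α_ _ _ _).hom ≫
        Y ◁ (τ ((φ.F β).obj X) Z hZ).hom ≫ (α_ _ _ _).inv ≫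
          (Y ⊗ Z) ◁ (φ.mulIso γ β (β * γ) rfl).hom.app X
  tensor_left (X Y : D) {γ : G} {Z : D} (hZ : comp γ Z) :
    (τ (X ⊗ Y) Z hZ).hom =
      (α_ X Y Z).hom ≫ X ◁ (τ Y Z hZ).hom ≫ (α_ _ _ _).inv ≫
        (τ X Z hZ).hom ▷ (φ.F γ).obj Y ≫ (α_ _ _ _).hom ≫ Z ◁ μ (φ.F γ) X Y
  crossing (α : G) (X : D) {β : G} {Y : D} (hY : comp β Y) :
    μ (φ.F α) X Y ≫ (φ.F α).map (τ X Y hY).hom =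
      (τ ((φ.F α).obj X) ((φ.F α).obj Y) (φ.maps hY)).hom ≫
        (φ.F α).obj Y ◁ (φ.mulIso (α⁻¹ * β * α) α (β * α) (by group)).hom.app X ≫
        (φ.F α).obj Y ◁ (φ.mulIso α β (β * α) rfl).inv.app X ≫
        μ (φ.F α) Y ((φ.F β).obj X)

lemma Crossing.maps_self (φ : Crossing G k D) {α : G} {X : D} (hX : comp α X) :
    comp α ((φ.F α).obj X) := by
  simpa using φ.maps (α := α) hX

variable [PivotalCat D]

/-- A crossing is pivotal if all its functors are pivotal. -/
def Crossing.IsPivotal (φ : Crossing G k D) : Prop := ∀ α : G, IsPivotalFunctor (φ.F α)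

/-- The twist `θ_X : X ⟶ φ_{|X|}(X)` of a homogeneous object. -/
def twist {φ : Crossing G k D} (τ : GBraiding φ) {α : G} (X : D) (hX : comp α X) :
    X ⟶ (φ.F α).obj X :=
  (λ_ X).inv ≫ coevR X ▷ X ≫ (α_ _ _ _).hom ≫ dual X ◁ (τ.τ X X hX).hom ≫ (α_ _ _ _).inv ≫
    ev X ▷ (φ.F α).obj X ≫ (λ_ _).hom

/-- Self-duality of the twist:
`(θ_X)* = (φ₀)_X* ∘ (φ₂(|X|⁻¹, |X|)_X⁻¹)* ∘ φ¹_{|X|⁻¹}(φ_{|X|}(X)) ∘ θ_{φ_{|X|}(X)*}`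
for all homogeneous objects `X`. -/
def IsSelfDualTwist [GPivotal G D] {φ : Crossing G k D} (τ : GBraiding φ) : Prop :=
  ∀ (α : G) (X : D) (hX : comp α X),
    dualMapL (twist τ X hX) =
      twist τ (dual ((φ.F α).obj X)) (GPivotal.dual_mem (φ.maps_self hX)) ≫
        compL (φ.F α⁻¹) ((φ.F α).obj X) ≫
        dualMapL ((φ.mulIso α⁻¹ α 1 (mul_inv_cancel α)).inv.app X) ≫
        dualMapL (φ.oneIso.hom.app X)

/-- A pivotal `G`-graded category with a crossing and a `G`-braiding is `G`-ribbon if the crossing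
is pivotal and the twist is self-dual. -/
structure IsRibbon [GPivotal G D] (φ : Crossing G k D) (τ : GBraiding φ) : Prop where
  pivotal : φ.IsPivotal
  selfDual : IsSelfDualTwist τ

end Crossed

/-! ### The canonical crossing and `G`-braiding of the `G`-center -/

section Canonical

open GGraded Functor.LaxMonoidal

variable {G : Type*} [Group G] {k : Type w} [CommRing k] {C : Type u} [Category.{v} C]
  [Preadditive C] [HasFiniteBiproducts C] [CategoryTheory.Linear k C] [MonoidalCategory C]
  [PivotalCat C] [GGraded G C] [GPivotal G C]

/-- The class `E_α` of the objects of `C_α` whose left dimension is invertible. -/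
structure InvDim (α : G) (V : C) : Prop where
  mem : comp α V
  isIso : IsIso (dimL V)

/-- The inverse of the left dimension. -/
noncomputable def InvDim.dInv {α : G} {V : C} (hV : InvDim α V) : 𝟙_ C ⟶ 𝟙_ C :=
  have := hV.isIso
  inv (dimL V)

/-- The product of a morphism with an endomorphism of the unit object. -/
def scal (c : 𝟙_ C ⟶ 𝟙_ C) {X Y : C} (f : X ⟶ Y) : X ⟶ Y :=
  (λ_ X).inv ≫ (c ⊗ₘ f) ≫ (λ_ Y).hom

lemma neutral_tensor_dual {α : G} {U V : C} (hV : comp α V) (hU : comp α U) :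
    neutral G C (V ⊗ dual U) := by
  simpa using tensor_mem hV (GPivotal.dual_mem (G := G) hU)

lemma neutral_conj {α : G} {V X : C} (hV : comp α V) (hX : neutral G C X) :
    neutral G C (V ⊗ X ⊗ dual V) := by
  simpa using tensor_mem hV (tensor_mem hX (GPivotal.dual_mem (G := G) hV))

lemma neutral_triple {α β : G} {U V W : C} (hU : comp α U) (hV : comp β V)
    (hW : comp (β * α) W) : neutral G C (V ⊗ U ⊗ dual W) := by
  simpa [mul_assoc] using tensor_mem hV (tensor_mem hU (GPivotal.dual_mem (G := G) hW))

/-- The morphism `V* ⊗ A ⊗ V ⟶ U* ⊗ A ⊗ U` given by `d_V⁻¹` times the composite of the right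
coevaluation of `U`, the half braiding `σ_{V ⊗ U*}` and the evaluation of `V`. -/
noncomputable def slide {α : G} (A : GCenter G C) {V U : C} (hV : InvDim α V) (hU : InvDim α U) :
    dual V ⊗ A.obj ⊗ V ⟶ dual U ⊗ A.obj ⊗ U :=
  scal hV.dInv
    (𝟙 _ ⊗≫ dual V ◁ A.obj ◁ V ◁ coevR U ⊗≫
      dual V ◁ (A.β (V ⊗ dual U) (neutral_tensor_dual hV.mem hU.mem)).hom ▷ U ⊗≫
      ev V ▷ (dual U ⊗ A.obj ⊗ U) ⊗≫ 𝟙 _)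

/-- The morphism `(V* ⊗ A ⊗ V) ⊗ X ⟶ X ⊗ (V* ⊗ A ⊗ V)` given by `d_V⁻¹` times the composite of the
right coevaluation of `V`, the half braiding `σ_{V ⊗ X ⊗ V*}` and the evaluation of `V`. -/
noncomputable def slideThrough {α : G} (A : GCenter G C) {V : C} (hV : InvDim α V) (X : C)
    (hX : neutral G C X) : (dual V ⊗ A.obj ⊗ V) ⊗ X ⟶ X ⊗ (dual V ⊗ A.obj ⊗ V) :=
  scal hV.dInv
    (𝟙 _ ⊗≫ dual V ◁ A.obj ◁ V ◁ X ◁ coevR V ⊗≫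
      dual V ◁ (A.β (V ⊗ X ⊗ dual V) (neutral_conj hV.mem hX)).hom ▷ V ⊗≫
      ev V ▷ (X ⊗ dual V ⊗ A.obj ⊗ V) ⊗≫ 𝟙 _)

/-- The morphism `U* ⊗ (V* ⊗ A ⊗ V) ⊗ U ⟶ W* ⊗ A ⊗ W` given by `d_U⁻¹ d_V⁻¹` times the composite
of the right coevaluation of `W`, the half braiding `σ_{V ⊗ U ⊗ W*}` and the evaluations of `V`
and `U`. -/
noncomputable def slideMul {α β : G} (A : GCenter G C) {U V W : C} (hU : InvDim α U)
    (hV : InvDim β V) (hW : InvDim (β * α) W) :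
    dual U ⊗ (dual V ⊗ A.obj ⊗ V) ⊗ U ⟶ dual W ⊗ A.obj ⊗ W :=
  scal hU.dInv (scal hV.dInv
    (𝟙 _ ⊗≫ dual U ◁ dual V ◁ A.obj ◁ V ◁ U ◁ coevR W ⊗≫
      dual U ◁ dual V ◁ (A.β (V ⊗ U ⊗ dual W) (neutral_triple hU.mem hV.mem hW.mem)).hom ▷ W ⊗≫
      dual U ◁ ev V ▷ (U ⊗ dual W ⊗ A.obj ⊗ W) ⊗≫
      ev U ▷ (dual W ⊗ A.obj ⊗ W) ⊗≫ 𝟙 _))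

/-- The morphism `A ⊗ X ⟶ X ⊗ (V* ⊗ A ⊗ V)` given by the right coevaluation of `V` and the half
braiding `σ_{X ⊗ V*}`. -/
def slideOut {α : G} (A : GCenter G C) {V X : C} (hV : InvDim α V) (hX : comp α X) :
    A.obj ⊗ X ⟶ X ⊗ (dual V ⊗ A.obj ⊗ V) :=
  𝟙 _ ⊗≫ A.obj ◁ X ◁ coevR V ⊗≫
    (A.β (X ⊗ dual V) (neutral_tensor_dual hX hV.mem)).hom ▷ V ⊗≫ 𝟙 _

/-- The morphism `A ⟶ U* ⊗ A ⊗ U`, for `U` of degree `1`, given by the right coevaluation of `U`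
and the half braiding `σ_{U*}`. -/
def slideUnit (A : GCenter G C) {U : C} (hU : InvDim (1 : G) U) : A.obj ⟶ dual U ⊗ A.obj ⊗ U :=
  𝟙 _ ⊗≫ A.obj ◁ coevR U ⊗≫
    (A.β (dual U) (RelCenter.DualClosed.prop_dual U hU.mem)).hom ▷ U ⊗≫ 𝟙 _

variable [MonoidalPreadditive C] [MonoidalLinear k C]

/-- The data exhibiting a crossing `φ` and a `G`-braiding `τ` of the `G`-center of `C` as the
canonical ones. For `V` in `E_α`, the morphisms `p V A` and `q V A` exhibit `φ_α(A)` as the image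
of the idempotent `π^V_A = slide A V V` of `V* ⊗ A ⊗ V`; when `V` varies, these presentations of
`φ_α(A)` are related by the transition isomorphisms given by `slide`, so that `φ_α(A)`, with its
half braiding, is the projective limit of the images of the `π^V_A`. The other fields express the
action of `φ_α` on morphisms, the monoidal constraints of `φ_α` and of the crossing, and the
`G`-braiding, through these presentations. -/
structure CanonicalData (φ : Crossing G k (GCenter G C)) (τ : GBraiding φ) where
  p {α : G} {V : C} (hV : InvDim α V) (A : GCenter G C) :
    dual V ⊗ A.obj ⊗ V ⟶ ((φ.F α).obj A).obj
  q {α : G} {V : C} (hV : InvDim α V) (A : GCenter G C) :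
    ((φ.F α).obj A).obj ⟶ dual V ⊗ A.obj ⊗ V
  p_q {α : G} {V : C} (hV : InvDim α V) (A : GCenter G C) : p hV A ≫ q hV A = slide A hV hV
  q_p {α : G} {V : C} (hV : InvDim α V) (A : GCenter G C) :
    q hV A ≫ p hV A = 𝟙 ((φ.F α).obj A).obj
  transition {α : G} {U V : C} (hU : InvDim α U) (hV : InvDim α V) (A : GCenter G C) :
    q hV A ≫ slide A hV hU ≫ p hU A = 𝟙 ((φ.F α).obj A).obj
  halfBraiding {α : G} {V : C} (hV : InvDim α V) (A : GCenter G C) (X : C) (hX : neutral G C X) :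
    (((φ.F α).obj A).β X hX).hom = q hV A ▷ X ≫ slideThrough A hV X hX ≫ X ◁ p hV A
  map {α : G} {V : C} (hV : InvDim α V) {A B : GCenter G C} (f : A ⟶ B) :
    RelCenter.Hom.f ((φ.F α).map f) = q hV A ≫ dual V ◁ f.f ▷ V ≫ p hV B
  tensor {α : G} {V : C} (hV : InvDim α V) (A B : GCenter G C) :
    RelCenter.Hom.f (μ (φ.F α) A B) =
      (q hV A ⊗ₘ q hV B) ≫
        (𝟙 _ ⊗≫ dual V ◁ A.obj ◁ evR V ▷ B.obj ▷ V ⊗≫ 𝟙 (dual V ⊗ (A.obj ⊗ B.obj) ⊗ V)) ≫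
        p hV (A ⊗ B)
  unit {α : G} {V : C} (hV : InvDim α V) :
    RelCenter.Hom.f (ε (φ.F α)) =
      (coevR V ≫ dual V ◁ (λ_ V).inv) ≫ p hV (𝟙_ (GCenter G C))
  mul {α β : G} {U V W : C} (hU : InvDim α U) (hV : InvDim β V) (hW : InvDim (β * α) W)
    (A : GCenter G C) :
    RelCenter.Hom.f ((φ.mulIso α β (β * α) rfl).hom.app A) =
      q hU ((φ.F β).obj A) ≫ dual U ◁ q hV A ▷ U ≫ slideMul A hU hV hW ≫ p hW A
  one {U : C} (hU : InvDim (1 : G) U) (A : GCenter G C) :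
    RelCenter.Hom.f (φ.oneIso.hom.app A) = slideUnit A hU ≫ p hU A
  braiding {α : G} {V : C} (hV : InvDim α V) (A B : GCenter G C)
    (hB : comp α B) :
    RelCenter.Hom.f (τ.τ A B hB).hom = slideOut A hV hB ≫ B.obj ◁ p hV A

/-- The crossing `φ` and the `G`-braiding `τ` are the canonical ones of the `G`-center. -/
def IsCanonical (φ : Crossing G k (GCenter G C)) (τ : GBraiding φ) : Prop :=
  Nonempty (CanonicalData φ τ)

end Canonical

end GCenterRibbon

/-! The whole structure is carried by one notion. For `α` in `G` and objects `A`, `B` of the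
`G`-center, a transport of degree `α` from `A` to `B` is a natural family of isomorphisms `A ⊗ X ≅ X
⊗ B`, for `X` of degree `α`, compatible with the half braidings of `A` and `B` when `X` is
multiplied by a neutral object on the left or on the right. A half braiding is a transport of degree
`1`; the value `φ_α(A)` of a canonical crossing is the target of a transport of degree `α` out of
`A`; and the `G`-braiding `τ_{A,Y}` is that transport evaluated at `Y`.

Transports are rigid because every degree contains an object `V` of invertible dimension, namely any
simple object (`IsSplitSemisimple.exists_dimInv`). Up to the scalar `d_V`, an object `X` of the
degree of `V` is a retract of `(X ⊗ V*) ⊗ V`, whose left factor is neutral. Hence a natural family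
`X ⊗ S ⟶ X ⊗ T` compatible with neutral objects on the left is `X ◁ g` for some `g`
(`exists_whiskerLeft_eq`), and `g` is unique (`DimInv.eq_of_whiskerLeft`). So morphisms lift along
transports (`Transport.exists_map`), and a transport of degree `αγ` can be divided by one of degree
`α` with the same source (`Transport.exists_divide`). Existence comes from `slideOut`, essentially
the half braiding at `X ⊗ V*`: it identifies `A ⊗ X` with the image of `X ⊗ e`, where `e` is the
idempotent `slide` of `V* ⊗ A ⊗ V`, and `e` splits by hypothesis.

For chosen transports, every constraint of the crossing is the lift of an identity, and every
coherence law compares two lifts of the same morphism (`Lifts.unique`). Among the axioms of the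
braiding, only the compatibility with the crossing needs an idea: naturality of a transport along a
component of another one. Canonical data and systems of transports determine each other
(`TransportSystem.isCanonical`, `CanonicalData.system`), so the ribbon axioms need only be checked
for a system of transports.

Pivotality of `φ_α`: the comparison built from the left duality makes the transport of `A*`
compatible with the left evaluations. Full rotations of a morphism to the left and to the right
agree in a pivotal category (`rotL_eq_rotR`), and this forces compatibility with the right
evaluations too, which characterizes the other comparison.

Self-duality of the twist: the twist is a crossing of `A` with itself closed by a loop on the left,
and closing the inverse crossing on the right gives an inverse of it (`curlInv_curl`). Thus the
right partial trace of the inverse crossing followed by the twist is the identity. Sphericity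
compares the traces of the two partial traces, and nondegeneracy of the trace
(`IsSplitSemisimple.eq_zero_of_trL`) shows that the left partial trace is the identity as well.
Unwinding the twist of `φ_α(A)*` through the bidual (`evR_eq_bidual`) reduces self-duality to
exactly this identity. -/

namespace GCenterRibbon

universe v u w

open DualityData GGraded Functor.LaxMonoidal Functor.OplaxMonoidal

set_option linter.unusedSectionVars false

/-! ### Composites of crossings -/

section Hexagons

variable {C : Type u} [Category.{v} C] [MonoidalCategory C]

/-- Crossing `A` with `X`, then with `Y`. -/
def step {A B D X Y : C} (a : A ⊗ X ⟶ X ⊗ B) (b : B ⊗ Y ⟶ Y ⊗ D) : A ⊗ (X ⊗ Y) ⟶ (X ⊗ Y) ⊗ D :=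
  (α_ _ _ _).inv ≫ a ▷ Y ≫ (α_ _ _ _).hom ≫ X ◁ b ≫ (α_ _ _ _).inv

/-- Crossing `A'`, then `A`, with `X`. -/
def par {A A' B B' X : C} (a : A ⊗ X ⟶ X ⊗ B) (a' : A' ⊗ X ⟶ X ⊗ B') :
    (A ⊗ A') ⊗ X ⟶ X ⊗ (B ⊗ B') :=
  (α_ _ _ _).hom ≫ A ◁ a' ≫ (α_ _ _ _).inv ≫ a ▷ B' ≫ (α_ _ _ _).hom

instance {A B D X Y : C} (a : A ⊗ X ⟶ X ⊗ B) (b : B ⊗ Y ⟶ Y ⊗ D) [IsIso a] [IsIso b] :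
    IsIso (step a b) := by
  unfold step; infer_instance

instance {A A' B B' X : C} (a : A ⊗ X ⟶ X ⊗ B) (a' : A' ⊗ X ⟶ X ⊗ B') [IsIso a] [IsIso a'] :
    IsIso (par a a') := by
  unfold par; infer_instance

lemma step_assoc {A B D E X Y Z : C} (a : A ⊗ X ⟶ X ⊗ B) (b : B ⊗ Y ⟶ Y ⊗ D)
    (c : D ⊗ Z ⟶ Z ⊗ E) :
    A ◁ (α_ X Y Z).hom ≫ step a (step b c) = step (step a b) c ≫ (α_ X Y Z).hom ▷ E := by
  unfold step; monoidal

lemma par_assoc {A A' A'' B B' B'' X : C} (a : A ⊗ X ⟶ X ⊗ B) (a' : A' ⊗ X ⟶ X ⊗ B')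
    (a'' : A'' ⊗ X ⟶ X ⊗ B'') :
    (α_ A A' A'').hom ▷ X ≫ par a (par a' a'') = par (par a a') a'' ≫ X ◁ (α_ B B' B'').hom := by
  unfold par; monoidal

/-- Interchange law of the two composites: the crossings `a` and `b'` act on disjoint strands. It
makes tensor products of half braidings, transports and quotients again compatible with products of
the crossed objects. -/
lemma step_par {A A' B B' D D' X Y : C} (a : A ⊗ X ⟶ X ⊗ B) (b : B ⊗ Y ⟶ Y ⊗ D)
    (a' : A' ⊗ X ⟶ X ⊗ B') (b' : B' ⊗ Y ⟶ Y ⊗ D') :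
    step (par a a') (par b b') = par (step a b) (step a' b') := by
  unfold step par
  calc
    _ = 𝟙 _ ⊗≫ A ◁ a' ▷ Y ⊗≫ (a ▷ (B' ⊗ Y) ≫ (X ⊗ B) ◁ b') ⊗≫ X ◁ b ▷ D' ⊗≫ 𝟙 _ := by monoidal
    _ = _ := by rw [← whisker_exchange]; monoidal

lemma step_comp {A B D D' X Y : C} (a : A ⊗ X ⟶ X ⊗ B) (b : B ⊗ Y ⟶ Y ⊗ D) (f : D ⟶ D') :
    step a (b ≫ Y ◁ f) = step a b ≫ (X ⊗ Y) ◁ f := by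
  unfold step; monoidal

lemma step_middle {A B B' D X Y : C} (a : A ⊗ X ⟶ X ⊗ B) (f : B ⟶ B') (b : B' ⊗ Y ⟶ Y ⊗ D) :
    step (a ≫ X ◁ f) b = step a (f ▷ Y ≫ b) := by
  unfold step; monoidal

lemma comp_step {A A' B D X Y : C} (f : A' ⟶ A) (a : A ⊗ X ⟶ X ⊗ B) (b : B ⊗ Y ⟶ Y ⊗ D) :
    step (f ▷ X ≫ a) b = f ▷ (X ⊗ Y) ≫ step a b := by
  unfold step; monoidal

lemma par_comp {A A' B B' E E' X : C} (a : A ⊗ X ⟶ X ⊗ B) (a' : A' ⊗ X ⟶ X ⊗ B') (f : B ⟶ E)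
    (g : B' ⟶ E') : par (a ≫ X ◁ f) (a' ≫ X ◁ g) = par a a' ≫ X ◁ (f ⊗ₘ g) := by
  unfold par
  calc
    _ = 𝟙 _ ⊗≫ A ◁ a' ⊗≫ ((A ⊗ X) ◁ g ≫ a ▷ E') ⊗≫ X ◁ f ▷ E' ⊗≫ 𝟙 _ := by monoidal
    _ = _ := by rw [whisker_exchange, tensorHom_def']; monoidal

lemma comp_par {A A' B B' E E' X : C} (a : A ⊗ X ⟶ X ⊗ B) (a' : A' ⊗ X ⟶ X ⊗ B') (f : E ⟶ A)
    (g : E' ⟶ A') : par (f ▷ X ≫ a) (g ▷ X ≫ a') = (f ⊗ₘ g) ▷ X ≫ par a a' := by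
  unfold par
  calc
    _ = 𝟙 _ ⊗≫ E ◁ g ▷ X ⊗≫ (E ◁ a' ≫ f ▷ (X ⊗ B')) ⊗≫ a ▷ B' ⊗≫ 𝟙 _ := by monoidal
    _ = _ := by rw [whisker_exchange, tensorHom_def']; monoidal

lemma par_natural {A A' B B' X Y : C} {a : A ⊗ X ⟶ X ⊗ B} {a' : A' ⊗ X ⟶ X ⊗ B'}
    {b : A ⊗ Y ⟶ Y ⊗ B} {b' : A' ⊗ Y ⟶ Y ⊗ B'} (f : X ⟶ Y) (h : A ◁ f ≫ b = a ≫ f ▷ B)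
    (h' : A' ◁ f ≫ b' = a' ≫ f ▷ B') : (A ⊗ A') ◁ f ≫ par b b' = par a a' ≫ f ▷ (B ⊗ B') := by
  unfold par
  calc
    _ = 𝟙 _ ⊗≫ A ◁ (A' ◁ f ≫ b') ⊗≫ b ▷ B' ⊗≫ 𝟙 _ := by monoidal
    _ = 𝟙 _ ⊗≫ A ◁ a' ⊗≫ (A ◁ f ≫ b) ▷ B' ⊗≫ 𝟙 _ := by rw [h']; monoidal
    _ = _ := by rw [h]; monoidal

/-- The crossing of the unit object with `X`. -/
def unitCrossing (X : C) : 𝟙_ C ⊗ X ⟶ X ⊗ 𝟙_ C := (λ_ X).hom ≫ (ρ_ X).inv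

instance (X : C) : IsIso (unitCrossing X) := by unfold unitCrossing; infer_instance

lemma step_unit (X Y : C) : step (unitCrossing X) (unitCrossing Y) = unitCrossing (X ⊗ Y) := by
  unfold step unitCrossing; monoidal

lemma par_unit_left {A B X : C} (a : A ⊗ X ⟶ X ⊗ B) :
    par (unitCrossing X) a ≫ X ◁ (λ_ B).hom = (λ_ A).hom ▷ X ≫ a := by
  unfold par unitCrossing; monoidal

lemma par_unit_right {A B X : C} (a : A ⊗ X ⟶ X ⊗ B) :
    par a (unitCrossing X) ≫ X ◁ (ρ_ B).hom = (ρ_ A).hom ▷ X ≫ a := by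
  unfold par unitCrossing; monoidal

lemma unitCrossing_natural {X Y : C} (f : X ⟶ Y) :
    𝟙_ C ◁ f ≫ unitCrossing Y = unitCrossing X ≫ f ▷ 𝟙_ C := by
  unfold unitCrossing; simp

end Hexagons

/-! ### Objects of invertible dimension -/

section Scalars

/-- The generator `g` supplied by the rank-one hypothesis need not be the identity. Writing `1 = a
g` and `g² = b g` gives `g = a g² = b (a g) = b · 1`, so the identity generates as well. -/
lemma exists_eq_smul_id {k : Type w} [CommRing k] {C : Type u} [Category.{v} C] [Preadditive C]
    [CategoryTheory.Linear k C] {i : C} (h : IsSimpleObj k i) (f : i ⟶ i) :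
    ∃ r : k, f = r • 𝟙 i := by
  obtain ⟨e⟩ := h
  set g := e.symm 1 with hg
  have gen (f : i ⟶ i) : f = e f • g := by
    apply e.injective; simp [hg]
  obtain ⟨a, ha⟩ : ∃ a : k, 𝟙 i = a • g := ⟨_, gen _⟩
  obtain ⟨b, hb⟩ : ∃ b : k, g ≫ g = b • g := ⟨_, gen _⟩
  have hg1 : g = b • 𝟙 i := by
    calc g = 𝟙 i ≫ g := by simp
      _ = a • (g ≫ g) := by rw [ha, CategoryTheory.Linear.smul_comp]
      _ = b • (a • g) := by rw [hb, smul_comm]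
      _ = _ := by rw [← ha]
  exact ⟨e f * b, by rw [mul_smul, ← hg1]; exact gen f⟩

variable {k : Type w} [CommRing k] {C : Type u} [Category.{v} C] [Preadditive C]
  [CategoryTheory.Linear k C] [MonoidalCategory C] [MonoidalPreadditive C] [MonoidalLinear k C]

lemma scal_smul_id (r : k) {X Y : C} (f : X ⟶ Y) : scal (r • 𝟙 (𝟙_ C)) f = r • f := by
  unfold scal
  rw [MonoidalCategory.tensorHom_def]
  simp

/-- The dimension of `V` is invertible, with inverse `r`. -/
def DimInv [PivotalCat C] (r : k) (V : C) : Prop := r • (coevR V ≫ ev V) = 𝟙 (𝟙_ C)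

variable [PivotalCat C]

lemma dimL_eq (V : C) : dimL V = coevR V ≫ ev V := by simp [dimL, trL]

variable {r : k} {V : C}

lemma DimInv.id_eq (h : DimInv r V) (T : C) :
    𝟙 T = r • (𝟙 T ⊗≫ (coevR V ≫ ev V) ▷ T ⊗≫ 𝟙 T) := by
  calc 𝟙 T = (λ_ T).inv ≫ (r • (coevR V ≫ ev V)) ▷ T ≫ (λ_ T).hom := by
        rw [show r • (coevR V ≫ ev V) = 𝟙 _ from h]; simp
    _ = r • ((λ_ T).inv ≫ (coevR V ≫ ev V) ▷ T ≫ (λ_ T).hom) := by simp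
    _ = _ := by congr 1; monoidal

/-- Closing the strand `V` of `V ◁ f` into a loop gives `d_V f`, so `f` is recovered after
multiplication by `r`. -/
lemma DimInv.eq_of_whiskerLeft (h : DimInv r V) {S T : C} {f g : S ⟶ T} (e : V ◁ f = V ◁ g) :
    f = g := by
  have aux (f : S ⟶ T) : f = r • (𝟙 S ⊗≫ coevR V ▷ S ⊗≫ dual V ◁ (V ◁ f) ⊗≫ ev V ▷ T ⊗≫ 𝟙 T) := by
    calc f = (r • (𝟙 S ⊗≫ (coevR V ≫ ev V) ▷ S ⊗≫ 𝟙 S)) ≫ f := by rw [← h.id_eq S]; simp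
      _ = r • (𝟙 S ⊗≫ coevR V ▷ S ≫ (ev V ▷ S ≫ 𝟙_ C ◁ f) ⊗≫ 𝟙 T) := by
        rw [CategoryTheory.Linear.smul_comp]; congr 1; monoidal
      _ = _ := by rw [← whisker_exchange]; congr 1; monoidal
  rw [aux f, aux g, e]

end Scalars

/-! ### Descent along an object of invertible dimension -/

section Descent

variable {G : Type*} [Group G] {k : Type w} [CommRing k] {C : Type u} [Category.{v} C]
  [Preadditive C] [HasFiniteBiproducts C] [CategoryTheory.Linear k C] [MonoidalCategory C]
  [PivotalCat C] [GGraded G C] [GPivotal G C]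
  [MonoidalPreadditive C] [MonoidalLinear k C]

/-- Simplicity of the unit object turns the inverse dimension, an endomorphism of `𝟙_ C`, into a
scalar of `k` that can be moved freely through composites. -/
lemma InvDim.exists_dimInv (h1 : IsSimpleObj k (𝟙_ C)) {α : G} {V : C} (hV : InvDim α V) :
    ∃ r : k, hV.dInv = r • 𝟙 _ ∧ DimInv r V := by
  obtain ⟨r, hr⟩ := exists_eq_smul_id h1 hV.dInv
  refine ⟨r, hr, ?_⟩
  have := hV.isIso
  have e : hV.dInv ≫ dimL V = 𝟙 _ := by simp [InvDim.dInv]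
  rw [hr, dimL_eq] at e
  simpa [DimInv] using e

lemma DimInv.isIso_dimL {r : k} {V : C} (h : DimInv r V) : IsIso (dimL V) := by
  refine ⟨r • 𝟙 _, ?_, ?_⟩ <;> · rw [dimL_eq]; simpa [DimInv] using h

lemma mem_neutral_mul {α : G} {Z X : C} (hZ : neutral G C Z) (hX : comp α X) : comp α (Z ⊗ X) := by
  simpa using tensor_mem hZ hX

lemma mem_mul_neutral {α : G} {Z X : C} (hX : comp α X) (hZ : neutral G C Z) : comp α (X ⊗ Z) := by
  simpa using tensor_mem hX hZ

/-- A family of morphisms `X ⊗ S ⟶ X ⊗ T`, natural in `X` of degree `α` and compatible with the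
action of the neutral component, comes from a morphism `S ⟶ T`. -/
lemma exists_whiskerLeft_eq {r : k} {V : C} (hr : DimInv r V) {α : G} (hV : comp α V) {S T : C}
    (h : ∀ X : C, comp α X → (X ⊗ S ⟶ X ⊗ T))
    (nat : ∀ (X Y : C) (hX : comp α X) (hY : comp α Y) (f : X ⟶ Y), f ▷ S ≫ h Y hY = h X hX ≫ f ▷ T)
    (lin : ∀ (Z X : C) (_ : neutral G C Z) (hX : comp α X) (hZX : comp α (Z ⊗ X)),
      h (Z ⊗ X) hZX = (α_ _ _ _).hom ≫ Z ◁ h X hX ≫ (α_ _ _ _).inv) :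
    ∃ g : S ⟶ T, ∀ (X : C) (hX : comp α X), X ◁ g = h X hX := by
  -- The witness is the normalized partial trace of `h V` over the strand `V`.
  refine ⟨r • (𝟙 S ⊗≫ coevR V ▷ S ⊗≫ dual V ◁ h V hV ⊗≫ ev V ▷ T ⊗≫ 𝟙 T), fun X hX => ?_⟩
  have hZ : neutral G C (X ⊗ dual V) := neutral_tensor_dual hX hV
  have hZV : comp α ((X ⊗ dual V) ⊗ V) := mem_neutral_mul hZ hV
  -- Up to the factor `r`, these exhibit `X` as a retract of `Z ⊗ V` with `Z = X ⊗ V*` neutral;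
  -- linearity in `Z` and naturality along `p` then express `h X` through `h V`.
  let i : X ⟶ (X ⊗ dual V) ⊗ V := (ρ_ X).inv ≫ X ◁ coevR V ≫ (α_ _ _ _).inv
  let p : (X ⊗ dual V) ⊗ V ⟶ X := (α_ _ _ _).hom ≫ X ◁ ev V ≫ (ρ_ X).hom
  have hip : r • (i ≫ p) = 𝟙 X := by
    have e : i ≫ p = (ρ_ X).inv ≫ X ◁ (coevR V ≫ ev V) ≫ (ρ_ X).hom := by
      simp [i, p]
    have e' : X ◁ (r • (coevR V ≫ ev V)) = 𝟙 _ := by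
      rw [show r • (coevR V ≫ ev V) = 𝟙 _ from hr]; simp
    rw [e, ← CategoryTheory.Linear.comp_smul, ← CategoryTheory.Linear.smul_comp,
      ← MonoidalLinear.whiskerLeft_smul, e']
    simp
  calc X ◁ (r • (𝟙 S ⊗≫ coevR V ▷ S ⊗≫ dual V ◁ h V hV ⊗≫ ev V ▷ T ⊗≫ 𝟙 T))
      = r • (i ▷ S ≫ h _ hZV ≫ p ▷ T) := by
        rw [lin _ _ hZ hV hZV, MonoidalLinear.whiskerLeft_smul]
        congr 1
        dsimp only [i, p]
        monoidal
    _ = (r • (i ≫ p)) ▷ S ≫ h X hX := by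
        rw [← nat _ _ hZV hX p]; simp
    _ = h X hX := by rw [hip]; simp

end Descent

/-! ### Transports -/

section Transport

variable {G : Type*} [Group G] {k : Type w} [CommRing k] {C : Type u} [Category.{v} C]
  [Preadditive C] [HasFiniteBiproducts C] [CategoryTheory.Linear k C] [MonoidalCategory C]
  [PivotalCat C] [GGraded G C] [GPivotal G C] [MonoidalPreadditive C] [MonoidalLinear k C]

lemma exists_whiskerLeft_iso {r : k} {V : C} (hr : DimInv r V) {α : G} (hV : comp α V) {S T : C}
    (h : ∀ X : C, comp α X → (X ⊗ S ≅ X ⊗ T))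
    (nat : ∀ (X Y : C) (hX : comp α X) (hY : comp α Y) (f : X ⟶ Y),
      f ▷ S ≫ (h Y hY).hom = (h X hX).hom ≫ f ▷ T)
    (lin : ∀ (Z X : C) (_ : neutral G C Z) (hX : comp α X) (hZX : comp α (Z ⊗ X)),
      (h (Z ⊗ X) hZX).hom = (α_ _ _ _).hom ≫ Z ◁ (h X hX).hom ≫ (α_ _ _ _).inv) :
    ∃ g : S ≅ T, ∀ (X : C) (hX : comp α X), X ◁ g.hom = (h X hX).hom := by
  obtain ⟨g, hg⟩ := exists_whiskerLeft_eq hr hV (fun X hX => (h X hX).hom) nat lin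
  obtain ⟨g', hg'⟩ := exists_whiskerLeft_eq hr hV (fun X hX => (h X hX).inv)
    (fun X Y hX hY f => by
      rw [← cancel_epi (h X hX).hom, ← reassoc_of% nat X Y hX hY f]; simp)
    (fun Z X hZ hX hZX => by
      rw [← cancel_epi (h (Z ⊗ X) hZX).hom, Iso.hom_inv_id, lin Z X hZ hX hZX]; simp)
  refine ⟨⟨g, g', hr.eq_of_whiskerLeft ?_, hr.eq_of_whiskerLeft ?_⟩, hg⟩
  · simp [hg V hV, hg' V hV]
  · simp [hg V hV, hg' V hV]

/-- A family of isomorphisms `A ⊗ X ≅ X ⊗ B`, for `X` of degree `α`, natural and compatible with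
the half braiding of `A`. -/
structure PreTransport (α : G) (A : GCenter G C) (B : C) where
  iso (X : C) (hX : comp α X) : A.obj ⊗ X ≅ X ⊗ B
  nat {X Y : C} (hX : comp α X) (hY : comp α Y) (f : X ⟶ Y) :
    A.obj ◁ f ≫ (iso Y hY).hom = (iso X hX).hom ≫ f ▷ B
  left {Z X : C} (hZ : neutral G C Z) (hX : comp α X) (hZX : comp α (Z ⊗ X)) :
    (iso (Z ⊗ X) hZX).hom = step (A.β Z hZ).hom (iso X hX).hom

/-- A pretransport to an object of the center, compatible with both half braidings. -/
structure Transport (α : G) (A B : GCenter G C) extends PreTransport α A B.obj where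
  right {X Z : C} (hX : comp α X) (hZ : neutral G C Z) (hXZ : comp α (X ⊗ Z)) :
    (iso (X ⊗ Z) hXZ).hom = step (iso X hX).hom (B.β Z hZ).hom

namespace PreTransport

lemma inv_nat {α : G} {A : GCenter G C} {B : C} (T : PreTransport α A B) {X Y : C}
    (hX : comp α X) (hY : comp α Y) (f : X ⟶ Y) :
    (T.iso X hX).inv ≫ A.obj ◁ f = f ▷ B ≫ (T.iso Y hY).inv := by
  rw [Iso.inv_comp_eq, ← Category.assoc, Iso.eq_comp_inv, T.nat hX hY]

lemma eq_of_comp_whiskerLeft {r : k} {V : C} (hr : DimInv r V) {α : G} (hV : comp α V)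
    {A : GCenter G C} {B : C} (T : PreTransport α A B) {D : C} {f g : B ⟶ D}
    (h : (T.iso V hV).hom ≫ V ◁ f = (T.iso V hV).hom ≫ V ◁ g) : f = g :=
  hr.eq_of_whiskerLeft ((cancel_epi _).1 h)

lemma eq_of_step {r : k} {V : C} (hr : DimInv r V) {α : G} (hV : comp α V)
    {A : GCenter G C} {B : C} (T : PreTransport α A B) {D Y : C} {f g : B ⊗ Y ⟶ Y ⊗ D}
    (h : step (T.iso V hV).hom f = step (T.iso V hV).hom g) : f = g := by
  unfold step at h
  rw [cancel_epi, cancel_epi, cancel_epi, cancel_mono] at h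
  exact hr.eq_of_whiskerLeft h

/-- Division of pretransports. -/
lemma exists_divide {r : k} {V : C} (hr : DimInv r V) {α γ δ : G} (hV : comp α V)
    (hδ : α * γ = δ) {A : GCenter G C} {B E : C} (T : PreTransport α A B)
    (R : PreTransport δ A E) :
    ∃ n : ∀ Y : C, comp γ Y → (B ⊗ Y ≅ Y ⊗ E),
      ∀ (X Y : C) (hX : comp α X) (hY : comp γ Y) (hXY : comp δ (X ⊗ Y)),
        step (T.iso X hX).hom (n Y hY).hom = (R.iso (X ⊗ Y) hXY).hom := by
  have mem {X Y : C} (hX : comp α X) (hY : comp γ Y) : comp δ (X ⊗ Y) := hδ ▸ tensor_mem hX hY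
  have key (Y : C) (hY : comp γ Y) : ∃ n : B ⊗ Y ≅ Y ⊗ E, ∀ (X : C) (hX : comp α X),
      X ◁ n.hom = ((α_ X B Y).inv ≫ (T.iso X hX).inv ▷ Y ≫ (α_ _ _ _).hom) ≫
        (R.iso (X ⊗ Y) (mem hX hY)).hom ≫ (α_ _ _ _).hom := by
    -- With `Y` fixed, undoing `T` at `X` and then applying `R` at `X ⊗ Y` is a family in `X` of
    -- degree `α`, to which descent applies.
    refine exists_whiskerLeft_iso hr hV (fun X hX =>
      ((α_ X B Y).symm ≪≫ whiskerRightIso (T.iso X hX).symm Y ≪≫ α_ _ _ _) ≪≫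
        (R.iso (X ⊗ Y) (mem hX hY)) ≪≫ α_ _ _ _) ?_ ?_
    · intro X X' hX hX' f
      simp only [Iso.trans_hom, Iso.symm_hom, whiskerRightIso_hom]
      calc _ = (α_ _ _ _).inv ≫ (f ▷ B ≫ (T.iso X' hX').inv) ▷ Y ≫ (α_ _ _ _).hom ≫
                (R.iso (X' ⊗ Y) (mem hX' hY)).hom ≫ (α_ _ _ _).hom := by monoidal
        _ = (α_ _ _ _).inv ≫ (T.iso X hX).inv ▷ Y ≫ (α_ _ _ _).hom ≫ (A.obj ◁ (f ▷ Y) ≫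
                (R.iso (X' ⊗ Y) (mem hX' hY)).hom) ≫ (α_ _ _ _).hom := by
            rw [← T.inv_nat hX hX']; monoidal
        _ = _ := by rw [R.nat (mem hX hY)]; monoidal
    · intro Z X hZ hX hZX
      simp only [Iso.trans_hom, Iso.symm_hom, whiskerRightIso_hom]
      -- Both `T` and `R` release the half braiding of `A` at `Z`, which cancels; the associator is
      -- needed because `R` is split along `Z ⊗ (X ⊗ Y)`.
      have e := R.nat (mem hZX hY) (mem_neutral_mul hZ (mem hX hY)) (α_ Z X Y).hom
      rw [R.left hZ (mem hX hY)] at e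
      rw [← cancel_epi (α_ (Z ⊗ X) B Y).hom, ← cancel_epi ((T.iso (Z ⊗ X) hZX).hom ▷ Y)]
      simp only [Category.assoc, Iso.hom_inv_id_assoc, hom_inv_whiskerRight_assoc]
      calc _ = (α_ _ _ _).hom ≫ ((R.iso ((Z ⊗ X) ⊗ Y) (mem hZX hY)).hom ≫
                (α_ Z X Y).hom ▷ E) ≫ (α_ _ _ _).hom ≫ Z ◁ (α_ _ _ _).hom ≫ (α_ _ _ _).inv := by
            monoidal
        _ = 𝟙 _ ⊗≫ (A.β Z hZ).hom ▷ (X ⊗ Y) ⊗≫ Z ◁ (R.iso (X ⊗ Y) (mem hX hY)).hom ⊗≫ 𝟙 _ := by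
            rw [← e]; unfold step; monoidal
        _ = 𝟙 _ ⊗≫ (A.β Z hZ).hom ▷ (X ⊗ Y) ⊗≫ Z ◁ ((T.iso X hX).hom ≫ (T.iso X hX).inv) ▷ Y ⊗≫
              Z ◁ (R.iso (X ⊗ Y) (mem hX hY)).hom ⊗≫ 𝟙 _ := by
            rw [Iso.hom_inv_id]; monoidal
        _ = _ := by rw [T.left hZ hX]; unfold step; monoidal
  choose n hn using key
  refine ⟨n, fun X Y hX hY hXY => ?_⟩
  unfold step
  rw [hn Y hY X hX]
  simp

end PreTransport

/-- Naturality of `R` along `V ◁ f`, from which the isomorphism `T` at `V` and then the factor `V`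
are cancelled. -/
lemma transport_natural_aux {r : k} {V : C} (hr : DimInv r V) {α γ δ : G} (hV : comp α V)
    (hδ : α * γ = δ) {A : GCenter G C} {B E : C} (T : PreTransport α A B)
    (R : PreTransport δ A E) (n : ∀ Y : C, comp γ Y → (B ⊗ Y ≅ Y ⊗ E))
    (hn : ∀ (X Y : C) (hX : comp α X) (hY : comp γ Y) (hXY : comp δ (X ⊗ Y)),
        step (T.iso X hX).hom (n Y hY).hom = (R.iso (X ⊗ Y) hXY).hom)
    {Y Y' : C} (hY : comp γ Y) (hY' : comp γ Y') (f : Y ⟶ Y') :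
    B ◁ f ≫ (n Y' hY').hom = (n Y hY).hom ≫ f ▷ E := by
  have mem {X Y : C} (hX : comp α X) (hY : comp γ Y) : comp δ (X ⊗ Y) := hδ ▸ tensor_mem hX hY
  have e := R.nat (mem hV hY) (mem hV hY') (V ◁ f)
  rw [← hn V Y hV hY, ← hn V Y' hV hY'] at e
  apply hr.eq_of_whiskerLeft
  rw [← cancel_mono (α_ _ _ _).inv, ← cancel_epi (α_ _ _ _).hom,
    ← cancel_epi ((T.iso V hV).hom ▷ Y), ← cancel_epi (α_ _ _ _).inv]
  unfold step at e
  calc _ = (α_ _ _ _).inv ≫ ((T.iso V hV).hom ▷ Y ≫ (V ⊗ B) ◁ f) ≫ (α_ _ _ _).hom ≫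
            V ◁ (n Y' hY').hom ≫ (α_ _ _ _).inv := by monoidal
    _ = A.obj ◁ V ◁ f ≫ (α_ _ _ _).inv ≫ (T.iso V hV).hom ▷ Y' ≫ (α_ _ _ _).hom ≫
            V ◁ (n Y' hY').hom ≫ (α_ _ _ _).inv := by rw [← whisker_exchange]; monoidal
    _ = _ := by rw [e]; monoidal

namespace PreTransport

/-- The target of a pretransport acquires a half braiding. -/
lemma exists_toTransport {r : k} {V : C} (hr : DimInv r V) {α : G} (hV : comp α V)
    {A : GCenter G C} {B : C} (T : PreTransport α A B) :
    ∃ (B' : GCenter G C) (_ : B'.obj = B), Nonempty (Transport α A B') := by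
  -- The half braiding of `B` is the quotient of `T` by itself, in degree `1`; the quotient equation
  -- is the missing compatibility on the right.
  obtain ⟨n, hn⟩ := T.exists_divide hr hV (mul_one α) T
  refine ⟨{ obj := B, β := n, naturality := ?_, monoidal := ?_ }, rfl,
    ⟨{ T with right := fun hX hZ hXZ => (hn _ _ hX hZ hXZ).symm }⟩⟩
  · intro X Y hX hY f
    exact transport_natural_aux hr hV (mul_one α) T T n hn hX hY f
  · intro X Y hX hY hXY
    change (n _ hXY).hom = step (n X hX).hom (n Y hY).hom
    apply T.eq_of_step hr hV
    -- Multiplicativity: both sides compute `T` at `V ⊗ X ⊗ Y`, for the two bracketings.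
    have e := T.nat (mem_mul_neutral (mem_mul_neutral hV hX) hY) (mem_mul_neutral hV hXY)
      (α_ V X Y).hom
    rw [hn _ _ hV hXY (mem_mul_neutral hV hXY), ← cancel_epi (A.obj ◁ (α_ V X Y).hom), step_assoc,
      hn _ _ hV hX (mem_mul_neutral hV hX),
      hn _ _ _ hY (mem_mul_neutral (mem_mul_neutral hV hX) hY), e]

end PreTransport

namespace Transport

/-- A morphism of half braidings induces a morphism between the targets of transports. -/
lemma exists_map {r : k} {V : C} (hr : DimInv r V) {α : G} (hV : comp α V)
    {A A' B B' : GCenter G C} (T : Transport α A B) (T' : Transport α A' B') (f : A ⟶ A') :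
    ∃ g : B ⟶ B', ∀ (X : C) (hX : comp α X),
      (T.iso X hX).hom ≫ X ◁ g.f = f.f ▷ X ≫ (T'.iso X hX).hom := by
  -- The family is `f` conjugated by the two transports; it is compatible with neutral objects
  -- because `f` commutes with the half braidings.
  obtain ⟨g, hg⟩ := exists_whiskerLeft_eq hr hV
    (fun X hX => (T.iso X hX).inv ≫ f.f ▷ X ≫ (T'.iso X hX).hom)
    (fun X Y hX hY h => by
      rw [← cancel_epi (T.iso X hX).hom, ← reassoc_of% T.nat hX hY h]
      simp only [Iso.hom_inv_id_assoc, Category.assoc]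
      rw [whisker_exchange_assoc, T'.nat hX hY])
    (fun Z X hZ hX hZX => by
      rw [← cancel_epi (T.iso (Z ⊗ X) hZX).hom, Iso.hom_inv_id_assoc, T.left hZ hX, T'.left hZ hX,
        ← comp_step, RelCenter.hom_comm, step_middle]
      unfold step
      simp)
  have hg' (X : C) (hX : comp α X) : (T.iso X hX).hom ≫ X ◁ g = f.f ▷ X ≫ (T'.iso X hX).hom := by
    rw [hg X hX]; simp
  refine ⟨{ f := g, comm := fun Z hZ => T.eq_of_step hr hV ?_ }, hg'⟩
  rw [step_comp, ← T.right hV hZ (mem_mul_neutral hV hZ), hg', ← step_middle, hg', comp_step,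
    ← T'.right hV hZ (mem_mul_neutral hV hZ)]

/-- Two morphisms out of the target of a transport agree if they agree after transport. -/
lemma hom_ext {r : k} {V : C} (hr : DimInv r V) {α : G} (hV : comp α V) {A B D : GCenter G C}
    (T : Transport α A B) {f g : B ⟶ D}
    (h : (T.iso V hV).hom ≫ V ◁ f.f = (T.iso V hV).hom ≫ V ◁ g.f) : f = g :=
  RelCenter.hom_ext (T.toPreTransport.eq_of_comp_whiskerLeft hr hV h)

/-- The tensor product of two transports. -/
noncomputable def tensor {α : G} {A A' B B' : GCenter G C} (T : Transport α A B)
    (T' : Transport α A' B') :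
    Transport α (A ⊗ A') (B ⊗ B') where
  iso X hX := asIso (X := (A.obj ⊗ A'.obj) ⊗ X) (Y := X ⊗ (B.obj ⊗ B'.obj))
    (par (T.iso X hX).hom (T'.iso X hX).hom)
  nat hX hY f := par_natural f (T.nat hX hY f) (T'.nat hX hY f)
  left {Z X} hZ hX hZX := by
    change par _ _ = step (par (A.β Z hZ).hom (A'.β Z hZ).hom) (par _ _)
    rw [step_par, T.left hZ hX, T'.left hZ hX]
  right {X Z} hX hZ hXZ := by
    change par _ _ = step (par _ _) (par (B.β Z hZ).hom (B'.β Z hZ).hom)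
    rw [step_par, T.right hX hZ, T'.right hX hZ]

/-- The transport of the unit object. -/
noncomputable def unit (α : G) : Transport α (𝟙_ (GCenter G C)) (𝟙_ (GCenter G C)) where
  iso X _ := asIso (X := 𝟙_ C ⊗ X) (Y := X ⊗ 𝟙_ C) (unitCrossing X)
  nat _ _ f := unitCrossing_natural f
  left {Z X} _ _ _ := (step_unit Z X).symm
  right {X Z} _ _ _ := (step_unit X Z).symm

/-- The half braiding of an object is a transport in degree `1`. -/
def refl (A : GCenter G C) : Transport (1 : G) A A where
  iso X hX := A.β X hX
  nat hX hY f := A.naturality hX hY f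
  left hZ hX hZX := A.monoidal hZ hX hZX
  right hX hZ hXZ := A.monoidal hX hZ hXZ

/-- The quotient of two transports with the same source. -/
lemma exists_divide {r : k} {V : C} (hr : DimInv r V) {α γ δ : G} (hV : comp α V)
    (hδ : α * γ = δ) {A B E : GCenter G C} (T : Transport α A B) (R : Transport δ A E) :
    ∃ Q : Transport γ B E, ∀ (X Y : C) (hX : comp α X) (hY : comp γ Y) (hXY : comp δ (X ⊗ Y)),
        step (T.iso X hX).hom (Q.iso Y hY).hom = (R.iso (X ⊗ Y) hXY).hom := by
  obtain ⟨n, hn⟩ := T.toPreTransport.exists_divide hr hV hδ R.toPreTransport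
  have mem {X Y : C} (hX : comp α X) (hY : comp γ Y) : comp δ (X ⊗ Y) := hδ ▸ tensor_mem hX hY
  refine ⟨{ iso := n, nat := ?_, left := ?_, right := ?_ }, hn⟩
  · intro X Y hX hY f
    exact transport_natural_aux hr hV hδ T.toPreTransport R.toPreTransport n hn hX hY f
  · intro Z Y hZ hY hZY
    -- After composition with `T` at `V`, both sides are `R` at `V ⊗ Z ⊗ Y`, `T` absorbing `Z`
    -- through its compatibility on the right.
    apply T.eq_of_step hr hV
    have e := R.nat (mem (mem_mul_neutral hV hZ) hY) (mem hV hZY) (α_ V Z Y).hom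
    rw [hn _ _ hV hZY (mem hV hZY), ← cancel_epi (A.obj ◁ (α_ V Z Y).hom), step_assoc, e,
      ← T.right hV hZ (mem_mul_neutral hV hZ), hn _ _ _ hY (mem (mem_mul_neutral hV hZ) hY)]
  · intro Y Z hY hZ hYZ
    apply T.eq_of_step hr hV
    have e := R.nat (mem_mul_neutral (mem hV hY) hZ) (mem hV hYZ) (α_ V Y Z).hom
    rw [hn _ _ hV hYZ (mem hV hYZ), ← cancel_epi (A.obj ◁ (α_ V Y Z).hom), step_assoc, e,
      hn _ _ hV hY (mem hV hY), ← R.right (mem hV hY) hZ]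

end Transport

end Transport

/-! ### Slides -/

section Slides

variable {G : Type*} [Group G] {k : Type w} [CommRing k] {C : Type u} [Category.{v} C]
  [Preadditive C] [HasFiniteBiproducts C] [CategoryTheory.Linear k C] [MonoidalCategory C]
  [PivotalCat C] [GGraded G C] [GPivotal G C] [MonoidalPreadditive C] [MonoidalLinear k C]

lemma slideOut_natural {α : G} (A : GCenter G C) {V X Y : C} (hV : InvDim α V) (hX : comp α X)
    (hY : comp α Y) (f : X ⟶ Y) :
    A.obj ◁ f ≫ slideOut A hV hY = slideOut A hV hX ≫ f ▷ (dual V ⊗ A.obj ⊗ V) := by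
  have e := A.naturality (neutral_tensor_dual hX hV.mem) (neutral_tensor_dual hY hV.mem)
    (f ▷ dual V)
  unfold slideOut
  calc
    _ = 𝟙 _ ⊗≫ A.obj ◁ (f ▷ 𝟙_ C ≫ Y ◁ coevR V) ⊗≫
          (A.β (Y ⊗ dual V) (neutral_tensor_dual hY hV.mem)).hom ▷ V ⊗≫ 𝟙 _ := by monoidal
    _ = 𝟙 _ ⊗≫ A.obj ◁ X ◁ coevR V ⊗≫ (A.obj ◁ (f ▷ dual V) ≫
          (A.β (Y ⊗ dual V) (neutral_tensor_dual hY hV.mem)).hom) ▷ V ⊗≫ 𝟙 _ := by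
        rw [← whisker_exchange]; monoidal
    _ = _ := by rw [e]; monoidal

/-- The half braiding at `Z ⊗ (X ⊗ V*)` splits by multiplicativity. With naturality, this makes
`slideOut` satisfy the axioms of a pretransport except invertibility, which only holds onto the
image of an idempotent. -/
lemma slideOut_left {α : G} (A : GCenter G C) {V Z X : C} (hV : InvDim α V)
    (hZ : neutral G C Z) (hX : comp α X) (hZX : comp α (Z ⊗ X)) :
    slideOut A hV hZX = step (A.β Z hZ).hom (slideOut A hV hX) := by
  have h1 := neutral_tensor_dual hX hV.mem
  have h2 := neutral_tensor_dual hZX hV.mem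
  have h3 : neutral G C (Z ⊗ (X ⊗ dual V)) := mem_neutral_mul hZ h1
  have e := A.naturality h2 h3 (α_ Z X (dual V)).hom
  rw [A.monoidal hZ h1] at e
  have e' : (A.β _ h2).hom = A.obj ◁ (α_ Z X (dual V)).hom ≫ ((α_ _ _ _).inv ≫
      (A.β Z hZ).hom ▷ (X ⊗ dual V) ≫ (α_ _ _ _).hom ≫ Z ◁ (A.β _ h1).hom ≫ (α_ _ _ _).inv) ≫
        (α_ Z X (dual V)).inv ▷ A.obj := by
    rw [← cancel_mono ((α_ Z X (dual V)).hom ▷ A.obj), ← e]; simp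
  unfold slideOut step
  rw [e']
  calc
    _ = 𝟙 _ ⊗≫ ((A.obj ⊗ Z) ◁ (X ◁ coevR V) ≫ (A.β Z hZ).hom ▷ (X ⊗ (dual V ⊗ V))) ⊗≫
          Z ◁ (A.β _ h1).hom ▷ V ⊗≫ 𝟙 _ := by monoidal
    _ = _ := by rw [whisker_exchange]; monoidal

/-- The left inverse of `slideOut`, for an object `V` of dimension inverse to `r`. -/
def slideIn (r : k) {α : G} (A : GCenter G C) {V X : C} (hV : InvDim α V) (hX : comp α X) :
    X ⊗ (dual V ⊗ A.obj ⊗ V) ⟶ A.obj ⊗ X :=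
  r • (𝟙 _ ⊗≫ (A.β (X ⊗ dual V) (neutral_tensor_dual hX hV.mem)).inv ▷ V ⊗≫
    A.obj ◁ X ◁ ev V ⊗≫ 𝟙 _)

lemma DimInv.whiskerLeft_eq {r : k} {V : C} (hr : DimInv r V) (T : C) :
    r • (T ◁ coevR V ≫ T ◁ ev V) = 𝟙 (T ⊗ 𝟙_ C) := by
  rw [← MonoidalCategory.whiskerLeft_comp, ← MonoidalLinear.whiskerLeft_smul,
    show r • (coevR V ≫ ev V) = 𝟙 _ from hr]
  simp

/-- The half braiding meets its inverse, and the remaining closed loop of `V` has value `d_V`. -/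
lemma slideOut_slideIn {r : k} {α : G} (A : GCenter G C) {V X : C} (hV : InvDim α V)
    (hr : DimInv r V) (hX : comp α X) : slideOut A hV hX ≫ slideIn r A hV hX = 𝟙 _ := by
  have h1 := neutral_tensor_dual hX hV.mem
  unfold slideOut slideIn
  rw [CategoryTheory.Linear.comp_smul]
  calc
    _ = r • (𝟙 _ ⊗≫ A.obj ◁ X ◁ coevR V ⊗≫ ((A.β (X ⊗ dual V) h1).hom ≫
          (A.β (X ⊗ dual V) h1).inv) ▷ V ⊗≫ A.obj ◁ X ◁ ev V ⊗≫ 𝟙 _) := by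
        congr 1; monoidal
    _ = r • (𝟙 _ ⊗≫ ((A.obj ⊗ X) ◁ coevR V ≫ (A.obj ⊗ X) ◁ ev V) ⊗≫ 𝟙 _) := by
        rw [Iso.hom_inv_id]; congr 1; monoidal
    _ = (ρ_ (A.obj ⊗ X)).inv ≫ (r • ((A.obj ⊗ X) ◁ coevR V ≫ (A.obj ⊗ X) ◁ ev V)) ≫
          (ρ_ (A.obj ⊗ X)).hom := by
        rw [CategoryTheory.Linear.smul_comp, CategoryTheory.Linear.comp_smul]; congr 1; monoidal
    _ = _ := by rw [hr.whiskerLeft_eq]; simp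

/-- The two half braidings merge into the one at `X ⊗ V* ⊗ V ⊗ U*`; naturality along `ev V` reduces
it to `X ⊗ U*`, and the loop of `V` that splits off cancels the scalar `r`. -/
lemma slideOut_slide {r : k} {α : G} (A : GCenter G C) {V U X : C} (hV : InvDim α V)
    (hd : hV.dInv = r • 𝟙 _) (hr : DimInv r V) (hU : InvDim α U) (hX : comp α X) :
    slideOut A hV hX ≫ X ◁ slide A hV hU = slideOut A hU hX := by
  have h1 := neutral_tensor_dual hX hV.mem
  have h2 := neutral_tensor_dual hV.mem hU.mem
  have h3 := neutral_tensor_dual hX hU.mem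
  have h12 : neutral G C ((X ⊗ dual V) ⊗ (V ⊗ dual U)) := mem_neutral_mul h1 h2
  have e := A.naturality h12 h3 (𝟙 _ ⊗≫ X ◁ ev V ▷ dual U ⊗≫ 𝟙 _)
  rw [A.monoidal h1 h2] at e
  unfold slideOut slide
  rw [hd, scal_smul_id, MonoidalLinear.whiskerLeft_smul, CategoryTheory.Linear.comp_smul]
  calc
    _ = r • (𝟙 _ ⊗≫ A.obj ◁ X ◁ coevR V ⊗≫ ((A.β (X ⊗ dual V) h1).hom ▷ (V ⊗ 𝟙_ C) ≫
          (_ ◁ (V ◁ coevR U))) ⊗≫ X ◁ dual V ◁ (A.β (V ⊗ dual U) h2).hom ▷ U ⊗≫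
          X ◁ ev V ▷ (dual U ⊗ A.obj ⊗ U) ⊗≫ 𝟙 _) := by
        congr 1; monoidal
    _ = r • (𝟙 _ ⊗≫ (A.obj ⊗ X) ◁ (coevR V ▷ 𝟙_ C ≫ (dual V ⊗ V) ◁ coevR U) ⊗≫
          (((α_ _ _ _).inv ≫ (A.β _ h1).hom ▷ (V ⊗ dual U) ≫ (α_ _ _ _).hom ≫
            (X ⊗ dual V) ◁ (A.β _ h2).hom ≫ (α_ _ _ _).inv) ≫
              (𝟙 _ ⊗≫ X ◁ ev V ▷ dual U ⊗≫ 𝟙 (X ⊗ dual U)) ▷ A.obj) ▷ U ⊗≫ 𝟙 _) := by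
        rw [← whisker_exchange]; congr 1; monoidal
    _ = r • (𝟙 _ ⊗≫ (A.obj ⊗ X) ◁ (𝟙_ C ◁ coevR U ≫ (coevR V ≫ ev V) ▷ (dual U ⊗ U)) ⊗≫
          (A.β _ h3).hom ▷ U ⊗≫ 𝟙 _) := by
        rw [← e, ← whisker_exchange]; congr 1; monoidal
    _ = r • (𝟙 _ ⊗≫ ((A.obj ⊗ X) ◁ coevR V ≫ (A.obj ⊗ X) ◁ ev V) ⊗≫ (A.obj ⊗ X) ◁ coevR U ⊗≫
          (A.β _ h3).hom ▷ U ⊗≫ 𝟙 _) := by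
        rw [whisker_exchange]; congr 1; monoidal
    _ = (ρ_ (A.obj ⊗ X)).inv ≫ (r • ((A.obj ⊗ X) ◁ coevR V ≫ (A.obj ⊗ X) ◁ ev V)) ≫
          (𝟙 _ ⊗≫ A.obj ◁ X ◁ coevR U ⊗≫ (A.β _ h3).hom ▷ U ⊗≫ 𝟙 _) := by
        rw [CategoryTheory.Linear.smul_comp, CategoryTheory.Linear.comp_smul]; congr 1; monoidal
    _ = _ := by rw [hr.whiskerLeft_eq]; monoidal

/-- The morphism `(V* ⊗ A ⊗ V) ⊗ Y ⟶ Y ⊗ (W* ⊗ A ⊗ W)` given by `r` times the composite of the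
right coevaluation of `W`, the half braiding `σ_{V ⊗ Y ⊗ W*}` and the evaluation of `V`. -/
def slideAcross (r : k) (A : GCenter G C) {V Y W : C} (h : neutral G C (V ⊗ Y ⊗ dual W)) :
    (dual V ⊗ A.obj ⊗ V) ⊗ Y ⟶ Y ⊗ (dual W ⊗ A.obj ⊗ W) :=
  r • (𝟙 _ ⊗≫ dual V ◁ A.obj ◁ V ◁ Y ◁ coevR W ⊗≫ dual V ◁ (A.β (V ⊗ Y ⊗ dual W) h).hom ▷ W ⊗≫
    ev V ▷ (Y ⊗ dual W ⊗ A.obj ⊗ W) ⊗≫ 𝟙 _)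

/-- The computation of `slideOut_slide` with an object `Y` carried along between `V` and `W*`. It
accounts both for the half braiding of `φ_α(A)` and for the constraint `φ₂`. -/
lemma slideOut_slideAcross {r : k} {α δ : G} (A : GCenter G C) {V W X Y : C} (hV : InvDim α V)
    (hr : DimInv r V) (hW : InvDim δ W) (hX : comp α X) (hXY : comp δ (X ⊗ Y))
    (h : neutral G C (V ⊗ Y ⊗ dual W)) :
    step (slideOut A hV hX) (slideAcross r A h) = slideOut A hW hXY := by
  have h1 := neutral_tensor_dual hX hV.mem
  have h3 := neutral_tensor_dual hXY hW.mem
  have h12 : neutral G C ((X ⊗ dual V) ⊗ (V ⊗ Y ⊗ dual W)) := mem_neutral_mul h1 h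
  have e := A.naturality h12 h3 (𝟙 _ ⊗≫ X ◁ ev V ▷ (Y ⊗ dual W) ⊗≫ 𝟙 _)
  rw [A.monoidal h1 h] at e
  unfold slideOut slideAcross step
  simp only [MonoidalLinear.whiskerLeft_smul, CategoryTheory.Linear.comp_smul,
    CategoryTheory.Linear.smul_comp]
  calc
    _ = r • (𝟙 _ ⊗≫ A.obj ◁ X ◁ coevR V ▷ Y ⊗≫ ((A.β (X ⊗ dual V) h1).hom ▷ (V ⊗ Y ⊗ 𝟙_ C) ≫
          (_ ◁ (V ◁ Y ◁ coevR W))) ⊗≫ X ◁ dual V ◁ (A.β _ h).hom ▷ W ⊗≫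
          X ◁ ev V ▷ (Y ⊗ dual W ⊗ A.obj ⊗ W) ⊗≫ 𝟙 _) := by
        congr 1; monoidal
    _ = r • (𝟙 _ ⊗≫ (A.obj ⊗ X) ◁ (coevR V ▷ (Y ⊗ 𝟙_ C) ≫ (dual V ⊗ V) ◁ (Y ◁ coevR W)) ⊗≫
          (((α_ _ _ _).inv ≫ (A.β _ h1).hom ▷ (V ⊗ Y ⊗ dual W) ≫ (α_ _ _ _).hom ≫
            (X ⊗ dual V) ◁ (A.β _ h).hom ≫ (α_ _ _ _).inv) ≫
              (𝟙 _ ⊗≫ X ◁ ev V ▷ (Y ⊗ dual W) ⊗≫ 𝟙 ((X ⊗ Y) ⊗ dual W)) ▷ A.obj) ▷ W ⊗≫ 𝟙 _) := by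
        rw [← whisker_exchange]; congr 1; monoidal
    _ = r • (𝟙 _ ⊗≫ (A.obj ⊗ X) ◁ (𝟙_ C ◁ (Y ◁ coevR W) ≫
          (coevR V ≫ ev V) ▷ (Y ⊗ dual W ⊗ W)) ⊗≫ (A.β _ h3).hom ▷ W ⊗≫ 𝟙 _) := by
        rw [← e, ← whisker_exchange]; congr 1; monoidal
    _ = r • (𝟙 _ ⊗≫ ((A.obj ⊗ X) ◁ coevR V ≫ (A.obj ⊗ X) ◁ ev V) ▷ Y ⊗≫
          (A.obj ⊗ X ⊗ Y) ◁ coevR W ⊗≫ (A.β _ h3).hom ▷ W ⊗≫ 𝟙 _) := by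
        rw [whisker_exchange]; congr 1; monoidal
    _ = (α_ _ _ _).inv ≫ ((ρ_ (A.obj ⊗ X)).inv ≫ (r • ((A.obj ⊗ X) ◁ coevR V ≫
          (A.obj ⊗ X) ◁ ev V))) ▷ Y ≫
          (𝟙 _ ⊗≫ A.obj ◁ (X ⊗ Y) ◁ coevR W ⊗≫ (A.β _ h3).hom ▷ W ⊗≫ 𝟙 _) := by
        simp only [MonoidalLinear.smul_whiskerRight, CategoryTheory.Linear.comp_smul,
          CategoryTheory.Linear.smul_comp]
        congr 1; monoidal
    _ = _ := by rw [hr.whiskerLeft_eq]; monoidal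

lemma slideThrough_eq {r : k} {α : G} (A : GCenter G C) {V X : C} (hV : InvDim α V)
    (hd : hV.dInv = r • 𝟙 _) (hX : neutral G C X) :
    slideThrough A hV X hX = slideAcross r A (neutral_conj hV.mem hX) := by
  unfold slideThrough slideAcross
  rw [hd, scal_smul_id]

lemma slideMul_eq {r s : k} {α β : G} (A : GCenter G C) {U V W : C} (hU : InvDim α U)
    (hV : InvDim β V) (hW : InvDim (β * α) W) (hs : hU.dInv = s • 𝟙 _) (hr : hV.dInv = r • 𝟙 _) :
    slideMul A hU hV hW =
      s • (dual U ◁ slideAcross r A (neutral_triple hU.mem hV.mem hW.mem) ≫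
        (𝟙 _ ⊗≫ ev U ▷ (dual W ⊗ A.obj ⊗ W) ⊗≫ 𝟙 _)) := by
  unfold slideMul slideAcross
  rw [hs, hr, scal_smul_id, scal_smul_id, MonoidalLinear.whiskerLeft_smul]
  congr 1
  rw [CategoryTheory.Linear.smul_comp]
  congr 1
  monoidal

/-- An explicit bracketing, in which the half braiding of a unit object or of a tensor product can
be replaced by its definition. -/
lemma slideOut_eq {α : G} (A : GCenter G C) {V X : C} (hV : InvDim α V) (hX : comp α X) :
    slideOut A hV hX = A.obj ◁ ((ρ_ X).inv ≫ X ◁ coevR V ≫ (α_ _ _ _).inv) ≫ (α_ _ _ _).inv ≫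
      (A.β (X ⊗ dual V) (neutral_tensor_dual hX hV.mem)).hom ▷ V ≫ (α_ _ _ _).hom ≫
        (α_ _ _ _).hom := by
  unfold slideOut; monoidal

lemma slideOut_unit {α : G} {V X : C} (hV : InvDim α V) (hX : comp α X) :
    slideOut (𝟙_ (GCenter G C)) hV hX =
      unitCrossing X ≫ X ◁ (coevR V ≫ dual V ◁ (λ_ V).inv) := by
  rw [slideOut_eq]
  unfold unitCrossing
  change 𝟙_ C ◁ ((ρ_ X).inv ≫ X ◁ coevR V ≫ (α_ _ _ _).inv) ≫ (α_ _ _ _).inv ≫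
    ((λ_ (X ⊗ dual V)).hom ≫ (ρ_ (X ⊗ dual V)).inv) ▷ V ≫ (α_ _ _ _).hom ≫ (α_ _ _ _).hom = _
  monoidal

/-- The inner evaluation of `V` meets the coevaluation created by the crossing of `A`: the strand
`V*` straightens, leaving the half braiding of `A ⊗ B`. -/
lemma slideOut_tensor {α : G} (A B : GCenter G C) {V X : C} (hV : InvDim α V) (hX : comp α X) :
    par (slideOut A hV hX) (slideOut B hV hX) ≫
      X ◁ (𝟙 _ ⊗≫ dual V ◁ A.obj ◁ evR V ▷ B.obj ▷ V ⊗≫ 𝟙 (dual V ⊗ (A.obj ⊗ B.obj) ⊗ V)) =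
    slideOut (A ⊗ B) hV hX := by
  have h1 := neutral_tensor_dual hX hV.mem
  have key := zigzagR_dual V
  rw [slideOut_eq (A ⊗ B)]
  change _ = (A.obj ⊗ B.obj) ◁ ((ρ_ X).inv ≫ X ◁ coevR V ≫ (α_ _ _ _).inv) ≫ (α_ _ _ _).inv ≫
    (RelCenter.tensorβ A B (X ⊗ dual V) h1).hom ▷ V ≫ (α_ _ _ _).hom ≫ (α_ _ _ _).hom
  unfold slideOut par
  rw [RelCenter.tensorβ_hom]
  calc
    _ = 𝟙 _ ⊗≫ A.obj ◁ B.obj ◁ X ◁ coevR V ⊗≫ A.obj ◁ (B.β _ h1).hom ▷ V ⊗≫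
          A.obj ◁ X ◁ coevR V ▷ (dual V ⊗ B.obj ⊗ V) ⊗≫
          ((A.β _ h1).hom ▷ (V ⊗ dual V ⊗ B.obj ⊗ V) ≫ _ ◁ ((α_ _ _ _).inv ≫
            evR V ▷ (B.obj ⊗ V))) ⊗≫ 𝟙 _ := by monoidal
    _ = 𝟙 _ ⊗≫ A.obj ◁ B.obj ◁ X ◁ coevR V ⊗≫ A.obj ◁ (B.β _ h1).hom ▷ V ⊗≫
          A.obj ◁ X ◁ ((λ_ _).inv ≫ coevR V ▷ dual V ≫ (α_ _ _ _).hom ≫ dual V ◁ evR V ≫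
            (ρ_ _).hom) ▷ (B.obj ⊗ V) ⊗≫
          (A.β _ h1).hom ▷ (B.obj ⊗ V) ⊗≫ 𝟙 _ := by
        rw [← whisker_exchange]; monoidal
    _ = _ := by rw [key]; monoidal

lemma slideOut_slideUnit (A : GCenter G C) {U X : C} (hU : InvDim (1 : G) U)
    (hX : neutral G C X) :
    (A.β X hX).hom ≫ X ◁ slideUnit A hU = slideOut A hU hX := by
  have h1 := neutral_tensor_dual hX hU.mem
  have h2 : neutral G C (dual U) := RelCenter.DualClosed.prop_dual U hU.mem
  unfold slideOut slideUnit
  rw [A.monoidal hX h2 h1]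
  calc
    _ = 𝟙 _ ⊗≫ ((A.β X hX).hom ▷ 𝟙_ C ≫ _ ◁ coevR U) ⊗≫ X ◁ (A.β (dual U) h2).hom ▷ U ⊗≫
          𝟙 _ := by monoidal
    _ = _ := by rw [← whisker_exchange]; monoidal

end Slides

/-! ### Existence of transports -/

section Existence

variable {G : Type*} [Group G] {k : Type w} [CommRing k] {C : Type u} [Category.{v} C]
  [Preadditive C] [HasFiniteBiproducts C] [CategoryTheory.Linear k C] [MonoidalCategory C]
  [PivotalCat C] [GGraded G C] [GPivotal G C] [MonoidalPreadditive C] [MonoidalLinear k C]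

/-- Same merging of half braidings as in `slideOut_slide`, but the strands `V*` and `V` are left
open at the source, so that `ev V` comes out in front instead of closing a loop. -/
lemma halfBraiding_slide {r : k} {α : G} (A : GCenter G C) {V U X : C} (hV : InvDim α V)
    (hd : hV.dInv = r • 𝟙 _) (hU : InvDim α U) (hX : comp α X) :
    (A.β (X ⊗ dual V) (neutral_tensor_dual hX hV.mem)).hom ▷ V ≫ (α_ _ _ _).hom ≫ (α_ _ _ _).hom ≫
      X ◁ slide A hV hU =
    r • (((α_ _ _ _).hom ≫ A.obj ◁ ((α_ _ _ _).hom ≫ X ◁ ev V ≫ (ρ_ X).hom)) ≫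
      slideOut A hU hX) := by
  have h1 := neutral_tensor_dual hX hV.mem
  have h2 := neutral_tensor_dual hV.mem hU.mem
  have h3 := neutral_tensor_dual hX hU.mem
  have h12 : neutral G C ((X ⊗ dual V) ⊗ (V ⊗ dual U)) := mem_neutral_mul h1 h2
  have e := A.naturality h12 h3 (𝟙 _ ⊗≫ X ◁ ev V ▷ dual U ⊗≫ 𝟙 _)
  rw [A.monoidal h1 h2] at e
  unfold slideOut slide
  rw [hd, scal_smul_id]
  simp only [MonoidalLinear.whiskerLeft_smul, CategoryTheory.Linear.comp_smul]
  congr 1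
  calc
    _ = 𝟙 _ ⊗≫ ((A.β (X ⊗ dual V) h1).hom ▷ (V ⊗ 𝟙_ C) ≫
          (_ ◁ (V ◁ coevR U))) ⊗≫ X ◁ dual V ◁ (A.β (V ⊗ dual U) h2).hom ▷ U ⊗≫
          X ◁ ev V ▷ (dual U ⊗ A.obj ⊗ U) ⊗≫ 𝟙 _ := by
        monoidal
    _ = 𝟙 _ ⊗≫ (A.obj ⊗ X) ◁ ((dual V ⊗ V) ◁ coevR U) ⊗≫
          (((α_ _ _ _).inv ≫ (A.β _ h1).hom ▷ (V ⊗ dual U) ≫ (α_ _ _ _).hom ≫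
            (X ⊗ dual V) ◁ (A.β _ h2).hom ≫ (α_ _ _ _).inv) ≫
              (𝟙 _ ⊗≫ X ◁ ev V ▷ dual U ⊗≫ 𝟙 (X ⊗ dual U)) ▷ A.obj) ▷ U ⊗≫ 𝟙 _ := by
        rw [← whisker_exchange]; monoidal
    _ = 𝟙 _ ⊗≫ (A.obj ⊗ X) ◁ ((dual V ⊗ V) ◁ coevR U ≫ ev V ▷ (dual U ⊗ U)) ⊗≫
          (A.β _ h3).hom ▷ U ⊗≫ 𝟙 _ := by
        rw [← e]; monoidal
    _ = _ := by
        rw [whisker_exchange]; monoidal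

/-- Together with `slideOut_slideIn`, this says that `A ⊗ X` is the image of the idempotent `X ◁
slide A hV hV`. -/
lemma slideIn_slideOut {r : k} {α : G} (A : GCenter G C) {V X : C} (hV : InvDim α V)
    (hd : hV.dInv = r • 𝟙 _) (hX : comp α X) :
    slideIn r A hV hX ≫ slideOut A hV hX = X ◁ slide A hV hV := by
  have e := halfBraiding_slide A hV hd hV hX
  rw [← cancel_epi (α_ _ _ _).hom, ← cancel_epi (α_ _ _ _).hom,
    ← cancel_epi ((A.β (X ⊗ dual V) (neutral_tensor_dual hX hV.mem)).hom ▷ V), e]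
  unfold slideIn
  rw [CategoryTheory.Linear.smul_comp, CategoryTheory.Linear.comp_smul,
    CategoryTheory.Linear.comp_smul, CategoryTheory.Linear.comp_smul]
  congr 1
  calc
    _ = (((A.β (X ⊗ dual V) (neutral_tensor_dual hX hV.mem)).hom ≫
          (A.β (X ⊗ dual V) (neutral_tensor_dual hX hV.mem)).inv) ▷ V ≫ (α_ _ _ _).hom ≫
          A.obj ◁ ((α_ _ _ _).hom ≫ X ◁ ev V ≫ (ρ_ X).hom)) ≫ slideOut A hV hX := by
        monoidal
    _ = _ := by rw [Iso.hom_inv_id]; simp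

/-- A retract of a homogeneous object is isomorphic to a homogeneous object. -/
lemma exists_homogeneous_retract {γ : G} {X Y : C} (hX : comp γ X) (i : Y ⟶ X) (p : X ⟶ Y)
    (hip : i ≫ p = 𝟙 Y) : ∃ Y' : C, comp γ Y' ∧ Nonempty (Y ≅ Y') := by
  obtain ⟨s, Z, hZ, ⟨e⟩⟩ := GGraded.decomp (G := G) Y
  -- The identity of a component of the wrong degree factors through `X`, hence vanishes.
  have zero (a : s) (ha : a.1 ≠ γ) : 𝟙 (Z a) = 0 := by
    have h : (biproduct.ι Z a ≫ e.inv ≫ i) = 0 := GGraded.hom_eq_zero ha (hZ a) hX _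
    calc 𝟙 (Z a) = (biproduct.ι Z a ≫ e.inv ≫ i) ≫ p ≫ e.hom ≫ biproduct.π Z a := by
          simp [reassoc_of% hip]
      _ = 0 := by rw [h]; simp
  have tot : ∑ a, biproduct.π Z a ≫ biproduct.ι Z a = 𝟙 (⨁ Z) :=
    IsBilimit.total (biproduct.isBilimit Z)
  have term (a : s) (ha : a.1 ≠ γ) : biproduct.π Z a ≫ biproduct.ι Z a = 0 := by
    rw [← Category.id_comp (biproduct.ι Z a), zero a ha]; simp
  by_cases hs : γ ∈ s
  · refine ⟨Z ⟨γ, hs⟩, hZ ⟨γ, hs⟩, ⟨e ≪≫ ⟨biproduct.π Z _, biproduct.ι Z _, ?_, by simp⟩⟩⟩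
    rw [← tot, Finset.sum_eq_single ⟨γ, hs⟩]
    · intro b _ hb
      exact term b fun h => hb (Subtype.ext h)
    · simp
  -- Without a component of degree `γ` the object `Y` is zero, and a zero object of degree `γ` is
  -- supplied by the empty biproduct.
  · have hfb := GGraded.hasFiniteBiproducts (C := C) γ
    have : HasZeroObject (comp (C := C) γ).FullSubcategory :=
      hasZeroObject_of_hasFiniteBiproducts _
    obtain ⟨O, hO'⟩ := this.zero
    have hO : 𝟙 O.obj = 0 := by
      have : 𝟙 O = 0 := hO'.eq_of_src _ _
      exact congrArg (fun f => (comp (C := C) γ).ι.map f) this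
    have hB : 𝟙 (⨁ Z) = 0 := by
      rw [← tot]
      exact Finset.sum_eq_zero fun a _ => term a fun h => hs (h ▸ a.2)
    refine ⟨O.obj, O.property, ⟨e ≪≫ ⟨0, 0, ?_, ?_⟩⟩⟩
    · rw [hB]; simp
    · rw [hO]; simp

/-- The target is the image of the idempotent `slide`. After tensoring with `X`, the same idempotent
is split by `slideIn` and `slideOut`, so comparing the two splittings gives `A ⊗ X ≅ X ⊗ B`. -/
lemma exists_pretransport [IsIdempotentComplete C] {r : k} {α : G} (A : GCenter G C) {V : C}
    (hV : InvDim α V) (hd : hV.dInv = r • 𝟙 _) (hr : DimInv r V) :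
    ∃ (B : C) (_ : PreTransport α A B) (i : B ⟶ dual V ⊗ A.obj ⊗ V)
      (p : dual V ⊗ A.obj ⊗ V ⟶ B), i ≫ p = 𝟙 B := by
  have idem : slide A hV hV ≫ slide A hV hV = slide A hV hV := by
    apply hr.eq_of_whiskerLeft
    rw [MonoidalCategory.whiskerLeft_comp, ← slideIn_slideOut A hV hd hV.mem, Category.assoc,
      reassoc_of% slideOut_slideIn A hV hr hV.mem]
  obtain ⟨B, i, p, hip, hpi⟩ := IsIdempotentComplete.idempotents_split _ _ idem
  refine ⟨B,
    { iso := fun X hX => ⟨slideOut A hV hX ≫ X ◁ p, X ◁ i ≫ slideIn r A hV hX, ?_, ?_⟩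
      nat := ?_
      left := ?_ }, i, p, hip⟩
  · rw [Category.assoc, ← whiskerLeft_comp_assoc, hpi, reassoc_of% slideOut_slide A hV hd hr hV hX,
      slideOut_slideIn A hV hr hX]
  · rw [Category.assoc, reassoc_of% slideIn_slideOut A hV hd hX, ← hpi,
      ← MonoidalCategory.whiskerLeft_comp, ← MonoidalCategory.whiskerLeft_comp, Category.assoc,
      hip, Category.comp_id, hip, MonoidalCategory.whiskerLeft_id]
  · intro X Y hX hY f
    dsimp only
    rw [reassoc_of% slideOut_natural A hV hX hY f, ← whisker_exchange, Category.assoc]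
  · intro Z X hZ hX hZX
    dsimp only
    rw [step_comp, slideOut_left A hV hZ hX]

/-- Replacing the target of a pretransport by an isomorphic object. -/
def PreTransport.compIso {α : G} {A : GCenter G C} {B B' : C} (T : PreTransport α A B)
    (e : B ≅ B') : PreTransport α A B' where
  iso X hX := T.iso X hX ≪≫ whiskerLeftIso X e
  nat hX hY f := by
    simp only [Iso.trans_hom, whiskerLeftIso_hom, Category.assoc]
    rw [whisker_exchange, reassoc_of% T.nat hX hY f]
  left hZ hX hZX := by
    simp only [Iso.trans_hom, whiskerLeftIso_hom]
    rw [step_comp, T.left hZ hX]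

/-- The graded pieces are not assumed closed under isomorphism, so the image of the idempotent, a
retract of the homogeneous object `V* ⊗ A ⊗ V` when `A` is homogeneous, is first replaced by an
isomorphic object of the right degree. Disjointness makes the degree of `A` unique, so one choice of
target serves all `β`. -/
lemma exists_transport [IsIdempotentComplete C] {r : k} {α : G} (A : GCenter G C) {V : C}
    (hV : InvDim α V) (hd : hV.dInv = r • 𝟙 _) (hr : DimInv r V) :
    ∃ B : GCenter G C, Nonempty (Transport α A B) ∧
      ∀ β : G, comp β A → comp (α⁻¹ * β * α) B := by
  obtain ⟨B₀, T₀, i, p, hip⟩ := exists_pretransport A hV hd hr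
  obtain ⟨B₁, e, hB₁⟩ : ∃ (B₁ : C) (_ : B₀ ≅ B₁),
      ∀ β : G, comp β A.obj → comp (α⁻¹ * β * α) B₁ := by
    by_cases h : ∃ β : G, comp β A.obj
    · obtain ⟨β, hβ⟩ := h
      have hM : comp (α⁻¹ * β * α) (dual V ⊗ A.obj ⊗ V) := by
        simpa [mul_assoc] using tensor_mem (GPivotal.dual_mem hV.mem) (tensor_mem hβ hV.mem)
      obtain ⟨B₁, h₁, ⟨e⟩⟩ := exists_homogeneous_retract hM i p hip
      refine ⟨B₁, e, fun β' hβ' => ?_⟩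
      by_cases hh : β = β'
      · exact hh ▸ h₁
      · exact absurd hβ' (GGraded.disjoint hh _ hβ)
    · exact ⟨B₀, Iso.refl _, fun β hβ => absurd ⟨β, hβ⟩ h⟩
  obtain ⟨B, rfl, T⟩ := (T₀.compIso e).exists_toTransport hr hV.mem
  exact ⟨B, T, hB₁⟩

end Existence

open RelCenter

/-! ### Calculus of lifts and quotients of transports -/

section Lifts

variable {G : Type*} [Group G] {k : Type w} [CommRing k] {C : Type u} [Category.{v} C]
  [Preadditive C] [HasFiniteBiproducts C] [CategoryTheory.Linear k C] [MonoidalCategory C]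
  [PivotalCat C] [GGraded G C] [GPivotal G C] [MonoidalPreadditive C] [MonoidalLinear k C]

/-- The morphism `g` between the targets of two transports lifts the morphism `f` between their
sources. -/
def Lifts {α : G} {A A' B B' : GCenter G C} (T : Transport α A B) (T' : Transport α A' B')
    (f : A ⟶ A') (g : B ⟶ B') : Prop :=
  ∀ (X : C) (hX : comp α X), (T.iso X hX).hom ≫ X ◁ g.f = f.f ▷ X ≫ (T'.iso X hX).hom

/-- `Q` is the quotient of `R` by `T`. -/
def IsQuotient {α γ δ : G} {A B E : GCenter G C} (T : Transport α A B) (Q : Transport γ B E)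
    (R : Transport δ A E) : Prop :=
  ∀ (X Y : C) (hX : comp α X) (hY : comp γ Y) (hXY : comp δ (X ⊗ Y)),
    step (T.iso X hX).hom (Q.iso Y hY).hom = (R.iso (X ⊗ Y) hXY).hom

namespace Lifts

variable {α : G} {A A' A'' B B' B'' : GCenter G C} {T : Transport α A B} {T' : Transport α A' B'}
  {T'' : Transport α A'' B''}

lemma id (T : Transport α A B) : Lifts T T (𝟙 A) (𝟙 B) := fun X hX => by simp

lemma comp {f : A ⟶ A'} {g : B ⟶ B'} {f' : A' ⟶ A''} {g' : B' ⟶ B''} (h : Lifts T T' f g)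
    (h' : Lifts T' T'' f' g') : Lifts T T'' (f ≫ f') (g ≫ g') := fun X hX => by
  rw [comp_f, comp_f, MonoidalCategory.whiskerLeft_comp, reassoc_of% h X hX, h' X hX,
    comp_whiskerRight, Category.assoc]

lemma comp_id {f : A ⟶ A'} {g : B ⟶ B'} {T'' : Transport α A' B''} {g' : B' ⟶ B''}
    (h : Lifts T T' f g) (h' : Lifts T' T'' (𝟙 A') g') : Lifts T T'' f (g ≫ g') := by
  simpa using h.comp h'

lemma id_comp {T' : Transport α A B'} {g : B ⟶ B'} {f' : A ⟶ A''} {g' : B' ⟶ B''}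
    (h : Lifts T T' (𝟙 A) g) (h' : Lifts T' T'' f' g') : Lifts T T'' f' (g ≫ g') := by
  simpa using h.comp h'

lemma of_eq {f f' : A ⟶ A'} {g g' : B ⟶ B'} (h : Lifts T T' f g) (hf : f = f') (hg : g = g') :
    Lifts T T' f' g' := hf ▸ hg ▸ h

lemma tensor {D D' E E' : GCenter G C} {S : Transport α D E} {S' : Transport α D' E'}
    {f : A ⟶ A'} {g : B ⟶ B'} {f' : D ⟶ D'} {g' : E ⟶ E'} (h : Lifts T T' f g)
    (h' : Lifts S S' f' g') : Lifts (T.tensor S) (T'.tensor S') (f ⊗ₘ f') (g ⊗ₘ g') :=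
  fun X hX => by
    change par _ _ ≫ X ◁ (g.f ⊗ₘ g'.f) = (f.f ⊗ₘ f'.f) ▷ X ≫ par _ _
    rw [← par_comp, h X hX, h' X hX, comp_par]

lemma whiskerRight {D E : GCenter G C} (S : Transport α D E) {f : A ⟶ A'} {g : B ⟶ B'}
    (h : Lifts T T' f g) : Lifts (T.tensor S) (T'.tensor S) (f ▷ D) (g ▷ E) :=
  (h.tensor (Lifts.id S)).of_eq (tensorHom_id _ _) (tensorHom_id _ _)

lemma whiskerLeft {D E : GCenter G C} (S : Transport α D E) {f : A ⟶ A'} {g : B ⟶ B'}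
    (h : Lifts T T' f g) : Lifts (S.tensor T) (S.tensor T') (D ◁ f) (E ◁ g) :=
  ((Lifts.id S).tensor h).of_eq (id_tensorHom _ _) (id_tensorHom _ _)

lemma associator (T : Transport α A B) (T' : Transport α A' B') (T'' : Transport α A'' B'') :
    Lifts ((T.tensor T').tensor T'') (T.tensor (T'.tensor T'')) (α_ A A' A'').hom
      (α_ B B' B'').hom := fun _ _ => (par_assoc _ _ _).symm

lemma leftUnitor (T : Transport α A B) :
    Lifts ((Transport.unit α).tensor T) T (λ_ A).hom (λ_ B).hom := fun _ _ => par_unit_left _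

lemma rightUnitor (T : Transport α A B) :
    Lifts (T.tensor (Transport.unit α)) T (ρ_ A).hom (ρ_ B).hom := fun _ _ => par_unit_right _

/-- The principle behind all coherence laws: a morphism between targets is determined by the
morphism of sources that it lifts. -/
lemma unique {r : k} {V : C} (hr : DimInv r V) (hV : GGraded.comp α V) {f : A ⟶ A'}
    {g g' : B ⟶ B'} (h : Lifts T T' f g) (h' : Lifts T T' f g') : g = g' :=
  T.hom_ext hr hV ((h V hV).trans (h' V hV).symm)

end Lifts

namespace IsQuotient

variable {α γ δ : G} {A A' B B' E E' : GCenter G C} {T : Transport α A B} {Q : Transport γ B E}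
  {R : Transport δ A E} {T' : Transport α A' B'} {Q' : Transport γ B' E'}
  {R' : Transport δ A' E'}

lemma tensor (h : IsQuotient T Q R) (h' : IsQuotient T' Q' R') :
    IsQuotient (T.tensor T') (Q.tensor Q') (R.tensor R') := fun X Y hX hY hXY => by
  change step (par _ _) (par _ _) = par _ _
  rw [step_par, h X Y hX hY hXY, h' X Y hX hY hXY]

lemma unit (α γ δ : G) : IsQuotient (C := C) (Transport.unit α) (Transport.unit γ)
    (Transport.unit δ) := fun X Y _ _ _ => step_unit X Y

lemma refl_left (T : Transport α A B) : IsQuotient (Transport.refl A) T T :=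
  fun _ _ hX hY hXY => (T.left hX hY hXY).symm

lemma refl_right (T : Transport α A B) : IsQuotient T (Transport.refl B) T :=
  fun _ _ hX hY hXY => (T.right hX hY hXY).symm

/-- Lifting along `R` is tested at `V ⊗ Y`, where `R` is `T` followed by `Q`; cancelling `T` at `V`
leaves the statement for `Q`. -/
lemma lifts {r : k} {V : C} (hr : DimInv r V) (hV : comp α V) (hδ : α * γ = δ)
    (hQ : IsQuotient T Q R) (hQ' : IsQuotient T' Q' R') {f : A ⟶ A'} {h : B ⟶ B'} {g : E ⟶ E'}
    (h₁ : Lifts T T' f h) (h₂ : Lifts R R' f g) : Lifts Q Q' h g := fun Y hY => by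
  have mem : comp δ (V ⊗ Y) := hδ ▸ tensor_mem hV hY
  apply T.toPreTransport.eq_of_step hr hV
  rw [step_comp, hQ V Y hV hY mem, h₂ _ mem, ← step_middle, h₁ V hV, comp_step,
    hQ' V Y hV hY mem]

/-- Cancellation in stages: at `V ⊗ X ⊗ Y` both sides become `R` once `T` at `V` is put in front, by
associativity of `step`. -/
lemma assoc {r : k} {V : C} (hr : DimInv r V) {α₁ α₂ α₃ α₁₂ α₂₃ α₁₂₃ : G}
    (hV : comp α₁ V) (h₁₂ : α₁ * α₂ = α₁₂) (h₂₃ : α₂ * α₃ = α₂₃) (h₁₂₃ : α₁ * α₂₃ = α₁₂₃)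
    {A B D E : GCenter G C} {T : Transport α₁ A B}
    {Q : Transport α₂ B D} {T' : Transport α₁₂ A D} {S : Transport α₃ D E}
    {R : Transport α₁₂₃ A E} {S' : Transport α₂₃ B E} (h : IsQuotient T Q T')
    (h' : IsQuotient T' S R) (h'' : IsQuotient T S' R) : IsQuotient Q S S' :=
  fun X Y hX hY hXY => by
    have m₁ : comp α₁₂ (V ⊗ X) := h₁₂ ▸ tensor_mem hV hX
    have m₂ : comp α₁₂₃ ((V ⊗ X) ⊗ Y) := by
      rw [← h₁₂₃, ← h₂₃, ← mul_assoc, h₁₂]; exact tensor_mem m₁ hY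
    have m₃ : comp α₁₂₃ (V ⊗ (X ⊗ Y)) := h₁₂₃ ▸ tensor_mem hV hXY
    apply T.toPreTransport.eq_of_step hr hV
    have e := R.nat m₂ m₃ (α_ V X Y).hom
    rw [h'' V _ hV hXY m₃, ← cancel_epi (A.obj ◁ (α_ V X Y).hom), step_assoc,
      h V X hV hX m₁, h' _ Y m₁ hY m₂, e]

end IsQuotient

end Lifts

/-! ### The crossing defined by a choice of transports -/

section Construction

variable {G : Type*} [Group G] {k : Type w} [CommRing k] {C : Type u} [Category.{v} C]
  [Preadditive C] [HasFiniteBiproducts C] [CategoryTheory.Linear k C] [MonoidalCategory C]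
  [PivotalCat C] [GGraded G C] [GPivotal G C] [MonoidalPreadditive C] [MonoidalLinear k C]

variable (G k C) in
/-- A choice, in every degree, of an object of invertible dimension, and of transports along
each degree. -/
structure TransportChoice where
  V : G → C
  mem (α : G) : comp α (V α)
  r : G → k
  dimInv (α : G) : DimInv (r α) (V α)
  obj : G → GCenter G C → GCenter G C
  T (α : G) (A : GCenter G C) : Transport α A (obj α A)
  maps {α β : G} {A : GCenter G C} (hA : comp β A) : comp (α⁻¹ * β * α) (obj α A)

namespace TransportChoice

variable (S : TransportChoice G k C) {α : G} {A A' A'' B B' B'' : GCenter G C}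

/-- The lift of a morphism along transports. -/
noncomputable def lift (T : Transport α A B) (T' : Transport α A' B') (f : A ⟶ A') : B ⟶ B' :=
  (T.exists_map (S.dimInv α) (S.mem α) T' f).choose

lemma lifts_lift (T : Transport α A B) (T' : Transport α A' B') (f : A ⟶ A') :
    Lifts T T' f (S.lift T T' f) :=
  (T.exists_map (S.dimInv α) (S.mem α) T' f).choose_spec

lemma unique (S : TransportChoice G k C) {T : Transport α A B} {T' : Transport α A' B'} {f : A ⟶ A'}
    {g g' : B ⟶ B'} (h : Lifts T T' f g) (h' : Lifts T T' f g') : g = g' :=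
  h.unique (S.dimInv α) (S.mem α) h'

lemma unique' (S : TransportChoice G k C) {T : Transport α A B} {T' : Transport α A' B'}
    {f f' : A ⟶ A'} {g g' : B ⟶ B'} (h : Lifts T T' f g) (h' : Lifts T T' f' g')
    (e : f = f') : g = g' :=
  S.unique h (h'.of_eq e.symm rfl)

/-- The lift of an isomorphism along transports. -/
noncomputable def liftIso (T : Transport α A B) (T' : Transport α A' B') (e : A ≅ A') :
    B ≅ B' where
  hom := S.lift T T' e.hom
  inv := S.lift T' T e.inv
  hom_inv_id := S.unique' ((S.lifts_lift T T' e.hom).comp (S.lifts_lift T' T e.inv)) (Lifts.id T)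
    e.hom_inv_id
  inv_hom_id := S.unique' ((S.lifts_lift T' T e.inv).comp (S.lifts_lift T T' e.hom)) (Lifts.id T')
    e.inv_hom_id

/-- The functor given by the transports in degree `α`. -/
noncomputable def functor (α : G) : GCenter G C ⥤ GCenter G C where
  obj := S.obj α
  map f := S.lift (S.T α _) (S.T α _) f
  map_id _ := S.unique (S.lifts_lift _ _ _) (Lifts.id _)
  map_comp _ _ := S.unique (S.lifts_lift _ _ _) ((S.lifts_lift _ _ _).comp (S.lifts_lift _ _ _))

/-- The transport from `A` to the value of the functor at `A`. -/
def tr (α : G) (A : GCenter G C) : Transport α A ((S.functor α).obj A) := S.T α A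

lemma lifts_map (α : G) {A B : GCenter G C} (f : A ⟶ B) :
    Lifts (S.tr α A) (S.tr α B) f ((S.functor α).map f) := S.lifts_lift _ _ _

/-- The unit constraint. -/
noncomputable def εIso (α : G) : 𝟙_ (GCenter G C) ≅ (S.functor α).obj (𝟙_ (GCenter G C)) :=
  S.liftIso (Transport.unit α) (S.tr α _) (Iso.refl _)

/-- The monoidal constraint. -/
noncomputable def μIso (α : G) (A B : GCenter G C) :
    (S.functor α).obj A ⊗ (S.functor α).obj B ≅ (S.functor α).obj (A ⊗ B) :=
  S.liftIso ((S.tr α A).tensor (S.tr α B)) (S.tr α _) (Iso.refl _)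

lemma lifts_ε (α : G) :
    Lifts (Transport.unit α) (S.tr α (𝟙_ (GCenter G C))) (𝟙 _) (S.εIso α).hom := S.lifts_lift _ _ _

lemma lifts_μ (α : G) (A B : GCenter G C) :
    Lifts ((S.tr α A).tensor (S.tr α B)) (S.tr α (A ⊗ B)) (𝟙 _) (S.μIso α A B).hom :=
  S.lifts_lift _ _ _

/-- The monoidal structure. -/
noncomputable def coreMonoidal (α : G) : (S.functor α).CoreMonoidal where
  εIso := S.εIso α
  μIso := S.μIso α
  μIso_hom_natural_left f B := S.unique
    (((S.lifts_map α f).whiskerRight (S.tr α B)).comp_id (S.lifts_μ α _ B))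
    ((S.lifts_μ α _ B).id_comp (S.lifts_map α (f ▷ B)))
  μIso_hom_natural_right B f := S.unique
    (((S.lifts_map α f).whiskerLeft (S.tr α B)).comp_id (S.lifts_μ α B _))
    ((S.lifts_μ α B _).id_comp (S.lifts_map α (B ◁ f)))
  associativity A B D := S.unique'
    (((S.lifts_μ α A B).whiskerRight (S.tr α D)).comp ((S.lifts_μ α (A ⊗ B) D).comp
      (S.lifts_map α (α_ A B D).hom)))
    ((Lifts.associator _ _ _).comp (((S.lifts_μ α B D).whiskerLeft (S.tr α A)).comp
      (S.lifts_μ α A (B ⊗ D)))) (by simp)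
  left_unitality A := S.unique' (Lifts.leftUnitor (S.tr α A))
    (((S.lifts_ε α).whiskerRight (S.tr α A)).comp ((S.lifts_μ α _ A).comp
      (S.lifts_map α (λ_ A).hom))) (by simp)
  right_unitality A := S.unique' (Lifts.rightUnitor (S.tr α A))
    (((S.lifts_ε α).whiskerLeft (S.tr α A)).comp ((S.lifts_μ α A _).comp
      (S.lifts_map α (ρ_ A).hom))) (by simp)

/-- The functor of a transport choice is monoidal. -/
@[reducible]
noncomputable def monoidal (α : G) : (S.functor α).Monoidal := (S.coreMonoidal α).toMonoidal

attribute [local instance] monoidal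

/-- A quotient of transports. -/
noncomputable def quotient {α γ δ : G} (h : α * γ = δ) {A B E : GCenter G C}
    (T : Transport α A B) (R : Transport δ A E) : Transport γ B E :=
  (T.exists_divide (S.dimInv α) (S.mem α) h R).choose

lemma isQuotient {α γ δ : G} (h : α * γ = δ) {A B E : GCenter G C}
    (T : Transport α A B) (R : Transport δ A E) : IsQuotient T (S.quotient h T R) R :=
  (T.exists_divide (S.dimInv α) (S.mem α) h R).choose_spec

/-- The components of the constraint `φ_α φ_β ≅ φ_{βα}`. -/
noncomputable def mulApp (α β γ : G) (h : β * α = γ) (A : GCenter G C) :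
    (S.functor α).obj ((S.functor β).obj A) ≅ (S.functor γ).obj A :=
  S.liftIso (S.tr α ((S.functor β).obj A)) (S.quotient h (S.tr β A) (S.tr γ A)) (Iso.refl _)

lemma lifts_mul (α β γ : G) (h : β * α = γ) (A : GCenter G C) :
    Lifts (S.tr α ((S.functor β).obj A)) (S.quotient h (S.tr β A) (S.tr γ A)) (𝟙 _)
      (S.mulApp α β γ h A).hom :=
  S.lifts_lift _ _ _

/-- The constraint `φ_α φ_β ≅ φ_{βα}`. -/
noncomputable def mulIso (α β γ : G) (h : β * α = γ) :
    S.functor β ⋙ S.functor α ≅ S.functor γ :=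
  NatIso.ofComponents (fun A => S.mulApp α β γ h A) fun {A B} f =>
    S.unique ((S.lifts_map α _).comp_id (S.lifts_mul α β γ h B))
      ((S.lifts_mul α β γ h A).id_comp (IsQuotient.lifts (S.dimInv β) (S.mem β) h
        (S.isQuotient h _ _) (S.isQuotient h _ _) (S.lifts_map β f) (S.lifts_map γ f)))

/-- The constraint `1 ≅ φ_1`. -/
noncomputable def oneIso : 𝟭 (GCenter G C) ≅ S.functor 1 :=
  NatIso.ofComponents (fun A => S.liftIso (Transport.refl A) (S.tr 1 A) (Iso.refl _)) fun {A B} f =>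
    S.unique (Lifts.comp_id (T := Transport.refl A) (T' := Transport.refl B)
        (fun X hX => (hom_comm f X hX).symm) (S.lifts_lift _ _ _))
      ((S.lifts_lift _ _ _).id_comp (S.lifts_map 1 f))

lemma lifts_one (A : GCenter G C) :
    Lifts (Transport.refl A) (S.tr 1 A) (𝟙 _) (S.oneIso.hom.app A) := S.lifts_lift _ _ _

/-- Both composites lift the constraint `φ_β φ_γ (A) ⟶ φ_{γβ}(A)` to a morphism between targets of
transports of degree `α`, hence coincide. -/
lemma mul_assoc (α β γ : G) (A : GCenter G C) :
    (S.functor α).map (S.mulApp β γ (γ * β) rfl A).hom ≫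
        (S.mulApp α (γ * β) (γ * β * α) rfl A).hom =
      (S.mulApp α β (β * α) rfl ((S.functor γ).obj A)).hom ≫
        (S.mulApp (β * α) γ (γ * β * α) (_root_.mul_assoc γ β α).symm A).hom := by
  have h₁ := S.lifts_mul β γ (γ * β) rfl A
  have h₂ := S.lifts_mul α (γ * β) (γ * β * α) rfl A
  have h₃ := S.lifts_mul α β (β * α) rfl ((S.functor γ).obj A)
  have h₄ := S.lifts_mul (β * α) γ (γ * β * α) (_root_.mul_assoc γ β α).symm A
  have q₁ := S.isQuotient (rfl : γ * β = _) (S.tr γ A) (S.tr (γ * β) A)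
  have q₂ := S.isQuotient (rfl : (γ * β) * α = _) (S.tr (γ * β) A) (S.tr (γ * β * α) A)
  have q₃ := S.isQuotient (rfl : β * α = _) (S.tr β ((S.functor γ).obj A))
    (S.tr (β * α) ((S.functor γ).obj A))
  have q₄ := S.isQuotient (_root_.mul_assoc γ β α).symm (S.tr γ A) (S.tr (γ * β * α) A)
  -- Intermediate transport of degree `α` from `φ_β φ_γ (A)` to `φ_{γβα}(A)`, through which the
  -- right-hand composite is factored.
  have q₅ := S.isQuotient (rfl : β * α = _) (S.tr β ((S.functor γ).obj A)) (S.quotient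
    (_root_.mul_assoc γ β α).symm (S.tr γ A) (S.tr (γ * β * α) A))
  have q₆ := IsQuotient.assoc (S.dimInv γ) (S.mem γ) rfl rfl (_root_.mul_assoc γ β α).symm q₁ q₂ q₄
  exact S.unique ((S.lifts_map α _).comp_id h₂)
    (h₃.id_comp (((IsQuotient.lifts (S.dimInv β) (S.mem β) rfl q₃ q₅ (Lifts.id _) h₄).id_comp
      (IsQuotient.lifts (S.dimInv β) (S.mem β) rfl q₅ q₆ h₁ (Lifts.id _))).of_eq rfl
        (Category.comp_id _)))

lemma mul_one (α : G) (A : GCenter G C) :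
    (S.functor α).map (S.oneIso.hom.app A) ≫ (S.mulApp α 1 α (one_mul α) A).hom =
      𝟙 ((S.functor α).obj A) :=
  S.unique ((S.lifts_map α _).comp_id (S.lifts_mul α 1 α (one_mul α) A))
    (IsQuotient.lifts (S.dimInv 1) (S.mem 1) (one_mul α) (IsQuotient.refl_left _)
      (S.isQuotient (one_mul α) _ _) (S.lifts_one A) (Lifts.id _))

lemma one_mul (α : G) (A : GCenter G C) :
    S.oneIso.hom.app ((S.functor α).obj A) ≫ (S.mulApp 1 α α (_root_.mul_one α) A).hom =
      𝟙 ((S.functor α).obj A) :=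
  S.unique ((S.lifts_one _).id_comp (S.lifts_mul 1 α α (_root_.mul_one α) A))
    (IsQuotient.lifts (S.dimInv α) (S.mem α) (_root_.mul_one α) (IsQuotient.refl_right _)
      (S.isQuotient (_root_.mul_one α) _ _) (Lifts.id _) (Lifts.id _))

instance (α : G) : (S.functor α).Additive where
  map_add {A B f g} := S.unique (S.lifts_map α _) fun X hX => by
    rw [add_f, add_f, MonoidalPreadditive.whiskerLeft_add, Preadditive.comp_add, S.lifts_map α f,
      S.lifts_map α g, MonoidalPreadditive.add_whiskerRight, Preadditive.add_comp]

instance (α : G) : (S.functor α).Linear k where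
  map_smul {A B} f r := S.unique (S.lifts_map α _) fun X hX => by
    change _ ≫ X ◁ (r • ((S.functor α).map f).f) = (r • f.f) ▷ X ≫ _
    rw [MonoidalLinear.whiskerLeft_smul, CategoryTheory.Linear.comp_smul, S.lifts_map α f,
      MonoidalLinear.smul_whiskerRight, CategoryTheory.Linear.smul_comp]

instance (α : G) : (S.functor α).IsEquivalence :=
  Functor.IsEquivalence.mk' (S.functor α⁻¹)
    (S.oneIso ≪≫ (S.mulIso α⁻¹ α 1 (mul_inv_cancel α)).symm)
    (S.mulIso α α⁻¹ 1 (inv_mul_cancel α) ≪≫ S.oneIso.symm)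

/-- In each of the two laws, both sides lift the corresponding monoidal constraint of `φ_β` to a
quotient of transports; for the second law, tensor products of quotients are quotients of tensor
products. -/
lemma mulIso_isMonoidal (α β γ : G) (h : β * α = γ) :
    NatTrans.IsMonoidal (S.mulIso α β γ h).hom where
  unit := by
    rw [Functor.LaxMonoidal.comp_ε, Category.assoc]
    exact S.unique ((S.lifts_ε α).id_comp ((S.lifts_map α _).comp_id (S.lifts_mul α β γ h _)))
      (IsQuotient.lifts (S.dimInv β) (S.mem β) h
          (IsQuotient.unit β α γ) (S.isQuotient h _ _) (S.lifts_ε β) (S.lifts_ε γ))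
  tensor A B := by
    rw [Functor.LaxMonoidal.comp_μ, Category.assoc]
    exact S.unique ((S.lifts_μ α _ _).id_comp ((S.lifts_map α _).comp_id
        (S.lifts_mul α β γ h _))) ((((S.lifts_mul α β γ h A).tensor (S.lifts_mul α β γ h B)).of_eq
          (id_tensorHom_id _ _) rfl).id_comp
          (IsQuotient.lifts (S.dimInv β) (S.mem β) h ((S.isQuotient h _ _).tensor
            (S.isQuotient h _ _)) (S.isQuotient h _ _) (S.lifts_μ β A B) (S.lifts_μ γ A B)))

lemma lifts_refl_tensor (A B : GCenter G C) :
    Lifts ((Transport.refl A).tensor (Transport.refl B)) (Transport.refl (A ⊗ B)) (𝟙 _) (𝟙 _) :=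
  fun X _ => by
    change par _ _ ≫ X ◁ 𝟙 (A.obj ⊗ B.obj) = 𝟙 (A.obj ⊗ B.obj) ▷ X ≫ par _ _
    simp [Transport.refl]

lemma lifts_refl_unit :
    Lifts (Transport.unit (1 : G)) (Transport.refl (𝟙_ (GCenter G C))) (𝟙 _) (𝟙 _) :=
  fun X _ => by
    change unitCrossing X ≫ X ◁ 𝟙 (𝟙_ C) = 𝟙 (𝟙_ C) ▷ X ≫ unitCrossing X
    simp

lemma oneIso_isMonoidal : NatTrans.IsMonoidal S.oneIso.hom where
  unit := S.unique (lifts_refl_unit.id_comp (S.lifts_one _)) (S.lifts_ε 1)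
  tensor A B := S.unique ((lifts_refl_tensor A B).id_comp (S.lifts_one _))
    ((((S.lifts_one A).tensor (S.lifts_one B)).of_eq (id_tensorHom_id _ _) rfl).id_comp
      (S.lifts_μ 1 A B))

/-- The crossing of a transport choice. -/
noncomputable def crossing : Crossing G k (GCenter G C) where
  F := S.functor
  monoidal := S.monoidal
  additive _ := inferInstance
  linear _ := inferInstance
  isEquivalence _ := inferInstance
  maps hX := S.maps hX
  mulIso := S.mulIso
  mulIso_monoidal := S.mulIso_isMonoidal
  oneIso := S.oneIso
  oneIso_monoidal := S.oneIso_isMonoidal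
  mul_assoc := S.mul_assoc
  mul_one := S.mul_one
  one_mul := S.one_mul

/-- The defining property of `φ₂` in evaluated form: crossing `X` and then `Y` is crossing `X ⊗ Y`.
This is already the first hexagon of the braiding. -/
lemma step_mul (α β γ : G) (h : β * α = γ) (A : GCenter G C) {X Y : C} (hX : comp β X)
    (hY : comp α Y) (hXY : comp γ (X ⊗ Y)) :
    step ((S.tr β A).iso X hX).hom ((S.tr α ((S.functor β).obj A)).iso Y hY).hom ≫
      (X ⊗ Y) ◁ ((S.mulIso α β γ h).hom.app A).f = ((S.tr γ A).iso (X ⊗ Y) hXY).hom := by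
  have e := S.lifts_mul α β γ h A Y hY
  change _ ≫ Y ◁ ((S.mulIso α β γ h).hom.app A).f = _ at e
  rw [← step_comp, e, id_f, id_whiskerRight, Category.id_comp]
  exact S.isQuotient h _ _ X Y hX hY hXY

end TransportChoice

end Construction

/-! ### The braiding and systems of transports -/

section Braiding

variable {G : Type*} [Group G] {k : Type w} [CommRing k] {C : Type u} [Category.{v} C]
  [Preadditive C] [HasFiniteBiproducts C] [CategoryTheory.Linear k C] [MonoidalCategory C]
  [PivotalCat C] [GGraded G C] [GPivotal G C] [MonoidalPreadditive C] [MonoidalLinear k C]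

/-- Naturality of the transport along the half braiding `Y ⊗ Z ⟶ Z ⊗ Y`, expanded by its
compatibilities on both sides. This is why a transport evaluated at an object of the center is a
morphism of the center. -/
lemma Transport.comm {α : G} {A B : GCenter G C} (T : Transport α A B) (Y : GCenter G C)
    (hY : comp α Y.obj) (Z : C) (hZ : neutral G C Z) :
    (T.iso Y.obj hY).hom ▷ Z ≫ (tensorβ Y B Z hZ).hom =
      (tensorβ A Y Z hZ).hom ≫ Z ◁ (T.iso Y.obj hY).hom := by
  have h₁ : comp α (Y.obj ⊗ Z) := mem_mul_neutral hY hZ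
  have h₂ : comp α (Z ⊗ Y.obj) := mem_neutral_mul hZ hY
  have e := T.nat h₁ h₂ (Y.β Z hZ).hom
  rw [T.right hY hZ, T.left hZ hY] at e
  unfold step at e
  rw [tensorβ_hom, tensorβ_hom]
  calc _ = (α_ _ _ _).hom ≫ (((α_ _ _ _).inv ≫ (T.iso Y.obj hY).hom ▷ Z ≫ (α_ _ _ _).hom ≫
            Y.obj ◁ (B.β Z hZ).hom ≫ (α_ _ _ _).inv) ≫ (Y.β Z hZ).hom ▷ B.obj) ≫
              (α_ _ _ _).hom := by monoidal
    _ = _ := by rw [← e]; monoidal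

variable {φ : Crossing G k (GCenter G C)}

/-- Transports to the values of the functors of a crossing, through which the crossing and the
braiding are expressed. -/
structure TransportSystem {φ : Crossing G k (GCenter G C)} (τ : GBraiding φ) where
  T (α : G) (A : GCenter G C) : Transport α A ((φ.F α).obj A)
  map (α : G) {A B : GCenter G C} (f : A ⟶ B) : Lifts (T α A) (T α B) f ((φ.F α).map f)
  tensor (α : G) (A B : GCenter G C) :
    Lifts ((T α A).tensor (T α B)) (T α (A ⊗ B)) (𝟙 _) (μ (φ.F α) A B)
  unit (α : G) : Lifts (Transport.unit α) (T α (𝟙_ _)) (𝟙 _) (ε (φ.F α))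
  mul (α β : G) (A : GCenter G C) {X Y : C} (hX : comp β X) (hY : comp α Y)
    (hXY : comp (β * α) (X ⊗ Y)) :
    step ((T β A).iso X hX).hom ((T α ((φ.F β).obj A)).iso Y hY).hom ≫
      (X ⊗ Y) ◁ Hom.f ((φ.mulIso α β (β * α) rfl).hom.app A) =
        ((T (β * α) A).iso (X ⊗ Y) hXY).hom
  one (A : GCenter G C) : Lifts (Transport.refl A) (T 1 A) (𝟙 _) (φ.oneIso.hom.app A)
  braiding {α : G} (A B : GCenter G C) (hB : comp α B) :
    Hom.f (τ.τ A B hB).hom = ((T α A).iso B.obj hB).hom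

namespace TransportChoice

variable (S : TransportChoice G k C)

/-- The components of the braiding. -/
noncomputable def braidIso (X : GCenter G C) {α : G} (Y : GCenter G C) (hY : comp α Y) :
    X ⊗ Y ≅ Y ⊗ (S.functor α).obj X :=
  isoMk (A := X ⊗ Y) (B := Y ⊗ (S.functor α).obj X) ((S.tr α X).iso Y.obj hY)
    (fun Z hZ => (S.tr α X).comm Y hY Z hZ)

/-- A Yang–Baxter argument: the transport of `X` in degree `βα` is natural along the transport `Y ⊗
V ⟶ V ⊗ φ_α(Y)`, and its values at `Y ⊗ V` and at `V ⊗ φ_α(Y)` are stacked transports corrected by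
the two constraints `φ₂`. -/
lemma braidIso_crossing (α : G) (X : GCenter G C) {β : G} {Y : GCenter G C} (hY : comp β Y) :
    (S.μIso α X Y).hom ≫ (S.functor α).map (S.braidIso X Y hY).hom =
      (S.braidIso ((S.functor α).obj X) ((S.functor α).obj Y) (S.maps hY)).hom ≫
        (S.functor α).obj Y ◁ (S.mulIso (α⁻¹ * β * α) α (β * α) (by group)).hom.app X ≫
        (S.functor α).obj Y ◁ (S.mulIso α β (β * α) rfl).inv.app X ≫
        (S.μIso α Y ((S.functor β).obj X)).hom := by
  have l₁ := (S.lifts_μ α X Y).id_comp (S.lifts_map α (S.braidIso X Y hY).hom)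
  have l₂ := S.lifts_μ α Y ((S.functor β).obj X)
  refine ((S.tr α X).tensor (S.tr α Y)).hom_ext (S.dimInv α) (S.mem α) ?_
  rw [l₁ _ (S.mem α)]
  set V := S.V α
  have hV : comp α V := S.mem α
  have hY' : comp (α⁻¹ * β * α) ((S.functor α).obj Y).obj := S.maps hY
  have hg : α * (α⁻¹ * β * α) = β * α := by group
  have m₁ : comp (β * α) (V ⊗ ((S.functor α).obj Y).obj) := hg ▸ tensor_mem hV hY'
  have m₂ : comp (β * α) (Y.obj ⊗ V) := tensor_mem hY hV
  have e₁ := S.step_mul (α⁻¹ * β * α) α (β * α) hg X hV hY' m₁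
  have e₂ := S.step_mul α β (β * α) rfl X hY hV m₂
  -- This is the only geometric input; what follows rearranges it into the composite obtained by
  -- applying the transport of `X ⊗ Y` at `V`.
  have e₃ := (S.tr (β * α) X).nat m₂ m₁ ((S.tr α Y).iso V hV).hom
  set a := ((S.tr α X).iso V hV).hom
  set b := ((S.tr α Y).iso V hV).hom
  set c := ((S.tr (α⁻¹ * β * α) ((S.functor α).obj X)).iso _ hY').hom
  set m := ((S.mulIso (α⁻¹ * β * α) α (β * α) hg).hom.app X).f
  set n := ((S.mulIso α β (β * α) rfl).hom.app X).f
  set n' := ((S.mulIso α β (β * α) rfl).inv.app X).f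
  have hn : n ≫ n' = 𝟙 _ := congrArg Hom.f ((S.mulIso α β (β * α) rfl).hom_inv_id_app X)
  set d := ((S.tr β X).iso Y.obj hY).hom
  set e := ((S.tr α ((S.functor β).obj X)).iso V hV).hom
  rw [← e₁, ← e₂] at e₃
  obtain ⟨μf, hμ⟩ : ∃ μf : ((S.functor α).obj Y).obj ⊗
      ((S.functor α).obj ((S.functor β).obj X)).obj ⟶ _,
      μf = (S.μIso α Y ((S.functor β).obj X)).hom.f := ⟨_, rfl⟩
  have l₂' : par b e ≫ V ◁ μf = _ := (congrArg (fun h => par b e ≫ V ◁ h) hμ).trans (l₂ V hV)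
  change d ▷ V ≫ _ = par a b ≫ V ◁ (c ≫ ((S.functor α).obj Y).obj ◁ m ≫
    ((S.functor α).obj Y).obj ◁ n' ≫ (S.μIso α Y ((S.functor β).obj X)).hom.f)
  rw [← hμ]
  have key : par a b ≫ V ◁ (c ≫ ((S.functor α).obj Y).obj ◁ m) =
      d ▷ V ≫ par b e ≫ V ◁ ((S.functor α).obj Y).obj ◁ n := by
    unfold par
    unfold step at e₃
    calc _ = (α_ _ _ _).hom ≫ (X.obj ◁ b ≫ ((α_ _ _ _).inv ≫ a ▷ _ ≫ (α_ _ _ _).hom ≫ V ◁ c ≫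
              (α_ _ _ _).inv) ≫ (V ⊗ ((S.functor α).obj Y).obj) ◁ m) ≫ (α_ _ _ _).hom := by
          monoidal
      _ = (α_ _ _ _).hom ≫ ((((α_ _ _ _).inv ≫ d ▷ V ≫ (α_ _ _ _).hom ≫ Y.obj ◁ e ≫
              (α_ _ _ _).inv) ≫ ((Y.obj ⊗ V) ◁ n ≫ b ▷ _))) ≫ (α_ _ _ _).hom := by
          rw [e₃]; simp only [Category.assoc]
      _ = _ := by rw [whisker_exchange]; monoidal
  calc _ = d ▷ V ≫ par b e ≫ V ◁ μf := by
        rw [l₂', id_f, id_whiskerRight, Category.id_comp]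
    _ = d ▷ V ≫ par b e ≫ V ◁ ((S.functor α).obj Y).obj ◁ (n ≫ n') ≫
          V ◁ μf := by
        rw [hn]; simp
    _ = (d ▷ V ≫ par b e ≫ V ◁ ((S.functor α).obj Y).obj ◁ n) ≫
          V ◁ ((S.functor α).obj Y).obj ◁ n' ≫
          V ◁ μf := by
        simp
    _ = _ := by rw [← key]; simp

/-- The braiding of a transport choice. -/
noncomputable def braiding : GBraiding S.crossing where
  τ X _ Y hY := S.braidIso X Y hY
  naturality_left f _ Y hY := hom_ext (S.lifts_map _ f Y.obj hY).symm
  naturality_right X _ _ _ hY hY' f := hom_ext ((S.tr _ X).nat hY hY' f.f)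
  tensor_right X {β γ Y Z} hY hZ := hom_ext <| by
    have e := S.step_mul γ β (β * γ) rfl X hY hZ (tensor_mem hY hZ)
    refine e.symm.trans ?_
    unfold step
    simp only [Category.assoc]
    rfl
  tensor_left X Y {γ Z} hZ := hom_ext <| by
    have e := S.lifts_μ γ X Y Z.obj hZ
    rw [id_f, id_whiskerRight, Category.id_comp] at e
    refine e.symm.trans ?_
    obtain ⟨m, hm⟩ : ∃ m : ((S.functor γ).obj X).obj ⊗ ((S.functor γ).obj Y).obj ⟶ _,
      m = (S.μIso γ X Y).hom.f := ⟨_, rfl⟩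
    change ((α_ _ _ _).hom ≫ X.obj ◁ ((S.tr γ Y).iso Z.obj hZ).hom ≫ (α_ _ _ _).inv ≫
      ((S.tr γ X).iso Z.obj hZ).hom ▷ _ ≫ (α_ _ _ _).hom) ≫ Z.obj ◁ (S.μIso γ X Y).hom.f =
      (α_ _ _ _).hom ≫ X.obj ◁ ((S.tr γ Y).iso Z.obj hZ).hom ≫ (α_ _ _ _).inv ≫
      ((S.tr γ X).iso Z.obj hZ).hom ▷ _ ≫ (α_ _ _ _).hom ≫ Z.obj ◁ (S.μIso γ X Y).hom.f
    rw [← hm]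
    simp only [Category.assoc]
  crossing α X _ Y hY := S.braidIso_crossing α X hY

/-- The transport system of a transport choice. -/
noncomputable def system : TransportSystem S.braiding where
  T := S.tr
  map α _ _ f := S.lifts_map α f
  tensor := S.lifts_μ
  unit := S.lifts_ε
  mul α β A _ _ hX hY hXY := S.step_mul α β (β * α) rfl A hX hY hXY
  one := S.lifts_one
  braiding _ _ _ := rfl

end TransportChoice

end Braiding

/-! ### Presentations of transports through `V* ⊗ A ⊗ V` -/

section Presentation

variable {G : Type*} [Group G] {k : Type w} [CommRing k] {C : Type u} [Category.{v} C]
  [Preadditive C] [HasFiniteBiproducts C] [CategoryTheory.Linear k C] [MonoidalCategory C]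
  [PivotalCat C] [GGraded G C] [GPivotal G C] [MonoidalPreadditive C] [MonoidalLinear k C]

/-- The morphisms `p` and `q` present the target of a pretransport as a retract of
`V* ⊗ A ⊗ V`, through `slideOut`. -/
structure Presents {α : G} {A : GCenter G C} {B : C} (T : PreTransport α A B) {V : C}
    (hV : InvDim α V) (p : dual V ⊗ A.obj ⊗ V ⟶ B) (q : B ⟶ dual V ⊗ A.obj ⊗ V) : Prop where
  hp {X : C} (hX : comp α X) : slideOut A hV hX ≫ X ◁ p = (T.iso X hX).hom
  hq {X : C} (hX : comp α X) : (T.iso X hX).hom ≫ X ◁ q = slideOut A hV hX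

lemma slideOut_map {α : G} {A B : GCenter G C} (f : A ⟶ B) {V X : C} (hV : InvDim α V)
    (hX : comp α X) :
    slideOut A hV hX ≫ X ◁ (dual V ◁ f.f ▷ V) = f.f ▷ X ≫ slideOut B hV hX := by
  have h1 := neutral_tensor_dual hX hV.mem
  have e := hom_comm f _ h1
  unfold slideOut
  calc _ = 𝟙 _ ⊗≫ A.obj ◁ X ◁ coevR V ⊗≫ ((A.β _ h1).hom ≫ (X ⊗ dual V) ◁ f.f) ▷ V ⊗≫ 𝟙 _ := by
        monoidal
    _ = 𝟙 _ ⊗≫ (A.obj ◁ (X ◁ coevR V) ≫ f.f ▷ _) ⊗≫ (B.β _ h1).hom ▷ V ⊗≫ 𝟙 _ := by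
        rw [← e]; monoidal
    _ = _ := by rw [whisker_exchange]; monoidal

namespace Presents

variable {α β : G} {A A' : GCenter G C} {B B' : C} {V : C}

/-- The equations of `Presents` leave `p` free on the complement of the idempotent, which `slideOut`
never reaches; `h'` fixes `p` there. -/
lemma p_q {r : k} {T : PreTransport α A B} {hV : InvDim α V} {p : dual V ⊗ A.obj ⊗ V ⟶ B}
    {q : B ⟶ dual V ⊗ A.obj ⊗ V} (h : Presents T hV p q) (hd : hV.dInv = r • 𝟙 _)
    (hr : DimInv r V) (h' : V ◁ p = slideIn r A hV hV.mem ≫ (T.iso V hV.mem).hom) :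
    p ≫ q = slide A hV hV := by
  apply hr.eq_of_whiskerLeft
  rw [MonoidalCategory.whiskerLeft_comp, h', Category.assoc, h.hq,
    slideIn_slideOut A hV hd]

lemma transition {r : k} {T : PreTransport α A B} {hV : InvDim α V}
    {p : dual V ⊗ A.obj ⊗ V ⟶ B} {q : B ⟶ dual V ⊗ A.obj ⊗ V} (h : Presents T hV p q)
    (hd : hV.dInv = r • 𝟙 _) (hr : DimInv r V) {U : C} {hU : InvDim α U}
    {p' : dual U ⊗ A.obj ⊗ U ⟶ B} {q' : B ⟶ dual U ⊗ A.obj ⊗ U} (h' : Presents T hU p' q') :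
    q ≫ slide A hV hU ≫ p' = 𝟙 B := by
  apply T.eq_of_comp_whiskerLeft hr hV.mem
  rw [MonoidalCategory.whiskerLeft_comp, reassoc_of% h.hq, MonoidalCategory.whiskerLeft_comp,
    reassoc_of% slideOut_slide A hV hd hr hU hV.mem, h'.hp]
  simp

lemma q_p {r : k} {T : PreTransport α A B} {hV : InvDim α V}
    {p : dual V ⊗ A.obj ⊗ V ⟶ B} {q : B ⟶ dual V ⊗ A.obj ⊗ V} (h : Presents T hV p q)
    (hr : DimInv r V) : q ≫ p = 𝟙 B := by
  apply T.eq_of_comp_whiskerLeft hr hV.mem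
  rw [MonoidalCategory.whiskerLeft_comp, reassoc_of% h.hq, h.hp]
  simp

lemma step_halfBraiding {r : k} {T : PreTransport α A B} {hV : InvDim α V}
    {p : dual V ⊗ A.obj ⊗ V ⟶ B} {q : B ⟶ dual V ⊗ A.obj ⊗ V} (h : Presents T hV p q)
    (hd : hV.dInv = r • 𝟙 _) (hr : DimInv r V) {X Z : C} (hX : comp α X) (hZ : neutral G C Z)
    (hXZ : comp α (X ⊗ Z)) :
    step (T.iso X hX).hom (q ▷ Z ≫ slideThrough A hV Z hZ ≫ Z ◁ p) =
      (T.iso (X ⊗ Z) hXZ).hom := by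
  rw [← step_middle, h.hq, step_comp, slideThrough_eq A hV hd, slideOut_slideAcross A hV hr hV hX
    hXZ, h.hp]

lemma comp_map {T : PreTransport α A B} {T' : PreTransport α A' B'} {hV : InvDim α V}
    {p : dual V ⊗ A.obj ⊗ V ⟶ B} {q : B ⟶ dual V ⊗ A.obj ⊗ V} (h : Presents T hV p q)
    {p' : dual V ⊗ A'.obj ⊗ V ⟶ B'} {q' : B' ⟶ dual V ⊗ A'.obj ⊗ V} (h' : Presents T' hV p' q')
    (f : A ⟶ A') {X : C} (hX : comp α X) :
    (T.iso X hX).hom ≫ X ◁ (q ≫ dual V ◁ f.f ▷ V ≫ p') = f.f ▷ X ≫ (T'.iso X hX).hom := by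
  rw [MonoidalCategory.whiskerLeft_comp, reassoc_of% h.hq, MonoidalCategory.whiskerLeft_comp,
    reassoc_of% slideOut_map f, h'.hp]

lemma comp_tensor {T : PreTransport α A B} {T' : PreTransport α A' B'} {E : C}
    {S : PreTransport α (A ⊗ A') E} {hV : InvDim α V}
    {p : dual V ⊗ A.obj ⊗ V ⟶ B} {q : B ⟶ dual V ⊗ A.obj ⊗ V} (h : Presents T hV p q)
    {p' : dual V ⊗ A'.obj ⊗ V ⟶ B'} {q' : B' ⟶ dual V ⊗ A'.obj ⊗ V} (h' : Presents T' hV p' q')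
    {p'' : dual V ⊗ (A ⊗ A').obj ⊗ V ⟶ E} {q'' : E ⟶ dual V ⊗ (A ⊗ A').obj ⊗ V}
    (h'' : Presents S hV p'' q'') {X : C} (hX : comp α X) :
    par (T.iso X hX).hom (T'.iso X hX).hom ≫ X ◁ ((q ⊗ₘ q') ≫
      (𝟙 _ ⊗≫ dual V ◁ A.obj ◁ evR V ▷ A'.obj ▷ V ⊗≫ 𝟙 (dual V ⊗ (A.obj ⊗ A'.obj) ⊗ V)) ≫ p'') =
      (S.iso X hX).hom := by
  have e := slideOut_tensor A A' hV hX
  rw [← h.hq, ← h'.hq, par_comp, Category.assoc] at e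
  have aux {D D₁ D₂ D₃ : C} (a : D ⟶ X ⊗ D₁) (b : D₁ ⟶ D₂) (c : D₂ ⟶ D₃) (d : D₃ ⟶ E) :
      a ≫ X ◁ (b ≫ c ≫ d) = (a ≫ X ◁ b ≫ X ◁ c) ≫ X ◁ d := by simp
  exact (aux _ _ _ _).trans ((congrArg (fun x => x ≫ X ◁ p'') e).trans (h''.hp hX))

lemma comp_unit {E : C} {S : PreTransport α (𝟙_ (GCenter G C)) E} {hV : InvDim α V}
    {p : dual V ⊗ (𝟙_ (GCenter G C) : GCenter G C).obj ⊗ V ⟶ E}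
    {q : E ⟶ dual V ⊗ (𝟙_ (GCenter G C) : GCenter G C).obj ⊗ V} (h : Presents S hV p q) {X : C}
    (hX : comp α X) :
    unitCrossing X ≫ X ◁ ((coevR V ≫ dual V ◁ (λ_ V).inv) ≫ p) = (S.iso X hX).hom := by
  have aux {D D₁ D₂ : C} (a : D ⟶ X ⊗ D₁) (b : D₁ ⟶ D₂) (c : D₂ ⟶ E) :
      a ≫ X ◁ (b ≫ c) = (a ≫ X ◁ b) ≫ X ◁ c := by simp
  exact (aux _ _ _).trans
    ((congrArg (fun x => x ≫ X ◁ p) (slideOut_unit hV hX).symm).trans (h.hp hX))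

lemma comp_one {E : C} {S : PreTransport 1 A E} {hV : InvDim (1 : G) V}
    {p : dual V ⊗ A.obj ⊗ V ⟶ E} {q : E ⟶ dual V ⊗ A.obj ⊗ V} (h : Presents S hV p q) {X : C}
    (hX : neutral G C X) :
    (A.β X hX).hom ≫ X ◁ (slideUnit A hV ≫ p) = (S.iso X hX).hom := by
  rw [MonoidalCategory.whiskerLeft_comp, reassoc_of% slideOut_slideUnit A hV hX, h.hp hX]

end Presents

/-- Compatibility of `T` on the right and `q` turn the transport at `X` followed by the half
braiding of `B` at `Y ⊗ U*` into `slideOut` at `X ⊗ (Y ⊗ U*)`. Then `slideAcross` replaces `V` by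
`W`, and naturality along `ev U` splits off a loop of `U`, cancelled by `s`. -/
lemma step_slideMul {r s : k} {α β : G} {A B : GCenter G C} (T : Transport β A B) {U V W : C}
    (hU : InvDim α U) (hV : InvDim β V) (hW : InvDim (β * α) W) (hs : hU.dInv = s • 𝟙 _)
    (hs' : DimInv s U) (hr : hV.dInv = r • 𝟙 _) (hr' : DimInv r V)
    {p : dual V ⊗ A.obj ⊗ V ⟶ B.obj} {q : B.obj ⟶ dual V ⊗ A.obj ⊗ V}
    (h : Presents T.toPreTransport hV p q) {X Y : C} (hX : comp β X) (hY : comp α Y)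
    (hXY : comp (β * α) (X ⊗ Y)) :
    step (T.iso X hX).hom (slideOut B hU hY ≫ Y ◁ (dual U ◁ q ▷ U ≫ slideMul A hU hV hW)) =
      slideOut A hW hXY := by
  have n₁ : neutral G C (Y ⊗ dual U) := neutral_tensor_dual hY hU.mem
  have n₂ := neutral_triple hU.mem hV.mem hW.mem
  have m₁ : comp β (X ⊗ (Y ⊗ dual U)) := mem_mul_neutral hX n₁
  have m₂ : comp (β * α) ((X ⊗ (Y ⊗ dual U)) ⊗ U) := tensor_mem m₁ hU.mem
  have e₁ : step (T.iso X hX).hom (B.β _ n₁).hom ≫ (X ⊗ (Y ⊗ dual U)) ◁ q =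
      slideOut A hV m₁ := by
    rw [← T.right hX n₁ m₁, h.hq]
  have e₂ := slideOut_slideAcross A hV hr' hW m₁ m₂ n₂
  let f : (X ⊗ (Y ⊗ dual U)) ⊗ U ⟶ X ⊗ Y := 𝟙 _ ⊗≫ (X ⊗ Y) ◁ ev U ⊗≫ 𝟙 (X ⊗ Y)
  have e₃ := slideOut_natural A hW m₂ hXY f
  rw [slideMul_eq A hU hV hW hs hr]
  calc _ = s • (𝟙 _ ⊗≫ ((T.iso X hX).hom ▷ (Y ⊗ 𝟙_ C) ≫ (X ⊗ B.obj) ◁ (Y ◁ coevR U)) ⊗≫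
            X ◁ (B.β (Y ⊗ dual U) n₁).hom ▷ U ⊗≫ X ◁ Y ◁ dual U ◁ q ▷ U ⊗≫
            X ◁ Y ◁ dual U ◁ slideAcross r A n₂ ⊗≫ f ▷ (dual W ⊗ A.obj ⊗ W) ⊗≫ 𝟙 _) := by
        unfold step slideOut
        simp only [MonoidalLinear.whiskerLeft_smul, CategoryTheory.Linear.comp_smul,
          CategoryTheory.Linear.smul_comp]
        congr 1
        dsimp only [f]
        monoidal
    _ = s • (𝟙 _ ⊗≫ A.obj ◁ (X ⊗ Y) ◁ coevR U ⊗≫ (step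
              (step (T.iso X hX).hom (B.β _ n₁).hom ≫ (X ⊗ (Y ⊗ dual U)) ◁ q)
              (slideAcross r A n₂) ≫ f ▷ (dual W ⊗ A.obj ⊗ W)) ⊗≫ 𝟙 _) := by
        rw [← whisker_exchange]
        unfold step
        congr 1
        monoidal
    _ = s • (𝟙 _ ⊗≫ A.obj ◁ (X ⊗ Y) ◁ coevR U ⊗≫ A.obj ◁ f ≫ slideOut A hW hXY) := by
        rw [e₁, e₂, ← e₃]; congr 1; monoidal
    _ = (ρ_ (A.obj ⊗ X ⊗ Y)).inv ≫ (s • ((A.obj ⊗ X ⊗ Y) ◁ coevR U ≫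
          (A.obj ⊗ X ⊗ Y) ◁ ev U)) ≫ (ρ_ (A.obj ⊗ X ⊗ Y)).hom ≫ slideOut A hW hXY := by
        rw [CategoryTheory.Linear.smul_comp, CategoryTheory.Linear.comp_smul]
        congr 1
        dsimp only [f]
        monoidal
    _ = _ := by rw [hs'.whiskerLeft_eq]; simp

end Presentation

/-! ### Canonical data correspond to systems of transports -/

section Canonical

variable {G : Type*} [Group G] {k : Type w} [CommRing k] {C : Type u} [Category.{v} C]
  [Preadditive C] [HasFiniteBiproducts C] [CategoryTheory.Linear k C] [MonoidalCategory C]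
  [PivotalCat C] [GGraded G C] [GPivotal G C] [MonoidalPreadditive C] [MonoidalLinear k C]

/-- Any pretransport out of `A` has the same source as `slideOut`, so the comparisons between the
two are families to which descent applies: `q` descends from the inverse of `T` followed by
`slideOut`, and `p` from `slideIn` followed by `T`. -/
lemma PreTransport.exists_presents {r : k} {α : G} {A : GCenter G C} {B : C}
    (T : PreTransport α A B) {V : C} (hV : InvDim α V) (hd : hV.dInv = r • 𝟙 _)
    (hr : DimInv r V) : ∃ p q, Presents T hV p q ∧
      V ◁ p = slideIn r A hV hV.mem ≫ (T.iso V hV.mem).hom := by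
  have nat {X Y : C} (hX : comp α X) (hY : comp α Y) (f : X ⟶ Y) :
      f ▷ B ≫ (T.iso Y hY).inv ≫ slideOut A hV hY =
        ((T.iso X hX).inv ≫ slideOut A hV hX) ≫ f ▷ (dual V ⊗ A.obj ⊗ V) := by
    rw [← reassoc_of% T.inv_nat hX hY f, slideOut_natural A hV hX hY, Category.assoc]
  have lin {Z X : C} (hZ : neutral G C Z) (hX : comp α X) (hZX : comp α (Z ⊗ X)) :
      (T.iso (Z ⊗ X) hZX).inv ≫ slideOut A hV hZX =
        (α_ _ _ _).hom ≫ Z ◁ ((T.iso X hX).inv ≫ slideOut A hV hX) ≫ (α_ _ _ _).inv := by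
    rw [Iso.inv_comp_eq, slideOut_left A hV hZ hX, T.left hZ hX]
    unfold step
    simp
  have split {X : C} (hX : comp α X) : (slideIn r A hV hX ≫ (T.iso X hX).hom) ≫
      (T.iso X hX).inv ≫ slideOut A hV hX = X ◁ slide A hV hV := by
    rw [Category.assoc, Iso.hom_inv_id_assoc, slideIn_slideOut A hV hd]
  -- The family defining `q` is split mono, so naturality and linearity of the family defining `p`
  -- may be tested after composing with it, where only `X ◁ slide` appears.
  have mono {X D : C} (hX : comp α X) {f g : D ⟶ X ⊗ B}
      (h : f ≫ (T.iso X hX).inv ≫ slideOut A hV hX = g ≫ (T.iso X hX).inv ≫ slideOut A hV hX) :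
      f = g := by
    have e := congrArg (fun x => x ≫ slideIn r A hV hX ≫ (T.iso X hX).hom) h
    simpa [reassoc_of% slideOut_slideIn A hV hr hX] using e
  obtain ⟨q, hq⟩ := exists_whiskerLeft_eq hr hV.mem
    (fun X hX => (T.iso X hX).inv ≫ slideOut A hV hX) (fun X Y hX hY f => nat hX hY f)
    (fun Z X hZ hX hZX => lin hZ hX hZX)
  obtain ⟨p, hp⟩ := exists_whiskerLeft_eq hr hV.mem
    (fun X hX => slideIn r A hV hX ≫ (T.iso X hX).hom)
    (fun X Y hX hY f => mono hY (by
      rw [Category.assoc, split hY, Category.assoc, nat hX hY, ← Category.assoc, split hX,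
        whisker_exchange]))
    (fun Z X hZ hX hZX => mono hZX (by
      rw [split hZX, lin hZ hX, Category.assoc, Category.assoc, Iso.inv_hom_id_assoc,
        ← MonoidalCategory.whiskerLeft_comp_assoc, split hX]
      simp))
  refine ⟨p, q, ⟨fun {X} hX => ?_, fun {X} hX => ?_⟩, hp V hV.mem⟩
  · rw [hp X hX, reassoc_of% slideOut_slideIn A hV hr hX]
  · rw [hq X hX, Iso.hom_inv_id_assoc]

/-- Each formula for the canonical structure is checked after crossing a test object, where both
sides reduce to the same transport; the test object is then cancelled by invertibility of its
dimension. -/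
lemma TransportSystem.isCanonical {φ : Crossing G k (GCenter G C)} {τ : GBraiding φ}
    (S : TransportSystem τ) (h1 : IsSimpleObj k (𝟙_ C)) : IsCanonical φ τ := by
  have key {α : G} {V : C} (hV : InvDim α V) := hV.exists_dimInv h1
  have key' {α : G} {V : C} (hV : InvDim α V) (A : GCenter G C) :
      ∃ p q, Presents (S.T α A).toPreTransport hV p q ∧ p ≫ q = slide A hV hV := by
    obtain ⟨r, hd, hr⟩ := key hV
    obtain ⟨p, q, h, h'⟩ := (S.T α A).toPreTransport.exists_presents hV hd hr
    exact ⟨p, q, h, h.p_q hd hr h'⟩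
  choose p q h hpq using @key'
  refine ⟨{ p := p, q := q, p_q := hpq, q_p := ?_, transition := ?_, halfBraiding := ?_, map := ?_,
            tensor := ?_, unit := ?_, mul := ?_, one := ?_, braiding := ?_ }⟩
  · intro α V hV A
    obtain ⟨r, hd, hr⟩ := key hV
    exact (h hV A).q_p hr
  · intro α U V hU hV A
    obtain ⟨r, hd, hr⟩ := key hV
    exact (h hV A).transition hd hr (h hU A)
  · intro α V hV A X hX
    obtain ⟨r, hd, hr⟩ := key hV
    apply (S.T α A).eq_of_step hr hV.mem
    rw [(h hV A).step_halfBraiding hd hr hV.mem hX (mem_mul_neutral hV.mem hX),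
      (S.T α A).right hV.mem hX]
  · intro α V hV A B f
    obtain ⟨r, hd, hr⟩ := key hV
    apply (S.T α A).eq_of_comp_whiskerLeft hr hV.mem
    rw [(h hV A).comp_map (h hV B), S.map α f V hV.mem]
  · intro α V hV A B
    obtain ⟨r, hd, hr⟩ := key hV
    apply ((S.T α A).tensor (S.T α B)).eq_of_comp_whiskerLeft hr hV.mem
    refine (S.tensor α A B V hV.mem).trans ?_
    rw [id_f, id_whiskerRight, Category.id_comp]
    exact ((h hV A).comp_tensor (h hV B) (h hV (A ⊗ B)) hV.mem).symm
  · intro α V hV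
    obtain ⟨r, hd, hr⟩ := key hV
    apply (Transport.unit α).eq_of_comp_whiskerLeft hr hV.mem
    refine (S.unit α V hV.mem).trans ?_
    rw [id_f, id_whiskerRight, Category.id_comp]
    exact ((h hV _).comp_unit hV.mem).symm
  · intro α β U V W hU hV hW A
    obtain ⟨r, hr, hr'⟩ := key hV
    obtain ⟨s, hs, hs'⟩ := key hU
    have hVU : comp (β * α) (V ⊗ U) := tensor_mem hV.mem hU.mem
    have e := S.mul α β A hV.mem hU.mem hVU
    have e' := step_slideMul (S.T β A) hU hV hW hs hs' hr hr' (h hV A) hV.mem hU.mem hVU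
    -- The constraint `φ₂` sits behind two stacked transports, so it is tested on `V ⊗ U` and both
    -- factors are cancelled.
    have e'' : step ((S.T β A).iso V hV.mem).hom ((S.T α ((φ.F β).obj A)).iso U hU.mem).hom ≫
        (V ⊗ U) ◁ Hom.f ((φ.mulIso α β (β * α) rfl).hom.app A) =
          step ((S.T β A).iso V hV.mem).hom ((S.T α ((φ.F β).obj A)).iso U hU.mem).hom ≫
        (V ⊗ U) ◁ (q hU ((φ.F β).obj A) ≫ dual U ◁ q hV A ▷ U ≫ slideMul A hU hV hW ≫ p hW A) := by
      rw [e, ← (h hW A).hp hVU, ← e', ← (h hU _).hq, ← step_comp, ← step_comp]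
      simp
    rw [cancel_epi, tensor_whiskerLeft, tensor_whiskerLeft, cancel_epi, cancel_mono] at e''
    exact hs'.eq_of_whiskerLeft (hr'.eq_of_whiskerLeft e'')
  · intro U hU A
    obtain ⟨r, hd, hr⟩ := key hU
    apply (Transport.refl A).eq_of_comp_whiskerLeft hr hU.mem
    refine (S.one A U hU.mem).trans ?_
    rw [id_f, id_whiskerRight, Category.id_comp]
    exact ((h hU A).comp_one hU.mem).symm
  · intro α V hV A B hB
    rw [S.braiding, (h hV A).hp hB]

namespace CanonicalData

variable {φ : Crossing G k (GCenter G C)} {τ : GBraiding φ} (K : CanonicalData φ τ) {α : G} {V : C}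
  (hV : InvDim α V) {r : k} (hd : hV.dInv = r • 𝟙 _) (hr : DimInv r V) (A : GCenter G C)

/-- The pretransport given by the morphisms `p` and `q`. -/
noncomputable def preTransport : PreTransport α A ((φ.F α).obj A).obj where
  iso X hX :=
    { hom := slideOut A hV hX ≫ X ◁ K.p hV A
      inv := X ◁ K.q hV A ≫ slideIn r A hV hX
      hom_inv_id := by
        rw [Category.assoc, ← MonoidalCategory.whiskerLeft_comp_assoc, K.p_q,
          reassoc_of% slideOut_slide A hV hd hr hV hX, slideOut_slideIn A hV hr hX]
      inv_hom_id := by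
        rw [Category.assoc, reassoc_of% slideIn_slideOut A hV hd hX,
          ← MonoidalCategory.whiskerLeft_comp, ← MonoidalCategory.whiskerLeft_comp,
          K.transition, MonoidalCategory.whiskerLeft_id] }
  nat hX hY f := by
    rw [reassoc_of% slideOut_natural A hV hX hY f, Category.assoc, whisker_exchange]
  left hZ hX hZX := by
    rw [step_comp, ← slideOut_left A hV hZ hX]

lemma presents : Presents (K.preTransport hV hd hr A) hV (K.p hV A) (K.q hV A) where
  hp _ := rfl
  hq {X} hX := by
    change (slideOut A hV hX ≫ X ◁ K.p hV A) ≫ _ = _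
    rw [Category.assoc, ← MonoidalCategory.whiskerLeft_comp, K.p_q, slideOut_slide A hV hd hr]

/-- The transport given by the morphisms `p` and `q`. -/
noncomputable def transport : Transport α A ((φ.F α).obj A) where
  toPreTransport := K.preTransport hV hd hr A
  right hX hZ hXZ := by
    rw [K.halfBraiding hV, (K.presents hV hd hr A).step_halfBraiding hd hr hX hZ]

/-- The transport system of a canonical crossing and braiding. -/
noncomputable def system {V : G → C} (hV : ∀ α, InvDim α (V α)) {r : G → k}
    (hd : ∀ α, (hV α).dInv = r α • 𝟙 _) (hr : ∀ α, DimInv (r α) (V α)) : TransportSystem τ where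
  T α := K.transport (hV α) (hd α) (hr α)
  map α A B f X hX := by
    rw [K.map (hV α)]
    exact (K.presents (hV α) (hd α) (hr α) A).comp_map (K.presents (hV α) (hd α) (hr α) B) f hX
  tensor α A B X hX := by
    rw [K.tensor (hV α), id_f, id_whiskerRight, Category.id_comp]
    exact (K.presents (hV α) (hd α) (hr α) A).comp_tensor (K.presents (hV α) (hd α) (hr α) B)
      (K.presents (hV α) (hd α) (hr α) (A ⊗ B)) hX
  unit α X hX := by
    rw [K.unit (hV α), id_f, id_whiskerRight, Category.id_comp]
    exact (K.presents (hV α) (hd α) (hr α) _).comp_unit hX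
  mul α β A X Y hX hY hXY := by
    rw [K.mul (hV α) (hV β) (hV (β * α))]
    have e := step_slideMul (K.transport (hV β) (hd β) (hr β) A) (hV α) (hV β) (hV (β * α)) (hd α)
      (hr α) (hd β) (hr β) (K.presents (hV β) (hd β) (hr β) A) hX hY hXY
    have e₁ := (K.presents (hV (β * α)) (hd _) (hr _) A).hp hXY
    have e₂ := (K.presents (hV α) (hd _) (hr _) ((φ.F β).obj A)).hq hY
    refine Eq.trans ?_ e₁
    rw [← e, ← e₂, ← step_comp, ← step_comp]
    simp only [MonoidalCategory.whiskerLeft_comp, Category.assoc]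
    rfl
  one A X hX := by
    rw [K.one (hV 1), id_f, id_whiskerRight, Category.id_comp]
    exact (K.presents (hV 1) (hd 1) (hr 1) A).comp_one hX
  braiding A B hB := K.braiding (hV _) A B hB

end CanonicalData

end Canonical

/-! ### Traces in pivotal categories -/

section Trace

variable {C : Type u} [Category.{v} C] [MonoidalCategory C] [PivotalCat C]

lemma coevR_dualMapR {X Y : C} (g : X ⟶ Y) :
    coevR Y ≫ dualMapR g ▷ Y = coevR X ≫ dual X ◁ g := by
  have key := zigzagR Y
  unfold dualMapR
  calc _ = 𝟙 _ ⊗≫ (𝟙_ C ◁ coevR Y ≫ coevR X ▷ _) ⊗≫ dual X ◁ g ▷ dual Y ▷ Y ⊗≫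
            dual X ◁ evR Y ▷ Y ⊗≫ 𝟙 _ := by monoidal
    _ = 𝟙 _ ⊗≫ coevR X ⊗≫ dual X ◁ (X ◁ coevR Y ≫ g ▷ _) ⊗≫
            dual X ◁ evR Y ▷ Y ⊗≫ 𝟙 _ := by rw [whisker_exchange]; monoidal
    _ = 𝟙 _ ⊗≫ coevR X ⊗≫ dual X ◁ g ⊗≫ dual X ◁ ((ρ_ Y).inv ≫ Y ◁ coevR Y ≫ (α_ _ _ _).inv ≫
            evR Y ▷ Y ≫ (λ_ Y).hom) ⊗≫ 𝟙 _ := by rw [whisker_exchange]; monoidal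
    _ = _ := by rw [key]; monoidal

/-- Cyclicity of the left trace. -/
lemma trL_comm {X Y : C} (f : X ⟶ Y) (g : Y ⟶ X) : trL (f ≫ g) = trL (g ≫ f) := by
  unfold trL
  -- The morphism `g` leaves its strand through the left duality and returns in front of `f` through
  -- the right one; equality of the two dual functors closes the circle.
  rw [MonoidalCategory.whiskerLeft_comp, Category.assoc, ← dualMapL_ev, whisker_exchange_assoc,
    PivotalCat.dualMap_eq, reassoc_of% coevR_dualMapR g, MonoidalCategory.whiskerLeft_comp,
    Category.assoc]

/-- The nested coevaluation `𝟙 ⟶ X* ⊗ Y* ⊗ Y ⊗ X`. -/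
def coevRTensor (X Y : C) : 𝟙_ C ⟶ (dual X ⊗ dual Y) ⊗ (Y ⊗ X) :=
  coevR X ≫ dual X ◁ ((λ_ X).inv ≫ coevR Y ▷ X ≫ (α_ _ _ _).hom) ≫ (α_ _ _ _).inv

/-- The nested coevaluation `𝟙 ⟶ Y ⊗ X ⊗ X* ⊗ Y*`. -/
def coevTensor (X Y : C) : 𝟙_ C ⟶ (Y ⊗ X) ⊗ (dual X ⊗ dual Y) :=
  coev Y ≫ Y ◁ ((λ_ _).inv ≫ coev X ▷ dual Y ≫ (α_ _ _ _).hom) ≫ (α_ _ _ _).inv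

lemma zigzagR_tensor (X Y : C) :
    (ρ_ (Y ⊗ X)).inv ≫ (Y ⊗ X) ◁ coevRTensor X Y ≫ (α_ _ _ _).inv ≫ evRTensor X Y ▷ (Y ⊗ X) ≫
      (λ_ _).hom = 𝟙 (Y ⊗ X) := by
  have kX := zigzagR X
  have kY := zigzagR Y
  unfold coevRTensor evRTensor
  calc _ = 𝟙 _ ⊗≫ Y ◁ X ◁ coevR X ⊗≫ Y ◁ ((X ⊗ dual X) ◁ coevR Y ≫ evR X ▷ _) ▷ X ⊗≫
              evR Y ▷ Y ▷ X ⊗≫ 𝟙 _ := by monoidal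
    _ = 𝟙 _ ⊗≫ Y ◁ ((ρ_ X).inv ≫ X ◁ coevR X ≫ (α_ _ _ _).inv ≫ evR X ▷ X ≫ (λ_ X).hom) ⊗≫
          ((ρ_ Y).inv ≫ Y ◁ coevR Y ≫ (α_ _ _ _).inv ≫ evR Y ▷ Y ≫ (λ_ Y).hom) ▷ X ⊗≫ 𝟙 _ := by
        rw [whisker_exchange]; monoidal
    _ = _ := by rw [kX, kY]; monoidal

lemma zigzag_tensor (X Y : C) :
    (λ_ (Y ⊗ X)).inv ≫ coevTensor X Y ▷ (Y ⊗ X) ≫ (α_ _ _ _).hom ≫ (Y ⊗ X) ◁ evTensor X Y ≫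
      (ρ_ _).hom = 𝟙 (Y ⊗ X) := by
  have kX := zigzag X
  have kY := zigzag Y
  unfold coevTensor evTensor
  calc _ = 𝟙 _ ⊗≫ coev Y ▷ (Y ⊗ X) ⊗≫ Y ◁ (coev X ▷ (dual Y ⊗ Y) ≫ _ ◁ ev Y) ▷ X ⊗≫
              Y ◁ X ◁ ev X ⊗≫ 𝟙 _ := by monoidal
    _ = 𝟙 _ ⊗≫ ((λ_ Y).inv ≫ coev Y ▷ Y ≫ (α_ _ _ _).hom ≫ Y ◁ ev Y ≫ (ρ_ Y).hom) ▷ X ⊗≫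
          Y ◁ ((λ_ X).inv ≫ coev X ▷ X ≫ (α_ _ _ _).hom ≫ X ◁ ev X ≫ (ρ_ X).hom) ⊗≫ 𝟙 _ := by
        rw [← whisker_exchange]; monoidal
    _ = _ := by rw [kX, kY]; monoidal

lemma coevRTensor_dualTensorR (X Y : C) :
    coevRTensor X Y ≫ dualTensorR X Y ▷ (Y ⊗ X) = coevR (Y ⊗ X) := by
  unfold dualTensorR
  calc _ = 𝟙 _ ⊗≫ (𝟙_ C ◁ coevRTensor X Y ≫ coevR (Y ⊗ X) ▷ _) ⊗≫
            dual (Y ⊗ X) ◁ evRTensor X Y ▷ (Y ⊗ X) ⊗≫ 𝟙 _ := by monoidal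
    _ = 𝟙 _ ⊗≫ coevR (Y ⊗ X) ⊗≫ dual (Y ⊗ X) ◁ ((ρ_ (Y ⊗ X)).inv ≫ (Y ⊗ X) ◁ coevRTensor X Y ≫
          (α_ _ _ _).inv ≫ evRTensor X Y ▷ (Y ⊗ X) ≫ (λ_ _).hom) ⊗≫ 𝟙 _ := by
        rw [whisker_exchange]; monoidal
    _ = _ := by rw [zigzagR_tensor]; monoidal

lemma coevTensor_dualTensorL (X Y : C) :
    coevTensor X Y ≫ (Y ⊗ X) ◁ dualTensorL X Y = coev (Y ⊗ X) := by
  unfold dualTensorL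
  calc _ = 𝟙 _ ⊗≫ (coevTensor X Y ▷ 𝟙_ C ≫ _ ◁ coev (Y ⊗ X)) ⊗≫
            (Y ⊗ X) ◁ evTensor X Y ▷ dual (Y ⊗ X) ⊗≫ 𝟙 _ := by monoidal
    _ = 𝟙 _ ⊗≫ coev (Y ⊗ X) ⊗≫ ((λ_ (Y ⊗ X)).inv ≫ coevTensor X Y ▷ (Y ⊗ X) ≫
          (α_ _ _ _).hom ≫ (Y ⊗ X) ◁ evTensor X Y ≫ (ρ_ _).hom) ▷ dual (Y ⊗ X) ⊗≫ 𝟙 _ := by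
        rw [← whisker_exchange]; monoidal
    _ = _ := by rw [zigzag_tensor]; monoidal

/-- The nested evaluation and coevaluation differ from those of `Y ⊗ X` by the left and the right
monoidal constraints of duality; these agree, so they cancel in a closed diagram. -/
lemma trL_tensor {X Y : C} (g : Y ⊗ X ⟶ Y ⊗ X) :
    trL g = coevRTensor X Y ≫ (dual X ⊗ dual Y) ◁ g ≫ evTensor X Y := by
  unfold trL
  rw [← dualTensorL_ev, whisker_exchange_assoc, PivotalCat.dualTensor_eq,
    reassoc_of% coevRTensor_dualTensorR X Y]

lemma trR_tensor {X Y : C} (g : Y ⊗ X ⟶ Y ⊗ X) :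
    trR g = coevTensor X Y ≫ g ▷ (dual X ⊗ dual Y) ≫ evRTensor X Y := by
  unfold trR
  rw [← evR_dualTensorR, ← whisker_exchange_assoc, ← PivotalCat.dualTensor_eq,
    reassoc_of% coevTensor_dualTensorL X Y]

end Trace

/-! ### Invertible dimensions and nondegeneracy of the trace -/

section Semisimple

variable {k : Type w} [CommRing k] {C : Type u} [Category.{v} C]
  [Preadditive C] [HasFiniteBiproducts C] [CategoryTheory.Linear k C]

lemma IsSimpleObj.smul_eq_zero {i : C} (hi : IsSimpleObj k i) {r : k} (h : r • 𝟙 i = 0) :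
    r = 0 := by
  obtain ⟨e⟩ := hi
  have h' : r • e.symm 1 = 0 := by
    rw [← Category.id_comp (e.symm 1), ← CategoryTheory.Linear.smul_comp, h, zero_comp]
  have := congrArg e h'
  simpa using this

variable [MonoidalCategory C] [MonoidalPreadditive C] [MonoidalLinear k C] [PivotalCat C]

/-- The dimension of a simple object is invertible. -/
lemma IsSplitSemisimple.exists_dim (hs : IsSplitSemisimple k C) (h1 : IsSimpleObj k (𝟙_ C))
    {i : C} (hi : IsSimpleObj k i) : ∃ s : k, s • (coev i ≫ evR i) = 𝟙 (𝟙_ C) := by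
  obtain ⟨d, hd⟩ := exists_eq_smul_id h1 (coev i ≫ evR i)
  -- By duality, morphisms `𝟙 ⟶ i ⊗ i*` correspond to endomorphisms of `i`, hence are multiples of
  -- `coev i`; likewise below for `evR i`.
  have hu (u : 𝟙_ C ⟶ i ⊗ dual i) : ∃ c : k, u = c • coev i := by
    obtain ⟨c, hc⟩ := exists_eq_smul_id hi (𝟙 i ⊗≫ u ▷ i ⊗≫ i ◁ ev i ⊗≫ 𝟙 i)
    refine ⟨c, ?_⟩
    calc u = 𝟙 _ ⊗≫ u ⊗≫ i ◁ ((ρ_ (dual i)).inv ≫ dual i ◁ coev i ≫ (α_ _ _ _).inv ≫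
              ev i ▷ dual i ≫ (λ_ (dual i)).hom) ⊗≫ 𝟙 _ := by rw [zigzag_dual]; monoidal
      _ = 𝟙 _ ⊗≫ (u ▷ 𝟙_ C ≫ _ ◁ coev i) ⊗≫ i ◁ ev i ▷ dual i ⊗≫ 𝟙 _ := by monoidal
      _ = coev i ≫ (𝟙 i ⊗≫ u ▷ i ⊗≫ i ◁ ev i ⊗≫ 𝟙 i) ▷ dual i := by
        rw [← whisker_exchange]; monoidal
      _ = _ := by rw [hc]; simp
  have hv (v : i ⊗ dual i ⟶ 𝟙_ C) : ∃ c : k, v = c • evR i := by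
    obtain ⟨c, hc⟩ := exists_eq_smul_id hi (𝟙 i ⊗≫ i ◁ coevR i ⊗≫ v ▷ i ⊗≫ 𝟙 i)
    refine ⟨c, ?_⟩
    calc v = 𝟙 _ ⊗≫ i ◁ ((λ_ (dual i)).inv ≫ coevR i ▷ dual i ≫ (α_ _ _ _).hom ≫
              dual i ◁ evR i ≫ (ρ_ (dual i)).hom) ⊗≫ v ⊗≫ 𝟙 _ := by rw [zigzagR_dual]; monoidal
      _ = 𝟙 _ ⊗≫ i ◁ coevR i ▷ dual i ⊗≫ (_ ◁ evR i ≫ v ▷ 𝟙_ C) ⊗≫ 𝟙 _ := by monoidal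
      _ = (𝟙 i ⊗≫ i ◁ coevR i ⊗≫ v ▷ i ⊗≫ 𝟙 i) ▷ dual i ≫ evR i := by
        rw [whisker_exchange]; monoidal
      _ = _ := by rw [hc]; simp
  obtain ⟨n, S, hS, ⟨e⟩⟩ := hs.exists_decomp (i ⊗ dual i)
  -- A summand of `i ⊗ i*` not isomorphic to the unit receives nothing from `coev i`; one isomorphic
  -- to the unit contributes a multiple of `coev i ≫ evR i ≫ coev i`, hence of `d • coev i`. Summing
  -- gives `coev i = c d • coev i`.
  have hterm (a : Fin n) : ∃ c : k, coev i ≫ (e.hom ≫ biproduct.π S a) ≫ biproduct.ι S a ≫ e.inv =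
      (c * d) • coev i := by
    by_cases h : Nonempty (𝟙_ C ≅ S a)
    · obtain ⟨f⟩ := h
      obtain ⟨c, hc⟩ := hu (f.hom ≫ biproduct.ι S a ≫ e.inv)
      obtain ⟨c', hc'⟩ := hv ((e.hom ≫ biproduct.π S a) ≫ f.inv)
      refine ⟨c' * c, ?_⟩
      calc _ = (coev i ≫ ((e.hom ≫ biproduct.π S a) ≫ f.inv)) ≫
                (f.hom ≫ biproduct.ι S a ≫ e.inv) := by simp
        _ = _ := by
          rw [hc, hc', CategoryTheory.Linear.comp_smul (Y := i ⊗ dual i) (Z := 𝟙_ C), hd]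
          simp [smul_smul, mul_comm, mul_left_comm]
    · refine ⟨0, ?_⟩
      rw [← Category.assoc, hs.hom_eq_zero _ _ h1 (hS a) h (coev i ≫ e.hom ≫ biproduct.π S a)]
      simp
  choose c hc using hterm
  have h : coev i = ((∑ a, c a) * d) • coev i := by
    calc coev i = coev i ≫ e.hom ≫ (∑ a, biproduct.π S a ≫ biproduct.ι S a) ≫ e.inv := by
          rw [biproduct.total]; simp
      _ = ∑ a, coev i ≫ (e.hom ≫ biproduct.π S a) ≫ biproduct.ι S a ≫ e.inv := by
          rw [Preadditive.sum_comp, Preadditive.comp_sum, Preadditive.comp_sum]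
          simp only [Category.assoc]
      _ = _ := by simp only [hc]; rw [← Finset.sum_smul, Finset.sum_mul]
  -- A scalar killing `coev i` kills `𝟙 i` by the zigzag identity, hence is zero because `i` is
  -- simple.
  have h' : (1 - (∑ a, c a) * d) • 𝟙 i = 0 := by
    have e : (1 - (∑ a, c a) * d) • coev i = 0 := by rw [sub_smul, ← h]; simp
    have hz : 𝟙 i = (λ_ i).inv ≫ coev i ▷ i ≫ (α_ _ _ _).hom ≫ i ◁ ev i ≫ (ρ_ i).hom :=
      (zigzag i).symm
    rw [hz, ← CategoryTheory.Linear.comp_smul, ← CategoryTheory.Linear.smul_comp,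
      ← MonoidalLinear.smul_whiskerRight, e]
    simp
  refine ⟨∑ a, c a, ?_⟩
  rw [hd, smul_smul, ← sub_eq_zero.1 (hi.smul_eq_zero h'), one_smul]

lemma IsSplitSemisimple.exists_dimInv (hs : IsSplitSemisimple k C) (h1 : IsSimpleObj k (𝟙_ C))
    (hsph : IsSpherical C) {i : C} (hi : IsSimpleObj k i) : ∃ s : k, DimInv s i := by
  obtain ⟨s, h⟩ := hs.exists_dim h1 hi
  have e := hsph i (𝟙 i)
  simp only [trL, trR, MonoidalCategory.whiskerLeft_id, id_whiskerRight, Category.id_comp] at e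
  exact ⟨s, by rw [DimInv, e, h]⟩

/-- The trace of a spherical pre-fusion category is nondegenerate. -/
lemma IsSplitSemisimple.eq_zero_of_trL (hs : IsSplitSemisimple k C) (h1 : IsSimpleObj k (𝟙_ C))
    (hsph : IsSpherical C) {X Y : C} {f : X ⟶ Y} (hf : ∀ h : Y ⟶ X, trL (f ≫ h) = 0) : f = 0 := by
  obtain ⟨n, S, hS, ⟨e⟩⟩ := hs.exists_decomp X
  obtain ⟨m, T, hT, ⟨e'⟩⟩ := hs.exists_decomp Y
  suffices h : e.inv ≫ f ≫ e'.hom = 0 by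
    calc f = e.hom ≫ (e.inv ≫ f ≫ e'.hom) ≫ e'.inv := by simp
      _ = 0 := by rw [h]; simp
  -- It suffices to kill the matrix entries between simple summands.
  refine biproduct.hom_ext' _ _ fun a => biproduct.hom_ext _ _ fun b => ?_
  rw [comp_zero, zero_comp]
  by_cases h : Nonempty (S a ≅ T b)
  · obtain ⟨g⟩ := h
    obtain ⟨r, hr⟩ := exists_eq_smul_id (hS a)
      ((biproduct.ι S a ≫ e.inv ≫ f ≫ e'.hom) ≫ biproduct.π T b ≫ g.inv)
    obtain ⟨s, hs'⟩ := hs.exists_dimInv h1 hsph (hS a)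
    -- Pairing with an elementary matrix isolates one entry: by cyclicity the trace is `r` times the
    -- dimension of `S a`, which is invertible, so `r = 0`.
    have e₁ := hf (e'.hom ≫ biproduct.π T b ≫ g.inv ≫ biproduct.ι S a ≫ e.inv)
    rw [show f ≫ e'.hom ≫ biproduct.π T b ≫ g.inv ≫ biproduct.ι S a ≫ e.inv =
      (f ≫ e'.hom ≫ biproduct.π T b ≫ g.inv) ≫ (biproduct.ι S a ≫ e.inv) by simp, trL_comm,
      show (biproduct.ι S a ≫ e.inv) ≫ (f ≫ e'.hom ≫ biproduct.π T b ≫ g.inv) = r • 𝟙 _ by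
        rw [← hr]; simp] at e₁
    have e₂ : r • 𝟙 (𝟙_ C) = 0 := by
      rw [← show s • (coevR (S a) ≫ ev (S a)) = 𝟙 (𝟙_ C) from hs', smul_comm]
      have : r • (coevR (S a) ≫ ev (S a)) = trL (r • 𝟙 (S a)) := by simp [trL]
      rw [this, e₁, smul_zero]
    rw [h1.smul_eq_zero e₂, zero_smul] at hr
    calc _ = ((biproduct.ι S a ≫ e.inv ≫ f ≫ e'.hom) ≫ biproduct.π T b ≫ g.inv) ≫ g.hom := by simp
      _ = 0 := by rw [hr, zero_comp]
  · exact hs.hom_eq_zero _ _ (hS a) (hT b) h _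

end Semisimple

/-! ### The case of spherical pre-fusion categories -/

section PreFusion

variable {G : Type*} [Group G] {k : Type w} [CommRing k] {C : Type u} [Category.{v} C]
  [Preadditive C] [HasFiniteBiproducts C] [CategoryTheory.Linear k C] [MonoidalCategory C]
  [PivotalCat C] [GGraded G C] [GPivotal G C] [MonoidalPreadditive C] [MonoidalLinear k C]

/-- The simple object present in each degree serves as `V`; sphericity is what makes its left
dimension, rather than the right one or a product of both, invertible. -/
lemma IsPreFusion.exists_invDim (hpre : IsPreFusion G k C) (hsph : IsSpherical C) :
    ∃ (V : G → C) (hV : ∀ α, InvDim α (V α)) (r : G → k),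
      (∀ α, (hV α).dInv = r α • 𝟙 _) ∧ ∀ α, DimInv (r α) (V α) := by
  choose V hV hs using hpre.exists_simple
  have h (α : G) : InvDim α (V α) := ⟨hV α, by
    obtain ⟨s, h⟩ := hpre.splitSemisimple.exists_dimInv hpre.simple_unit hsph (hs α)
    exact h.isIso_dimL⟩
  choose r hr using fun α => (h α).exists_dimInv hpre.simple_unit
  exact ⟨V, h, r, fun α => (hr α).1, fun α => (hr α).2⟩

lemma IsPreFusion.exists_isCanonical (hpre : IsPreFusion G k C) (hsph : IsSpherical C)
    [IsIdempotentComplete C] :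
    ∃ (φ : Crossing G k (GCenter G C)) (τ : GBraiding φ), IsCanonical φ τ := by
  obtain ⟨V, hV, r, hd, hr⟩ := hpre.exists_invDim hsph
  choose obj h using fun (α : G) (A : GCenter G C) => exists_transport A (hV α) (hd α) (hr α)
  let S : TransportChoice G k C :=
    { V := V
      mem := fun α => (hV α).mem
      r := r
      dimInv := hr
      obj := obj
      T := fun α A => (h α A).1.some
      maps := fun hA => (h _ _).2 _ hA }
  exact ⟨S.crossing, S.braiding, S.system.isCanonical hpre.simple_unit⟩

lemma IsCanonical.nonempty_system (hpre : IsPreFusion G k C) (hsph : IsSpherical C)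
    {φ : Crossing G k (GCenter G C)} {τ : GBraiding φ} (h : IsCanonical φ τ) :
    Nonempty (TransportSystem τ) := by
  obtain ⟨V, hV, r, hd, hr⟩ := hpre.exists_invDim hsph
  exact ⟨h.some.system hV hd hr⟩

end PreFusion

/-! ### Transposes and rotations of a crossing -/

section Mates

variable {C : Type u} [Category.{v} C] [MonoidalCategory C] [PivotalCat C] {A B X : C}

/-- The transpose of `f` with respect to `X`. -/
def mateL (f : A ⊗ X ⟶ X ⊗ B) : dual X ⊗ A ⟶ B ⊗ dual X :=
  𝟙 _ ⊗≫ (dual X ⊗ A) ◁ coev X ⊗≫ dual X ◁ f ▷ dual X ⊗≫ ev X ▷ (B ⊗ dual X) ⊗≫ 𝟙 _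

/-- The left full rotation of `f`. -/
def rotL (f : A ⊗ X ⟶ X ⊗ B) : dual B ⊗ dual X ⟶ dual X ⊗ dual A :=
  𝟙 _ ⊗≫ (dual B ⊗ dual X) ◁ coev A ⊗≫ dual B ◁ mateL f ▷ dual A ⊗≫
    ev B ▷ (dual X ⊗ dual A) ⊗≫ 𝟙 _

/-- The transpose of `f` with respect to `A` and `B`. -/
def mateR (f : A ⊗ X ⟶ X ⊗ B) : X ⊗ dual B ⟶ dual A ⊗ X :=
  𝟙 _ ⊗≫ coevR A ▷ (X ⊗ dual B) ⊗≫ dual A ◁ f ▷ dual B ⊗≫ dual A ◁ X ◁ evR B ⊗≫ 𝟙 _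

/-- The right full rotation of `f`. -/
def rotR (f : A ⊗ X ⟶ X ⊗ B) : dual B ⊗ dual X ⟶ dual X ⊗ dual A :=
  𝟙 _ ⊗≫ coevR X ▷ (dual B ⊗ dual X) ⊗≫ dual X ◁ mateR f ▷ dual X ⊗≫
    (dual X ⊗ dual A) ◁ evR X ⊗≫ 𝟙 _

lemma mateL_ev (f : A ⊗ X ⟶ X ⊗ B) :
    mateL f ▷ X ⊗≫ B ◁ ev X ⊗≫ 𝟙 B = 𝟙 _ ⊗≫ dual X ◁ f ⊗≫ ev X ▷ B ⊗≫ 𝟙 B := by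
  have key := zigzag X
  unfold mateL
  calc _ = 𝟙 _ ⊗≫ dual X ◁ A ◁ coev X ▷ X ⊗≫ dual X ◁ f ▷ dual X ▷ X ⊗≫
            (ev X ▷ (B ⊗ dual X ⊗ X) ≫ 𝟙_ C ◁ B ◁ ev X) ⊗≫ 𝟙 B := by monoidal
    _ = 𝟙 _ ⊗≫ dual X ◁ A ◁ coev X ▷ X ⊗≫ dual X ◁ (f ▷ (dual X ⊗ X) ≫ (X ⊗ B) ◁ ev X) ⊗≫
          ev X ▷ B ⊗≫ 𝟙 B := by rw [← whisker_exchange]; monoidal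
    _ = 𝟙 _ ⊗≫ dual X ◁ A ◁ ((λ_ X).inv ≫ coev X ▷ X ≫ (α_ _ _ _).hom ≫ X ◁ ev X ≫
          (ρ_ X).hom) ⊗≫ dual X ◁ f ⊗≫ ev X ▷ B ⊗≫ 𝟙 B := by
        rw [← whisker_exchange]; monoidal
    _ = _ := by rw [key]; monoidal

lemma rotL_ev (f : A ⊗ X ⟶ X ⊗ B) :
    rotL f ▷ A ⊗≫ dual X ◁ ev A ⊗≫ 𝟙 (dual X) =
      𝟙 _ ⊗≫ dual B ◁ mateL f ⊗≫ ev B ▷ dual X ⊗≫ 𝟙 (dual X) := by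
  have key := zigzag A
  unfold rotL
  calc _ = 𝟙 _ ⊗≫ dual B ◁ dual X ◁ coev A ▷ A ⊗≫ dual B ◁ mateL f ▷ dual A ▷ A ⊗≫
            (ev B ▷ (dual X ⊗ dual A ⊗ A) ≫ 𝟙_ C ◁ dual X ◁ ev A) ⊗≫ 𝟙 (dual X) := by monoidal
    _ = 𝟙 _ ⊗≫ dual B ◁ dual X ◁ coev A ▷ A ⊗≫ dual B ◁ (mateL f ▷ (dual A ⊗ A) ≫
          (B ⊗ dual X) ◁ ev A) ⊗≫ ev B ▷ dual X ⊗≫ 𝟙 (dual X) := by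
        rw [← whisker_exchange]; monoidal
    _ = 𝟙 _ ⊗≫ dual B ◁ dual X ◁ ((λ_ A).inv ≫ coev A ▷ A ≫ (α_ _ _ _).hom ≫ A ◁ ev A ≫
          (ρ_ A).hom) ⊗≫ dual B ◁ mateL f ⊗≫ ev B ▷ dual X ⊗≫ 𝟙 (dual X) := by
        rw [← whisker_exchange]; monoidal
    _ = _ := by rw [key]; monoidal

lemma rotL_evTensor (f : A ⊗ X ⟶ X ⊗ B) :
    rotL f ▷ (A ⊗ X) ≫ evTensor X A = (dual B ⊗ dual X) ◁ f ≫ evTensor B X := by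
  calc _ = 𝟙 _ ⊗≫ (rotL f ▷ A ⊗≫ dual X ◁ ev A ⊗≫ 𝟙 (dual X)) ▷ X ⊗≫ ev X ⊗≫ 𝟙 _ := by
        unfold evTensor; monoidal
    _ = 𝟙 _ ⊗≫ dual B ◁ mateL f ▷ X ⊗≫ (ev B ▷ (dual X ⊗ X) ≫ 𝟙_ C ◁ ev X) ⊗≫ 𝟙 _ := by
        rw [rotL_ev]; monoidal
    _ = 𝟙 _ ⊗≫ dual B ◁ (mateL f ▷ X ⊗≫ B ◁ ev X ⊗≫ 𝟙 B) ⊗≫ ev B ⊗≫ 𝟙 _ := by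
        rw [← whisker_exchange]; monoidal
    _ = _ := by rw [mateL_ev]; unfold evTensor; monoidal

lemma mateR_evR (f : A ⊗ X ⟶ X ⊗ B) :
    A ◁ mateR f ⊗≫ evR A ▷ X ⊗≫ 𝟙 X = 𝟙 _ ⊗≫ f ▷ dual B ⊗≫ X ◁ evR B ⊗≫ 𝟙 X := by
  have key := zigzagR A
  unfold mateR
  calc _ = 𝟙 _ ⊗≫ A ◁ coevR A ▷ (X ⊗ dual B) ⊗≫ ((A ⊗ dual A) ◁ (f ▷ dual B ≫ (α_ _ _ _).hom ≫
            X ◁ evR B ≫ (ρ_ _).hom) ≫ evR A ▷ X) ⊗≫ 𝟙 _ := by monoidal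
    _ = 𝟙 _ ⊗≫ ((ρ_ _).inv ≫ A ◁ coevR A ≫ (α_ _ _ _).inv ≫ evR A ▷ A ≫
          (λ_ _).hom) ▷ (X ⊗ dual B) ⊗≫ f ▷ dual B ⊗≫ X ◁ evR B ⊗≫ 𝟙 _ := by
        rw [whisker_exchange]; monoidal
    _ = _ := by rw [key]; monoidal

lemma rotR_evRTensor (f : A ⊗ X ⟶ X ⊗ B) :
    (A ⊗ X) ◁ rotR f ≫ evRTensor X A = f ▷ (dual B ⊗ dual X) ≫ evRTensor B X := by
  have kX := zigzagR X
  unfold rotR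
  calc _ = 𝟙 _ ⊗≫ A ◁ X ◁ coevR X ▷ (dual B ⊗ dual X) ⊗≫
          A ◁ ((X ⊗ dual X) ◁ (mateR f ▷ dual X ≫ (α_ _ _ _).hom ≫
            dual A ◁ evR X ≫ (ρ_ _).hom) ≫ evR X ▷ dual A) ⊗≫ evR A ⊗≫ 𝟙 _ := by
        unfold evRTensor; monoidal
    _ = 𝟙 _ ⊗≫ A ◁ ((ρ_ _).inv ≫ X ◁ coevR X ≫ (α_ _ _ _).inv ≫ evR X ▷ X ≫
            (λ_ _).hom) ▷ (dual B ⊗ dual X) ⊗≫ A ◁ mateR f ▷ dual X ⊗≫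
            ((A ⊗ dual A) ◁ evR X ≫ evR A ▷ 𝟙_ C) ⊗≫ 𝟙 _ := by
        rw [whisker_exchange]; monoidal
    _ = 𝟙 _ ⊗≫ (A ◁ mateR f ⊗≫ evR A ▷ X ⊗≫ 𝟙 X) ▷ dual X ⊗≫ evR X ⊗≫ 𝟙 _ := by
        rw [kX, whisker_exchange]; monoidal
    _ = _ := by rw [mateR_evR]; unfold evRTensor; monoidal

/-- The left rotation is characterized by nested left evaluations and the right one by nested right
evaluations, so this is the pivotal axiom in the form `rotation_eq`. -/
lemma rotL_eq_rotR (f : A ⊗ X ⟶ X ⊗ B) : rotL f = rotR f :=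
  rotation_eq f _ _ (rotL_evTensor f) (rotR_evRTensor f)

lemma rotR_evR (f : A ⊗ X ⟶ X ⊗ B) :
    𝟙 (X ⊗ dual B) ⊗≫ (X ⊗ dual B) ◁ coevR X ⊗≫ X ◁ rotR f ▷ X ⊗≫ evR X ▷ (dual A ⊗ X) ⊗≫
      𝟙 (dual A ⊗ X) = mateR f := by
  have kX := zigzagR X
  unfold rotR
  calc
    _ = 𝟙 _ ⊗≫ X ◁ (𝟙_ C ◁ (dual B ◁ coevR X) ≫ coevR X ▷ (dual B ⊗ dual X ⊗ X)) ⊗≫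
          X ◁ dual X ◁ (mateR f ▷ (dual X ⊗ X)) ⊗≫
          ((X ⊗ dual X) ◁ (dual A ◁ evR X ▷ X) ≫ evR X ▷ (dual A ⊗ 𝟙_ C ⊗ X)) ⊗≫ 𝟙 _ := by
        monoidal
    _ = 𝟙 _ ⊗≫ X ◁ coevR X ▷ dual B ⊗≫ X ◁ dual X ◁ ((X ⊗ dual B) ◁ coevR X ≫
          mateR f ▷ (dual X ⊗ X)) ⊗≫
          evR X ▷ (dual A ⊗ X ⊗ dual X ⊗ X) ⊗≫ dual A ◁ evR X ▷ X ⊗≫ 𝟙 _ := by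
        rw [whisker_exchange, whisker_exchange]; monoidal
    _ = 𝟙 _ ⊗≫ X ◁ coevR X ▷ dual B ⊗≫ ((X ⊗ dual X) ◁ (mateR f ≫
          dual A ◁ ((ρ_ X).inv ≫ X ◁ coevR X)) ≫
          evR X ▷ (dual A ⊗ X ⊗ dual X ⊗ X)) ⊗≫ dual A ◁ evR X ▷ X ⊗≫ 𝟙 _ := by
        rw [whisker_exchange (mateR f)]; monoidal
    _ = 𝟙 _ ⊗≫ ((ρ_ _).inv ≫ X ◁ coevR X ≫ (α_ _ _ _).inv ≫ evR X ▷ X ≫ (λ_ _).hom) ▷ dual B ⊗≫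
          mateR f ⊗≫
          dual A ◁ ((ρ_ _).inv ≫ X ◁ coevR X ≫ (α_ _ _ _).inv ≫ evR X ▷ X ≫ (λ_ _).hom) ⊗≫
            𝟙 _ := by
        rw [whisker_exchange]; monoidal
    _ = _ := by rw [kX]; monoidal

/-- Naturality of a crossing along the evaluation of `X`. -/
lemma comp_mateL {f : A ⊗ X ⟶ X ⊗ B} {s : A ⊗ (X ⊗ dual X) ⟶ (X ⊗ dual X) ⊗ A}
    (h : A ◁ ((α_ _ _ _).hom ≫ X ◁ ev X ≫ (ρ_ _).hom) ≫ f =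
      step s f ≫ ((α_ _ _ _).hom ≫ X ◁ ev X ≫ (ρ_ _).hom) ▷ B) :
    s ≫ (α_ _ _ _).hom ≫ X ◁ mateL f = (α_ _ _ _).inv ≫ f ▷ dual X ≫ (α_ _ _ _).hom := by
  have kX := zigzag_dual X
  unfold mateL
  unfold step at h
  calc _ = 𝟙 _ ⊗≫ (s ▷ 𝟙_ C ≫ ((X ⊗ dual X) ⊗ A) ◁ coev X) ⊗≫ X ◁ dual X ◁ f ▷ dual X ⊗≫
            X ◁ ev X ▷ (B ⊗ dual X) ⊗≫ 𝟙 _ := by monoidal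
    _ = 𝟙 _ ⊗≫ (A ⊗ X ⊗ dual X) ◁ coev X ⊗≫ (((α_ _ _ _).inv ≫ s ▷ X ≫ (α_ _ _ _).hom ≫
          (X ⊗ dual X) ◁ f ≫ (α_ _ _ _).inv) ≫
            ((α_ _ _ _).hom ≫ X ◁ ev X ≫ (ρ_ _).hom) ▷ B) ▷ dual X ⊗≫ 𝟙 _ := by
        rw [← whisker_exchange]; monoidal
    _ = 𝟙 _ ⊗≫ A ◁ X ◁ ((ρ_ (dual X)).inv ≫ dual X ◁ coev X ≫ (α_ _ _ _).inv ≫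
          ev X ▷ dual X ≫ (λ_ (dual X)).hom) ⊗≫ f ▷ dual X ⊗≫ 𝟙 _ := by
        rw [← h]; monoidal
    _ = _ := by rw [kX]; monoidal

lemma ext_whiskerLeft_ev {T Z : C} {f g : T ⟶ Z ⊗ dual A}
    (h : f ▷ A ≫ (α_ _ _ _).hom ≫ Z ◁ ev A = g ▷ A ≫ (α_ _ _ _).hom ≫ Z ◁ ev A) : f = g := by
  have aux (f : T ⟶ Z ⊗ dual A) : f = 𝟙 _ ⊗≫ T ◁ coev A ⊗≫
      (f ▷ A ≫ (α_ _ _ _).hom ≫ Z ◁ ev A) ▷ dual A ⊗≫ 𝟙 _ := by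
    calc f = 𝟙 _ ⊗≫ f ⊗≫ Z ◁ ((ρ_ (dual A)).inv ≫ dual A ◁ coev A ≫ (α_ _ _ _).inv ≫
          ev A ▷ dual A ≫ (λ_ (dual A)).hom) ⊗≫ 𝟙 _ := by rw [zigzag_dual]; monoidal
      _ = 𝟙 _ ⊗≫ (f ▷ 𝟙_ C ≫ _ ◁ coev A) ⊗≫ Z ◁ ev A ▷ dual A ⊗≫ 𝟙 _ := by monoidal
      _ = _ := by rw [← whisker_exchange]; monoidal
  rw [aux f, aux g, h]

/-- Here `s` and `d` stand for the half braidings of `A` and `A*` at `X ⊗ X*`. As `s` is invertible,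
`d` is determined by its pairing with `s` under `ev A`; crossing with `f'` and then rotating `f` has
the same pairing, because `f'` pairs with `f`. -/
lemma step_rotL {f : A ⊗ X ⟶ X ⊗ B} {f' : dual A ⊗ X ⟶ X ⊗ dual B}
    {s : A ⊗ (X ⊗ dual X) ⟶ (X ⊗ dual X) ⊗ A} [IsIso s]
    {d : dual A ⊗ (X ⊗ dual X) ⟶ (X ⊗ dual X) ⊗ dual A}
    (hf : par f' f ≫ X ◁ ev B = ev A ▷ X ≫ unitCrossing X)
    (hs : s ≫ (α_ _ _ _).hom ≫ X ◁ mateL f = (α_ _ _ _).inv ≫ f ▷ dual X ≫ (α_ _ _ _).hom)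
    (hd : par d s ≫ (X ⊗ dual X) ◁ ev A = ev A ▷ (X ⊗ dual X) ≫ unitCrossing _) :
    step f' (rotL f) = d := by
  have e : par (step f' (rotL f)) s ≫ (X ⊗ dual X) ◁ ev A = par d s ≫ (X ⊗ dual X) ◁ ev A := by
    rw [hd]
    unfold par at hf ⊢
    unfold step
    calc _ = 𝟙 _ ⊗≫ dual A ◁ s ⊗≫ f' ▷ (dual X ⊗ A) ⊗≫ X ◁ (rotL f ▷ A ⊗≫ dual X ◁ ev A ⊗≫
              𝟙 (dual X)) ⊗≫ 𝟙 _ := by monoidal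
      _ = 𝟙 _ ⊗≫ dual A ◁ s ⊗≫ (f' ▷ (dual X ⊗ A) ≫ (X ⊗ dual B) ◁ mateL f) ⊗≫
            X ◁ ev B ▷ dual X ⊗≫ 𝟙 _ := by rw [rotL_ev]; monoidal
      _ = 𝟙 _ ⊗≫ dual A ◁ (s ≫ (α_ _ _ _).hom ≫ X ◁ mateL f) ⊗≫ f' ▷ (B ⊗ dual X) ⊗≫
            X ◁ ev B ▷ dual X ⊗≫ 𝟙 _ := by rw [← whisker_exchange]; monoidal
      _ = 𝟙 _ ⊗≫ (((α_ _ _ _).hom ≫ dual A ◁ f ≫ (α_ _ _ _).inv ≫ f' ▷ B ≫ (α_ _ _ _).hom) ≫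
            X ◁ ev B) ▷ dual X ⊗≫ 𝟙 _ := by rw [hs]; monoidal
      _ = _ := by rw [hf]; unfold unitCrossing; monoidal
  unfold par at e
  simp only [Category.assoc] at e
  rw [cancel_epi, cancel_epi, cancel_epi] at e
  exact ext_whiskerLeft_ev e

/-- The left rotation is traded for the right one; naturality of `d` along `evR X` then straightens
the strand `X`. This is where compatibility with left evaluations passes to the right duality. -/
lemma comp_mateR {f : A ⊗ X ⟶ X ⊗ B} {f' : dual A ⊗ X ⟶ X ⊗ dual B}
    {d : dual A ⊗ (X ⊗ dual X) ⟶ (X ⊗ dual X) ⊗ dual A} (h : step f' (rotL f) = d)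
    (hd : d ≫ evR X ▷ dual A = dual A ◁ evR X ≫ (ρ_ _).hom ≫ (λ_ _).inv) :
    f' ≫ mateR f = 𝟙 _ := by
  have kX := zigzagR X
  rw [← h, rotL_eq_rotR] at hd
  unfold step at hd
  rw [← rotR_evR]
  calc _ = 𝟙 _ ⊗≫ (f' ▷ 𝟙_ C ≫ (X ⊗ dual B) ◁ coevR X) ⊗≫ X ◁ rotR f ▷ X ⊗≫
            evR X ▷ (dual A ⊗ X) ⊗≫ 𝟙 _ := by monoidal
    _ = 𝟙 _ ⊗≫ (dual A ⊗ X) ◁ coevR X ⊗≫ (((α_ _ _ _).inv ≫ f' ▷ dual X ≫ (α_ _ _ _).hom ≫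
          X ◁ rotR f ≫ (α_ _ _ _).inv) ≫ evR X ▷ dual A) ▷ X ⊗≫ 𝟙 _ := by
        rw [← whisker_exchange]; monoidal
    _ = 𝟙 _ ⊗≫ dual A ◁ ((ρ_ X).inv ≫ X ◁ coevR X ≫ (α_ _ _ _).inv ≫ evR X ▷ X ≫
          (λ_ X).hom) ⊗≫ 𝟙 _ := by rw [hd]; monoidal
    _ = _ := by rw [kX]; monoidal

lemma par_evR_of_comp_mateR {f : A ⊗ X ⟶ X ⊗ B} {f' : dual A ⊗ X ⟶ X ⊗ dual B}
    (h : f' ≫ mateR f = 𝟙 _) : par f f' ≫ X ◁ evR B = evR A ▷ X ≫ unitCrossing X := by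
  unfold par unitCrossing
  calc _ = 𝟙 _ ⊗≫ A ◁ f' ⊗≫ (𝟙 (A ⊗ X ⊗ dual B) ⊗≫ f ▷ dual B ⊗≫ X ◁ evR B ⊗≫ 𝟙 X) ⊗≫
            𝟙 _ := by monoidal
    _ = 𝟙 _ ⊗≫ A ◁ (f' ≫ mateR f) ⊗≫ evR A ▷ X ⊗≫ 𝟙 _ := by rw [← mateR_evR]; monoidal
    _ = _ := by rw [h]; monoidal

end Mates

/-! ### Characterization of the two comparison morphisms -/

section Comparison

variable {C : Type u} [Category.{v} C] [MonoidalCategory C] [PivotalCat C]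
  {D : Type*} [Category* D] [MonoidalCategory D] [PivotalCat D] (F : C ⥤ D) [F.Monoidal]

lemma compL_ev (X : C) :
    compL F X ▷ F.obj X ≫ ev (F.obj X) = μ F (dual X) X ≫ F.map (ev X) ≫ η F := by
  have key := zigzag (F.obj X)
  unfold compL
  generalize μ F (dual X) X ≫ F.map (ev X) ≫ η F = e
  calc _ = 𝟙 _ ⊗≫ F.obj (dual X) ◁ coev (F.obj X) ▷ F.obj X ⊗≫
            (e ▷ (dual (F.obj X) ⊗ F.obj X) ≫ 𝟙_ D ◁ ev (F.obj X)) ⊗≫ 𝟙 _ := by monoidal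
    _ = 𝟙 _ ⊗≫ F.obj (dual X) ◁ ((λ_ _).inv ≫ coev (F.obj X) ▷ F.obj X ≫ (α_ _ _ _).hom ≫
          F.obj X ◁ ev (F.obj X) ≫ (ρ_ _).hom) ⊗≫ e ⊗≫ 𝟙 _ := by
        rw [← whisker_exchange]; monoidal
    _ = _ := by rw [key]; monoidal

lemma evR_compR (X : C) :
    F.obj X ◁ compR F X ≫ evR (F.obj X) = μ F X (dual X) ≫ F.map (evR X) ≫ η F := by
  have key := zigzagR (F.obj X)
  unfold compR
  generalize μ F X (dual X) ≫ F.map (evR X) ≫ η F = e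
  calc _ = 𝟙 _ ⊗≫ F.obj X ◁ coevR (F.obj X) ▷ F.obj (dual X) ⊗≫
            ((F.obj X ⊗ dual (F.obj X)) ◁ e ≫ evR (F.obj X) ▷ 𝟙_ D) ⊗≫ 𝟙 _ := by monoidal
    _ = 𝟙 _ ⊗≫ ((ρ_ _).inv ≫ F.obj X ◁ coevR (F.obj X) ≫ (α_ _ _ _).inv ≫
          evR (F.obj X) ▷ F.obj X ≫ (λ_ _).hom) ▷ F.obj (dual X) ⊗≫ e ⊗≫ 𝟙 _ := by
        rw [whisker_exchange]; monoidal
    _ = _ := by rw [key]; monoidal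

end Comparison

/-! ### Pivotality of the crossing -/

section Pivotality

variable {G : Type*} [Group G] {k : Type w} [CommRing k] {C : Type u} [Category.{v} C]
  [Preadditive C] [HasFiniteBiproducts C] [CategoryTheory.Linear k C] [MonoidalCategory C]
  [PivotalCat C] [GGraded G C] [GPivotal G C] [MonoidalPreadditive C] [MonoidalLinear k C]

namespace TransportSystem

variable {φ : Crossing G k (GCenter G C)} {τ : GBraiding φ} (S : TransportSystem τ) (α : G)
  (A : GCenter G C)

lemma lifts_η (S : TransportSystem τ) :
    Lifts (S.T α (𝟙_ _)) (Transport.unit α) (𝟙 _) (η (φ.F α)) := fun X hX => by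
  have e := S.unit α X hX
  have e' : (ε (φ.F α)).f ≫ (η (φ.F α)).f = 𝟙 _ :=
    congrArg Hom.f (Functor.Monoidal.ε_η (φ.F α))
  rw [id_f, id_whiskerRight, Category.id_comp] at e ⊢
  rw [← e, Category.assoc, ← MonoidalCategory.whiskerLeft_comp, e', MonoidalCategory.whiskerLeft_id]
  exact Category.comp_id _

lemma lifts_ev : Lifts ((S.T α (dual A)).tensor (S.T α A)) (Transport.unit α) (ev A)
    (μ (φ.F α) (dual A) A ≫ (φ.F α).map (ev A) ≫ η (φ.F α)) :=
  (S.tensor α _ _).id_comp ((S.map α (ev A)).comp_id (S.lifts_η α))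

lemma lifts_evR : Lifts ((S.T α A).tensor (S.T α (dual A))) (Transport.unit α) (evR A)
    (μ (φ.F α) A (dual A) ≫ (φ.F α).map (evR A) ≫ η (φ.F α)) :=
  (S.tensor α _ _).id_comp ((S.map α (evR A)).comp_id (S.lifts_η α))

/-- The transport of `A` along `X`. -/
def t (A : GCenter G C) {X : C} (hX : comp α X) :
    A.obj ⊗ X ⟶ X ⊗ ((φ.F α).obj A).obj := ((S.T α A).iso X hX).hom

instance {X : C} (hX : comp α X) : IsIso (S.t α A hX) := by unfold t; infer_instance

/-- The transport of `A*` along `X`, to the dual of `φ_α(A)`. -/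
noncomputable def tDual (A : GCenter G C) {X : C} (hX : comp α X) :
    dual A.obj ⊗ X ⟶ X ⊗ dual ((φ.F α).obj A).obj :=
  ((S.T α (dual A)).iso X hX).hom ≫ X ◁ (compL (φ.F α) A).f

lemma par_tDual_ev {X : C} (hX : comp α X) :
    par (S.tDual α A hX) (S.t α A hX) ≫ X ◁ ev ((φ.F α).obj A).obj =
      ev A.obj ▷ X ≫ unitCrossing X := by
  have e := S.lifts_ev α A X hX
  rw [← compL_ev] at e
  refine Eq.trans ?_ e
  have aux {P P' Q Q' Q'' : C} (a : P ⊗ X ⟶ X ⊗ Q) (b : P' ⊗ X ⟶ X ⊗ Q') (c : Q ⟶ Q'')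
      (d : Q'' ⊗ Q' ⟶ 𝟙_ C) : par (a ≫ X ◁ c) b ≫ X ◁ d = par a b ≫ X ◁ (c ▷ Q' ≫ d) := by
    unfold par; monoidal
  exact aux _ _ _ _

lemma t_natural {X Y : C} (hX : comp α X) (hY : comp α Y) (f : X ⟶ Y) :
    A.obj ◁ f ≫ S.t α A hY = S.t α A hX ≫ f ▷ ((φ.F α).obj A).obj := (S.T α A).nat hX hY f

lemma t_left {X Z : C} (hX : comp α X) (hZ : neutral G C Z) (hZX : comp α (Z ⊗ X)) :
    S.t α A hZX = step (A.β Z hZ).hom (S.t α A hX) := (S.T α A).left hZ hX hZX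

/-- `step_rotL` and `comp_mateR` applied to the transport of `A` and to the half braidings of `A`
and `A*` at the neutral object `X ⊗ X*`. -/
lemma tDual_mateR {X : C} (hX : comp α X) :
    S.tDual α A hX ≫ mateR (S.t α A hX) = 𝟙 _ := by
  have hZ : neutral G C (X ⊗ dual X) := neutral_tensor_dual hX hX
  have hZX : comp α ((X ⊗ dual X) ⊗ X) := mem_neutral_mul hZ hX
  have h1 : neutral G C (𝟙_ C) := unit_mem
  have e := S.t_natural α A hZX hX ((α_ _ _ _).hom ≫ X ◁ ev X ≫ (ρ_ _).hom)
  rw [S.t_left α A hX hZ] at e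
  refine comp_mateR (step_rotL (s := (A.β _ hZ).hom) (d := dualβHom A _ hZ)
    (S.par_tDual_ev α A hX) (comp_mateL e) (dual_ev_comm A _ hZ).symm) ?_
  rw [← dualβHom_naturality A hZ h1, dualβHom_unit A h1 (mem_neutral_mul h1 h1)]

/-- The comparison `compR` is characterized by right evaluations. After transport at `V`, the
required identity is the compatibility of `tDual`, which was built from `compL`, with `evR`. -/
lemma compL_eq_compR (S : TransportSystem τ) {V : C} {r : k} (hV : comp α V) (hr : DimInv r V) :
    compL (φ.F α) A = compR (φ.F α) A := by
  apply ext_evR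
  rw [evR_compR]
  apply ((S.T α A).tensor (S.T α (dual A))).hom_ext hr hV
  refine Eq.trans ?_ (S.lifts_evR α A V hV).symm
  refine Eq.trans ?_ (par_evR_of_comp_mateR (S.tDual_mateR α A hV))
  have aux {P P' Q Q' Q'' : C} (a : P ⊗ V ⟶ V ⊗ Q) (b : P' ⊗ V ⟶ V ⊗ Q') (c : Q' ⟶ Q'')
      (d : Q ⊗ Q'' ⟶ 𝟙_ C) : par a b ≫ V ◁ (Q ◁ c ≫ d) = par a (b ≫ V ◁ c) ≫ V ◁ d := by
    unfold par
    calc _ = 𝟙 _ ⊗≫ P ◁ b ⊗≫ (a ▷ Q' ≫ (V ⊗ Q) ◁ c) ⊗≫ V ◁ d ⊗≫ 𝟙 _ := by monoidal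
      _ = _ := by rw [← whisker_exchange]; monoidal
  exact aux _ _ _ _

lemma isPivotal (S : TransportSystem τ) {V : G → C} {r : G → k} (hV : ∀ α, comp α (V α))
    (hr : ∀ α, DimInv (r α) (V α)) : φ.IsPivotal := fun α A => S.compL_eq_compR α A (hV α) (hr α)

end TransportSystem

end Pivotality

/-! ### The bidual and the two evaluations -/

section Bidual

variable {C : Type u} [Category.{v} C] [MonoidalCategory C] [PivotalCat C]

lemma dualMapL_comp {X Y Z : C} (f : X ⟶ Y) (g : Y ⟶ Z) :
    dualMapL (f ≫ g) = dualMapL g ≫ dualMapL f := by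
  apply ext_ev
  rw [dualMapL_ev, comp_whiskerRight, Category.assoc, dualMapL_ev, ← whisker_exchange_assoc,
    dualMapL_ev, MonoidalCategory.whiskerLeft_comp, Category.assoc]

/-- The unit axiom says that `coev` and `coevR` give the same map `𝟙 ⟶ 𝟙*`. Both evaluations are
retractions of it, and it is invertible. -/
lemma ev_unit_eq : (ρ_ (dual (𝟙_ C))).inv ≫ ev (𝟙_ C) = (λ_ (dual (𝟙_ C))).inv ≫ evR (𝟙_ C) := by
  have h := PivotalCat.dualUnit_eq (C := C)
  have z₁ := zigzag (𝟙_ C)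
  have z₂ := zigzagR (𝟙_ C)
  set i := coev (𝟙_ C) ≫ (λ_ (dual (𝟙_ C))).hom with hi
  have hc : coev (𝟙_ C) = i ≫ (λ_ _).inv := by simp [hi]
  have hc' : coevR (𝟙_ C) = i ≫ (ρ_ _).inv := by simp [h]
  have e₁ : i ≫ (ρ_ _).inv ≫ ev (𝟙_ C) = 𝟙 _ := by
    rw [hc] at z₁
    rw [← z₁]
    monoidal
  have e₂ : i ≫ (λ_ _).inv ≫ evR (𝟙_ C) = 𝟙 _ := by
    rw [hc'] at z₂
    rw [← z₂]
    monoidal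
  have e₃ : ((ρ_ (dual (𝟙_ C))).inv ≫ ev (𝟙_ C)) ≫ i = 𝟙 _ := by
    have z₃ := zigzag_dual (𝟙_ C)
    rw [hc] at z₃
    rw [← z₃]
    calc _ = 𝟙 _ ⊗≫ (((ρ_ (dual (𝟙_ C))).inv ≫ ev (𝟙_ C)) ▷ 𝟙_ C ≫ 𝟙_ C ◁ i) ⊗≫ 𝟙 _ := by monoidal
      _ = _ := by rw [← whisker_exchange]; monoidal
  have : IsIso i := ⟨_, e₁, e₃⟩
  rw [← cancel_epi i, e₁, e₂]

/-- The map `B** ⊗ B* ⟶ (B ⊗ B*)* ⟶ 𝟙*` dual to `coev B` is the same for the left and the right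
dualities. Evaluating it on the unit from either side gives a nested left and a nested right
evaluation, which are therefore equal. -/
lemma ev_dual (B : C) : ev (dual B) =
    𝟙 _ ⊗≫ coev B ▷ (dual (dual B) ⊗ dual B) ⊗≫ B ◁ evR (dual B) ▷ dual B ⊗≫ evR B := by
  have key := zigzag_dual B
  have aux {T : C} (x : T ⟶ dual (𝟙_ C)) :
      (ρ_ T).inv ≫ x ▷ 𝟙_ C ≫ ev (𝟙_ C) = (λ_ T).inv ≫ 𝟙_ C ◁ x ≫ evR (𝟙_ C) := by
    rw [← rightUnitor_inv_naturality_assoc, ← leftUnitor_inv_naturality_assoc, ev_unit_eq]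
  have e := aux (dualTensorL (dual B) B ≫ dualMapL (coev B))
  have e₁ : (dualTensorL (dual B) B ≫ dualMapL (coev B)) ▷ 𝟙_ C ≫ ev (𝟙_ C) =
      (dual (dual B) ⊗ dual B) ◁ coev B ≫ evTensor (dual B) B := by
    rw [comp_whiskerRight, Category.assoc, dualMapL_ev, ← whisker_exchange_assoc, dualTensorL_ev]
  have e₂ : 𝟙_ C ◁ (dualTensorL (dual B) B ≫ dualMapL (coev B)) ≫ evR (𝟙_ C) =
      coev B ▷ (dual (dual B) ⊗ dual B) ≫ evRTensor (dual B) B := by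
    rw [PivotalCat.dualTensor_eq, PivotalCat.dualMap_eq, MonoidalCategory.whiskerLeft_comp,
      Category.assoc, evR_dualMapR, whisker_exchange_assoc, evR_dualTensorR]
  rw [e₁, e₂] at e
  calc ev (dual B) = 𝟙 _ ⊗≫ dual (dual B) ◁ ((ρ_ (dual B)).inv ≫ dual B ◁ coev B ≫
          (α_ _ _ _).inv ≫ ev B ▷ dual B ≫ (λ_ (dual B)).hom) ⊗≫ ev (dual B) := by
        rw [key]; monoidal
    _ = (ρ_ _).inv ≫ (dual (dual B) ⊗ dual B) ◁ coev B ≫ evTensor (dual B) B := by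
        unfold evTensor; monoidal
    _ = _ := by rw [e]; unfold evRTensor; monoidal

/-- The right evaluation of `B` is obtained from the left evaluation of `B*` and the canonical
morphism from `B` to its bidual. -/
lemma evR_eq_bidual (B : C) :
    𝟙 (B ⊗ dual B) ⊗≫ coevR (dual B) ▷ (B ⊗ dual B) ⊗≫ dual (dual B) ◁ ev B ▷ dual B ⊗≫
      ev (dual B) = evR B := by
  have kB := zigzag B
  have kR := zigzagR (dual B)
  rw [ev_dual]
  calc _ = 𝟙 _ ⊗≫ coevR (dual B) ▷ (B ⊗ dual B) ⊗≫
            (𝟙_ C ◁ (dual (dual B) ◁ ev B ▷ dual B) ≫ coev B ▷ _) ⊗≫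
              B ◁ evR (dual B) ▷ dual B ⊗≫ evR B := by monoidal
    _ = 𝟙 _ ⊗≫ (𝟙_ C ◁ (coevR (dual B) ▷ (B ⊗ dual B)) ≫ coev B ▷ _) ⊗≫
            B ◁ ((dual B ⊗ dual (dual B)) ◁ (ev B ▷ dual B) ≫ evR (dual B) ▷ _) ⊗≫ evR B := by
        rw [whisker_exchange]; monoidal
    _ = 𝟙 _ ⊗≫ coev B ▷ (B ⊗ dual B) ⊗≫ B ◁ ((ρ_ _).inv ≫ dual B ◁ coevR (dual B) ≫
          (α_ _ _ _).inv ≫ evR (dual B) ▷ dual B ≫ (λ_ _).hom) ▷ (B ⊗ dual B) ⊗≫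
            B ◁ ev B ▷ dual B ⊗≫ evR B := by
        rw [whisker_exchange, whisker_exchange]; monoidal
    _ = 𝟙 _ ⊗≫ ((λ_ B).inv ≫ coev B ▷ B ≫ (α_ _ _ _).hom ≫ B ◁ ev B ≫ (ρ_ B).hom) ▷ dual B ⊗≫
          evR B := by rw [kR]; monoidal
    _ = _ := by rw [kB]; monoidal

end Bidual

/-! ### Partial traces -/

section PartialTraces

variable {C : Type u} [Category.{v} C] [MonoidalCategory C] [PivotalCat C]

/-- The left partial trace. -/
def ptrL {X Y : C} (g : Y ⊗ X ⟶ Y ⊗ X) : X ⟶ X :=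
  𝟙 _ ⊗≫ coevR Y ▷ X ⊗≫ dual Y ◁ g ⊗≫ ev Y ▷ X ⊗≫ 𝟙 _

/-- The right partial trace. -/
def ptrR {X Y : C} (g : Y ⊗ X ⟶ Y ⊗ X) : Y ⟶ Y :=
  𝟙 _ ⊗≫ Y ◁ coev X ⊗≫ g ▷ dual X ⊗≫ Y ◁ evR X ⊗≫ 𝟙 _

lemma trL_ptrL {X Y : C} (g : Y ⊗ X ⟶ Y ⊗ X) : trL (ptrL g) = trL g := by
  rw [trL_tensor]
  unfold trL ptrL coevRTensor evTensor
  monoidal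

lemma trR_ptrR {X Y : C} (g : Y ⊗ X ⟶ Y ⊗ X) : trR (ptrR g) = trR g := by
  rw [trR_tensor]
  unfold trR ptrR coevTensor evRTensor
  monoidal

lemma ptrL_comp {X Y : C} (g : Y ⊗ X ⟶ Y ⊗ X) (h : X ⟶ X) :
    ptrL g ≫ h = ptrL (g ≫ Y ◁ h) := by
  unfold ptrL
  calc _ = 𝟙 _ ⊗≫ coevR Y ▷ X ⊗≫ dual Y ◁ g ⊗≫ (ev Y ▷ X ≫ 𝟙_ C ◁ h) ⊗≫ 𝟙 _ := by monoidal
    _ = _ := by rw [← whisker_exchange]; monoidal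

lemma comp_ptrR {X Y : C} (g : Y ⊗ X ⟶ Y ⊗ X) (h : Y ⟶ Y) :
    h ≫ ptrR g = ptrR (h ▷ X ≫ g) := by
  unfold ptrR
  calc _ = 𝟙 _ ⊗≫ (h ▷ 𝟙_ C ≫ Y ◁ coev X) ⊗≫ g ▷ dual X ⊗≫ Y ◁ evR X ⊗≫ 𝟙 _ := by monoidal
    _ = _ := by rw [← whisker_exchange]; monoidal

end PartialTraces

/-! ### The twist of a crossing and its inverse -/

section TwistCore

variable {C : Type u} [Category.{v} C] [MonoidalCategory C] [PivotalCat C] {A B : C}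

/-- The twist associated with a crossing of `A` with itself. -/
def curl (t : A ⊗ A ⟶ A ⊗ B) : A ⟶ B :=
  (λ_ A).inv ≫ coevR A ▷ A ≫ (α_ _ _ _).hom ≫ dual A ◁ t ≫ (α_ _ _ _).inv ≫ ev A ▷ B ≫ (λ_ _).hom

/-- The inverse twist associated with a crossing. -/
def curlInv (s : B ⊗ B ⟶ A ⊗ B) : B ⟶ A :=
  𝟙 _ ⊗≫ B ◁ coev B ⊗≫ s ▷ dual B ⊗≫ A ◁ evR B ⊗≫ 𝟙 _

/-- Since `o` pairs with `t'` under the evaluations, pulling `ev A` through the inverse crossing `s`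
replaces it by `o`, and the loop on `B` straightens. -/
lemma whiskerLeft_curlInv_ev {t' : A ⊗ B ⟶ B ⊗ B} {s : B ⊗ B ⟶ A ⊗ B}
    {o : dual A ⊗ B ⟶ B ⊗ dual B} (hs : s ≫ t' = 𝟙 _)
    (ho : par o t' ≫ B ◁ ev B = ev A ▷ B ≫ unitCrossing B) :
    dual A ◁ curlInv s ≫ ev A = o ≫ evR B := by
  have key := zigzag_dual B
  have ho' : ev A ▷ B = (par o t' ≫ B ◁ ev B) ≫ (ρ_ B).hom ≫ (λ_ B).inv := by
    rw [ho]; unfold unitCrossing; simp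
  unfold par at ho'
  unfold curlInv
  calc _ = 𝟙 _ ⊗≫ dual A ◁ B ◁ coev B ⊗≫ dual A ◁ s ▷ dual B ⊗≫
            ((dual A ⊗ A) ◁ evR B ≫ ev A ▷ 𝟙_ C) ⊗≫ 𝟙 _ := by monoidal
    _ = 𝟙 _ ⊗≫ dual A ◁ B ◁ coev B ⊗≫ dual A ◁ s ▷ dual B ⊗≫ (ev A ▷ B) ▷ dual B ⊗≫
          evR B ⊗≫ 𝟙 _ := by rw [whisker_exchange]; monoidal
    _ = 𝟙 _ ⊗≫ dual A ◁ B ◁ coev B ⊗≫ dual A ◁ (s ≫ t') ▷ dual B ⊗≫ o ▷ (B ⊗ dual B) ⊗≫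
          B ◁ ev B ▷ dual B ⊗≫ evR B ⊗≫ 𝟙 _ := by rw [ho']; monoidal
    _ = 𝟙 _ ⊗≫ ((dual A ⊗ B) ◁ coev B ≫ o ▷ (B ⊗ dual B)) ⊗≫
          B ◁ ev B ▷ dual B ⊗≫ evR B ⊗≫ 𝟙 _ := by rw [hs]; monoidal
    _ = 𝟙 _ ⊗≫ o ⊗≫ B ◁ ((ρ_ (dual B)).inv ≫ dual B ◁ coev B ≫
          (α_ _ _ _).inv ≫ ev B ▷ dual B ≫ (λ_ (dual B)).hom) ⊗≫ evR B ⊗≫ 𝟙 _ := by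
        rw [whisker_exchange]; monoidal
    _ = _ := by rw [key]; monoidal

/-- Naturality slides `curlInv s` through the crossing, where `whiskerLeft_curlInv_ev` turns it into
the dual crossing `o`; compatibility of `o` and `t'` with the coevaluations then leaves a zigzag on
`B`. One-sided inverses suffice for the sequel. -/
lemma curlInv_curl {t : A ⊗ A ⟶ A ⊗ B} {t' : A ⊗ B ⟶ B ⊗ B} {s : B ⊗ B ⟶ A ⊗ B}
    {o : dual A ⊗ B ⟶ B ⊗ dual B} (hs : s ≫ t' = 𝟙 _)
    (hn : A ◁ curlInv s ≫ t = t' ≫ curlInv s ▷ B)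
    (ho : par o t' ≫ B ◁ ev B = ev A ▷ B ≫ unitCrossing B)
    (ho' : coevR A ▷ B ≫ par o t' = unitCrossing B ≫ B ◁ coevR B) :
    curlInv s ≫ curl t = 𝟙 B := by
  have key := zigzagR B
  have h := whiskerLeft_curlInv_ev hs ho
  unfold par at ho'
  generalize curlInv s = c at *
  unfold curl
  calc _ = 𝟙 _ ⊗≫ (𝟙_ C ◁ c ≫ coevR A ▷ A) ⊗≫ dual A ◁ t ⊗≫ ev A ▷ B ⊗≫ 𝟙 _ := by monoidal
    _ = 𝟙 _ ⊗≫ coevR A ▷ B ⊗≫ dual A ◁ (A ◁ c ≫ t) ⊗≫ ev A ▷ B ⊗≫ 𝟙 _ := by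
        rw [whisker_exchange]; monoidal
    _ = 𝟙 _ ⊗≫ coevR A ▷ B ⊗≫ dual A ◁ t' ⊗≫ (dual A ◁ c ≫ ev A) ▷ B ⊗≫ 𝟙 _ := by
        rw [hn]; monoidal
    _ = 𝟙 _ ⊗≫ (coevR A ▷ B ≫ (α_ _ _ _).hom ≫ dual A ◁ t' ≫ (α_ _ _ _).inv ≫ o ▷ B ≫
          (α_ _ _ _).hom) ⊗≫ evR B ▷ B ⊗≫ 𝟙 _ := by rw [h]; monoidal
    _ = 𝟙 _ ⊗≫ ((ρ_ B).inv ≫ B ◁ coevR B ≫ (α_ _ _ _).inv ≫ evR B ▷ B ≫ (λ_ B).hom) ⊗≫ 𝟙 _ := by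
        rw [ho']; unfold unitCrossing; monoidal
    _ = _ := by rw [key]; monoidal

/-- Spherical comparison of the partial traces of the inverse crossing and the twist. -/
lemma trL_ptrL_comp (hsph : IsSpherical C) {t : A ⊗ A ⟶ A ⊗ B}
    {s : B ⊗ B ⟶ A ⊗ B} (hc : curlInv s ≫ curl t = 𝟙 B) (h : B ⟶ B)
    (hn : s ≫ A ◁ h = h ▷ B ≫ s) : trL (ptrL (s ≫ curl t ▷ B) ≫ h) = trL h := by
  -- Closing the strand `B` on the right turns `s` into `curlInv s`, leaving the composite of `hc`.
  have e : ptrR (s ≫ curl t ▷ B) = 𝟙 B := by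
    rw [← hc]
    unfold ptrR curlInv
    generalize curl t = c
    calc _ = 𝟙 _ ⊗≫ B ◁ coev B ⊗≫ s ▷ dual B ⊗≫ (c ▷ (B ⊗ dual B) ≫ B ◁ evR B) ⊗≫ 𝟙 _ := by
          monoidal
      _ = _ := by rw [← whisker_exchange]; monoidal
  -- The factor `h` moves to the other strand through `s`. Sphericity is used twice: to pass from
  -- the left trace to the right one, where the partial trace is known, and to return.
  rw [ptrL_comp, trL_ptrL, Category.assoc, ← whisker_exchange, reassoc_of% hn, hsph, ← trR_ptrR,
    ← comp_ptrR, e, Category.comp_id, hsph]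

/-- By `hf`, `f` is `s` with one strand bent, so composing with `c` and `ev B` closes the other
strand and produces the left partial trace in front of `evR B`. -/
lemma evR_of_ptrL {c : A ⟶ B} {s : B ⊗ B ⟶ A ⊗ B} {f : B ⊗ dual B ⟶ dual B ⊗ A}
    (hf : f = 𝟙 _ ⊗≫ coevR B ▷ (B ⊗ dual B) ⊗≫ dual B ◁ s ▷ dual B ⊗≫ dual B ◁ A ◁ evR B ⊗≫ 𝟙 _)
    (h : ptrL (s ≫ c ▷ B) = 𝟙 B) : f ≫ dual B ◁ c ≫ ev B = evR B := by
  rw [hf]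
  calc _ = 𝟙 _ ⊗≫ coevR B ▷ (B ⊗ dual B) ⊗≫ dual B ◁ s ▷ dual B ⊗≫
            dual B ◁ (A ◁ evR B ≫ c ▷ 𝟙_ C) ⊗≫ ev B ⊗≫ 𝟙 _ := by monoidal
    _ = 𝟙 _ ⊗≫ coevR B ▷ (B ⊗ dual B) ⊗≫ dual B ◁ s ▷ dual B ⊗≫
            dual B ◁ c ▷ (B ⊗ dual B) ⊗≫ ((dual B ⊗ B) ◁ evR B ≫ ev B ▷ 𝟙_ C) ⊗≫ 𝟙 _ := by
        rw [whisker_exchange]; monoidal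
    _ = ptrL (s ≫ c ▷ B) ▷ dual B ≫ evR B := by
        rw [whisker_exchange]; unfold ptrL; monoidal
    _ = _ := by rw [h]; simp

/-- The inverse of the crossing of `B` with `X*`, from the crossing of `A` with `X ⊗ X*`. -/
lemma eq_of_step_halfBraiding {X : C} {t : A ⊗ X ⟶ X ⊗ B} {s : X ⊗ B ⟶ A ⊗ X}
    {f : B ⊗ dual X ⟶ dual X ⊗ A} {b : A ⊗ (X ⊗ dual X) ⟶ (X ⊗ dual X) ⊗ A}
    (hs : s ≫ t = 𝟙 _) (hb : step t f = b)
    (hb' : b ≫ evR X ▷ A = A ◁ evR X ≫ (ρ_ A).hom ≫ (λ_ A).inv) :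
    f = 𝟙 _ ⊗≫ coevR X ▷ (B ⊗ dual X) ⊗≫ dual X ◁ s ▷ dual X ⊗≫ dual X ◁ A ◁ evR X ⊗≫ 𝟙 _ := by
  have key := zigzagR_dual X
  rw [← hb] at hb'
  unfold step at hb'
  symm
  calc _ = 𝟙 _ ⊗≫ coevR X ▷ (B ⊗ dual X) ⊗≫ dual X ◁ s ▷ dual X ⊗≫
            dual X ◁ (A ◁ evR X ≫ (ρ_ A).hom ≫ (λ_ A).inv) ⊗≫ 𝟙 _ := by monoidal
    _ = 𝟙 _ ⊗≫ coevR X ▷ (B ⊗ dual X) ⊗≫ dual X ◁ (s ≫ t) ▷ dual X ⊗≫ dual X ◁ X ◁ f ⊗≫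
            dual X ◁ evR X ▷ A ⊗≫ 𝟙 _ := by rw [← hb']; monoidal
    _ = 𝟙 _ ⊗≫ (coevR X ▷ (B ⊗ dual X) ≫ (dual X ⊗ X) ◁ f) ⊗≫
            dual X ◁ evR X ▷ A ⊗≫ 𝟙 _ := by rw [hs]; monoidal
    _ = 𝟙 _ ⊗≫ f ⊗≫ ((λ_ (dual X)).inv ≫ coevR X ▷ dual X ≫ (α_ _ _ _).hom ≫
          dual X ◁ evR X ≫ (ρ_ (dual X)).hom) ▷ A ⊗≫ 𝟙 _ := by
        rw [← whisker_exchange]; monoidal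
    _ = _ := by rw [key]; monoidal

/-- The twist of `Y = B*` composed with the evaluation. -/
lemma curl_dual_ev {D F : C} {t : dual B ⊗ dual B ⟶ dual B ⊗ F} {t' : B ⊗ dual B ⟶ dual B ⊗ D}
    {e : F ⊗ D ⟶ 𝟙_ C} {f : B ⊗ dual B ⟶ dual B ⊗ A} {j : A ⟶ D} {c : A ⟶ B}
    (he : par t t' ≫ dual B ◁ e = ev B ▷ dual B ≫ unitCrossing _) (hf : f ≫ dual B ◁ j = t')
    [IsIso f] (h : f ≫ dual B ◁ c ≫ ev B = evR B) :
    curl t ▷ A ≫ F ◁ j ≫ e = dual B ◁ c ≫ ev B := by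
  -- Once `f` is put in front, the right side is `evR B`, which is rewritten through the bidual
  -- because the twist of `B*` is a loop formed with `B**`.
  rw [← cancel_epi f, h, ← evR_eq_bidual]
  have he' : ev B ▷ dual B = (par t t' ≫ dual B ◁ e) ≫ (ρ_ _).hom ≫ (λ_ _).inv := by
    rw [he]; unfold unitCrossing; simp
  unfold par at he'
  unfold curl
  calc _ = 𝟙 _ ⊗≫ (𝟙_ C ◁ f ≫ coevR (dual B) ▷ (dual B ⊗ A)) ⊗≫
            dual (dual B) ◁ t ▷ A ⊗≫
            (ev (dual B) ▷ (F ⊗ A) ≫ 𝟙_ C ◁ (F ◁ j ≫ e)) ⊗≫ 𝟙 _ := by monoidal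
    _ = 𝟙 _ ⊗≫ coevR (dual B) ▷ (B ⊗ dual B) ⊗≫ dual (dual B) ◁ dual B ◁ f ⊗≫
            dual (dual B) ◁ (t ▷ A ≫ (dual B ⊗ F) ◁ j) ⊗≫ dual (dual B) ◁ dual B ◁ e ⊗≫
            ev (dual B) ⊗≫ 𝟙 _ := by
        rw [whisker_exchange, ← whisker_exchange (ev (dual B))]; monoidal
    _ = 𝟙 _ ⊗≫ coevR (dual B) ▷ (B ⊗ dual B) ⊗≫ dual (dual B) ◁ dual B ◁ (f ≫ dual B ◁ j) ⊗≫
            dual (dual B) ◁ t ▷ D ⊗≫ dual (dual B) ◁ dual B ◁ e ⊗≫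
            ev (dual B) ⊗≫ 𝟙 _ := by
        rw [← whisker_exchange]; monoidal
    _ = _ := by rw [hf, he']; monoidal

end TwistCore

/-! ### Self-duality of the twist -/

section TransportTwist

variable {G : Type*} [Group G] {k : Type w} [CommRing k] {C : Type u} [Category.{v} C]
  [Preadditive C] [HasFiniteBiproducts C] [CategoryTheory.Linear k C] [MonoidalCategory C]
  [PivotalCat C] [GGraded G C] [GPivotal G C] [MonoidalPreadditive C] [MonoidalLinear k C]

lemma Lifts.inv {α : G} {A A' B B' : GCenter G C} {T : Transport α A B} {T' : Transport α A' B'}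
    {e : A ≅ A'} {e' : B ≅ B'} (h : Lifts T T' e.hom e'.hom) : Lifts T' T e.inv e'.inv :=
  fun X hX => by
    have h₁ : e.inv.f ≫ e.hom.f = 𝟙 _ := congrArg Hom.f e.inv_hom_id
    have h₂ : e'.hom.f ≫ e'.inv.f = 𝟙 _ := congrArg Hom.f e'.hom_inv_id
    have h₃ : (T'.iso X hX).hom = e.inv.f ▷ X ≫ (T.iso X hX).hom ≫ X ◁ e'.hom.f := by
      rw [h X hX, ← comp_whiskerRight_assoc, h₁, id_whiskerRight, Category.id_comp]
    rw [h₃]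
    simp only [Category.assoc, ← MonoidalCategory.whiskerLeft_comp, h₂,
      MonoidalCategory.whiskerLeft_id, Category.comp_id]

/-- The right coevaluation is determined by the right evaluation, through `compR`. -/
lemma coevR_eq_of_zigzag {C : Type u} [Category.{v} C] [MonoidalCategory C] [PivotalCat C]
    {B D : C} {c : D ⟶ dual B} {e : B ⊗ D ⟶ 𝟙_ C} (he : B ◁ c ≫ evR B = e)
    {u : 𝟙_ C ⟶ D ⊗ B}
    (hu : (ρ_ B).inv ≫ B ◁ u ≫ (α_ _ _ _).inv ≫ e ▷ B ≫ (λ_ B).hom = 𝟙 B) :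
    u ≫ c ▷ B = coevR B := by
  have key := zigzagR_dual B
  calc u ≫ c ▷ B = 𝟙 _ ⊗≫ u ⊗≫ (c ≫ ((λ_ (dual B)).inv ≫ coevR B ▷ dual B ≫ (α_ _ _ _).hom ≫
          dual B ◁ evR B ≫ (ρ_ (dual B)).hom)) ▷ B ⊗≫ 𝟙 _ := by rw [key]; monoidal
    _ = 𝟙 _ ⊗≫ u ⊗≫ (𝟙_ C ◁ c ≫ coevR B ▷ dual B) ▷ B ⊗≫ dual B ◁ evR B ▷ B ⊗≫ 𝟙 _ := by monoidal
    _ = 𝟙 _ ⊗≫ (𝟙_ C ◁ u ≫ coevR B ▷ _) ⊗≫ dual B ◁ (B ◁ c ≫ evR B) ▷ B ⊗≫ 𝟙 _ := by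
        rw [whisker_exchange (coevR B)]; monoidal
    _ = 𝟙 _ ⊗≫ coevR B ⊗≫ dual B ◁ ((ρ_ B).inv ≫ B ◁ u ≫ (α_ _ _ _).inv ≫ e ▷ B ≫
          (λ_ B).hom) ⊗≫ 𝟙 _ := by rw [whisker_exchange, he]; monoidal
    _ = _ := by rw [hu]; monoidal

lemma trL_sub {X : C} (f g : X ⟶ X) : trL (f - g) = trL f - trL g := by
  rw [eq_sub_iff_add_eq]
  unfold trL
  rw [← Preadditive.comp_add, ← Preadditive.add_comp, ← MonoidalPreadditive.whiskerLeft_add,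
    sub_add_cancel]

instance {A B : GCenter G C} (e : A ≅ B) : IsIso e.inv.f :=
  ⟨e.hom.f, congrArg Hom.f e.inv_hom_id, congrArg Hom.f e.hom_inv_id⟩

namespace TransportSystem

variable {φ : Crossing G k (GCenter G C)} {τ : GBraiding φ} (S : TransportSystem τ) (α : G)
  (A : GCenter G C)

lemma lifts_coevR : Lifts (Transport.unit α) ((S.T α (dual A)).tensor (S.T α A)) (coevR A)
    (ε (φ.F α) ≫ (φ.F α).map (coevR A) ≫ δ (φ.F α) (dual A) A) :=
  (S.unit α).id_comp ((S.map α (coevR A)).comp_id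
    (Lifts.inv (e := Iso.refl _) (e' := Functor.Monoidal.μIso (φ.F α) (dual A) A)
      (S.tensor α (dual A) A)))

/-- The composite lifts the zigzag of `A`, which is the identity, so uniqueness of lifts applies. -/
lemma zigzagR_map (S : TransportSystem τ) {V : C} {r : k} (hV : comp α V) (hr : DimInv r V) :
    (ρ_ _).inv ≫ (φ.F α).obj A ◁ (ε (φ.F α) ≫ (φ.F α).map (coevR A) ≫ δ (φ.F α) (dual A) A) ≫
      (α_ _ _ _).inv ≫ (μ (φ.F α) A (dual A) ≫ (φ.F α).map (evR A) ≫ η (φ.F α)) ▷ (φ.F α).obj A ≫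
        (λ_ _).hom = 𝟙 _ :=
  Lifts.unique hr hV
    ((Lifts.inv (e := ρ_ _) (e' := ρ_ _) (Lifts.rightUnitor (S.T α A))).comp
      (((S.lifts_coevR α A).whiskerLeft (S.T α A)).comp
        ((Lifts.inv (e := α_ _ _ _) (e' := α_ _ _ _)
            (Lifts.associator (S.T α A) (S.T α (dual A)) (S.T α A))).comp
          (((S.lifts_evR α A).whiskerRight (S.T α A)).comp (Lifts.leftUnitor (S.T α A))))))
    ((Lifts.id (S.T α A)).of_eq (zigzagR A).symm rfl)

/-- The dual transport is defined through `compL`, whereas the right coevaluation is controlled by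
`compR`; pivotality of `φ_α` identifies the two. -/
lemma coevR_par_tDual {V : C} {r : k} (hV : comp α V) (hr : DimInv r V) {X : C}
    (hX : comp α X) :
    coevR A.obj ▷ X ≫ par (S.tDual α A hX) (S.t α A hX) =
      unitCrossing X ≫ X ◁ coevR ((φ.F α).obj A).obj := by
  have e := coevR_eq_of_zigzag (evR_compR (φ.F α) A) (S.zigzagR_map α A hV hr)
  rw [← S.compL_eq_compR α A hV hr] at e
  have e' := S.lifts_coevR α A X hX
  have aux {P P' Q Q' Q'' : C} (a : P ⊗ X ⟶ X ⊗ Q) (b : P' ⊗ X ⟶ X ⊗ Q') (c : Q ⟶ Q'') :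
      par (a ≫ X ◁ c) b = par a b ≫ X ◁ (c ▷ Q') := by
    unfold par; monoidal
  have e₃ := congrArg (fun x => unitCrossing X ≫ X ◁ Hom.f x) e
  have aux' {P Q R : C} (a : 𝟙_ C ⟶ P) (b : P ⊗ X ⟶ X ⊗ Q) (c : 𝟙_ C ⟶ Q) (d : Q ⟶ R)
      (h : unitCrossing X ≫ X ◁ c = a ▷ X ≫ b) :
      a ▷ X ≫ b ≫ X ◁ d = unitCrossing X ≫ X ◁ (c ≫ d) := by
    rw [← reassoc_of% h, MonoidalCategory.whiskerLeft_comp]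
  exact ((congrArg (fun x => coevR A.obj ▷ X ≫ x) (aux _ _ _)).trans (aux' _ _ _ _ e')).trans e₃

lemma twist_f (hA : comp α A) : (twist τ A hA).f = curl (S.t α A hA) := by
  unfold curl t
  rw [← S.braiding A A hA]
  rfl

/-- The identification of `A` with `φ_{α⁻¹}(φ_α(A))`. -/
def unitIso (φ : Crossing G k (GCenter G C)) (α : G) (A : GCenter G C) :
    A ≅ (φ.F α⁻¹).obj ((φ.F α).obj A) :=
  φ.oneIso.app A ≪≫ ((φ.mulIso α⁻¹ α 1 (mul_inv_cancel α)).app A).symm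

lemma step_t {α β γ : G} (h : β * α = γ) {X Y : C} (hX : comp β X) (hY : comp α Y)
    (hXY : comp γ (X ⊗ Y)) :
    step (S.t β A hX) (S.t α ((φ.F β).obj A) hY) ≫ (X ⊗ Y) ◁ ((φ.mulIso α β γ h).hom.app A).f =
      S.t γ A hXY := by
  subst h
  exact S.mul α β A hX hY hXY

lemma t_one {X : C} (hX : neutral G C X) :
    (A.β X hX).hom ≫ X ◁ (φ.oneIso.hom.app A).f = S.t 1 A hX := by
  have e := S.one A X hX
  rw [id_f, id_whiskerRight, Category.id_comp] at e
  exact e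

/-- Transports in degrees `α` and `α⁻¹` compose to one of degree `1`, which is the half braiding of
`A` once `φ_1` is identified with the identity. -/
lemma step_unitIso {X Y : C} (hX : comp α X) (hY : comp α⁻¹ Y) (hXY : neutral G C (X ⊗ Y)) :
    step (S.t α A hX) (S.t α⁻¹ ((φ.F α).obj A) hY ≫ Y ◁ (unitIso φ α A).inv.f) =
      (A.β (X ⊗ Y) hXY).hom := by
  have e := S.step_t A (mul_inv_cancel α) hX hY hXY
  rw [← S.t_one] at e
  have h : (unitIso φ α A).inv.f = ((φ.mulIso α⁻¹ α 1 (mul_inv_cancel α)).hom.app A).f ≫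
      (φ.oneIso.inv.app A).f := rfl
  have h' : (φ.oneIso.hom.app A).f ≫ (φ.oneIso.inv.app A).f = 𝟙 _ :=
    congrArg Hom.f (φ.oneIso.hom_inv_id_app A)
  rw [h, step_comp, MonoidalCategory.whiskerLeft_comp, reassoc_of% e,
    ← MonoidalCategory.whiskerLeft_comp, h']
  exact (congrArg (fun x => _ ≫ x) (MonoidalCategory.whiskerLeft_id _ _)).trans
    (Category.comp_id _)

/-- Paired with `A` under evaluation, the left side is the twist of `A` followed by `ev B`, and the
right side is the twist of `B*` followed by the image of `ev B` under `φ_{α⁻¹}`, where `B = φ_α(A)`.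
`curl_dual_ev` equates them once the left partial trace of the inverse crossing followed by the
twist is known to be the identity. -/
lemma twist_selfDual (S : TransportSystem τ) (hs : IsSplitSemisimple k C)
    (h1 : IsSimpleObj k (𝟙_ C))
    (hsph : IsSpherical C) {V : C} {r : k} (hV : comp α V) (hr : DimInv r V) (hA : comp α A) :
    dualMapL (twist τ A hA) =
      twist τ (dual ((φ.F α).obj A)) (GPivotal.dual_mem (φ.maps_self hA)) ≫
        compL (φ.F α⁻¹) ((φ.F α).obj A) ≫
        dualMapL ((φ.mulIso α⁻¹ α 1 (mul_inv_cancel α)).inv.app A) ≫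
        dualMapL (φ.oneIso.hom.app A) := by
  set B := (φ.F α).obj A with hB'
  have hB : comp α B.obj := φ.maps_self hA
  have hBd : comp α⁻¹ (dual B.obj) := GPivotal.dual_mem hB
  have hn : neutral G C (B.obj ⊗ dual B.obj) := neutral_tensor_dual hB hB
  have hu : neutral G C (𝟙_ C) := unit_mem
  have hc : curlInv (inv (S.t α A hB)) ≫ curl (S.t α A hA) = 𝟙 B.obj :=
    curlInv_curl (IsIso.inv_hom_id _) (S.t_natural α A hB hA _) (S.par_tDual_ev α A hB)
      (S.coevR_par_tDual α A hV hr hB)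
  -- Only the right partial trace is directly computable. The left one has the same trace as the
  -- identity against every `h`, so nondegeneracy applies to the difference.
  have hΦ : ptrL (inv (S.t α A hB) ≫ curl (S.t α A hA) ▷ B.obj) = 𝟙 B.obj := by
    rw [← sub_eq_zero]
    refine hs.eq_zero_of_trL h1 hsph fun h => ?_
    have e := trL_ptrL_comp hsph hc h (by
      rw [IsIso.inv_comp_eq, ← Category.assoc, IsIso.eq_comp_inv, S.t_natural])
    rw [Preadditive.sub_comp, trL_sub, e, Category.id_comp, sub_self]
  -- The transport of `B` at `B*`, brought back to `A`, is the inverse of the crossing of `A` with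
  -- `B` with one strand bent, since the two compose to a half braiding of `A` that is natural along
  -- `evR`.
  have hf := eq_of_step_halfBraiding (IsIso.inv_hom_id (S.t α A hB))
    (S.step_unitIso α A hB hBd hn) (by
      rw [← A.naturality hn hu, RelCenter.β_unit A hu (mem_neutral_mul hu hu)])
  have h := evR_of_ptrL hf hΦ
  have hj : (unitIso φ α A).inv.f ≫ (unitIso φ α A).hom.f = 𝟙 _ :=
    congrArg Hom.f (unitIso φ α A).inv_hom_id
  have key := curl_dual_ev (S.lifts_ev α⁻¹ B _ hBd) (j := (unitIso φ α A).hom.f) (by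
    rw [Category.assoc, ← MonoidalCategory.whiskerLeft_comp, hj, MonoidalCategory.whiskerLeft_id]
    exact Category.comp_id _) h
  have e : dualMapL ((φ.mulIso α⁻¹ α 1 (mul_inv_cancel α)).inv.app A) ≫
      dualMapL (φ.oneIso.hom.app A) = dualMapL (unitIso φ α A).hom := (dualMapL_comp _ _).symm
  refine Eq.trans ?_ (congrArg (fun x => twist τ (dual B) (GPivotal.dual_mem hB) ≫
    compL (φ.F α⁻¹) B ≫ x) e.symm)
  apply ext_ev
  rw [dualMapL_ev, comp_whiskerRight, comp_whiskerRight, Category.assoc,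
    Category.assoc, dualMapL_ev, ← whisker_exchange_assoc, compL_ev]
  apply RelCenter.hom_ext
  have t₁ := S.twist_f α A hA
  have t₂ := S.twist_f α⁻¹ (dual B) hBd
  change dual B.obj ◁ (twist τ A hA).f ≫ ev B.obj =
    (twist τ (dual B) hBd).f ▷ A.obj ≫ ((φ.F α⁻¹).obj (dual B)).obj ◁ (unitIso φ α A).hom.f ≫
        (μ (φ.F α⁻¹) (dual B) B ≫ (φ.F α⁻¹).map (ev B) ≫ η (φ.F α⁻¹)).f
  rw [t₁, t₂]
  exact key.symm

end TransportSystem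

end TransportTwist

end GCenterRibbon

theorem lemma4p2 {G : Type*} [Group G] {k : Type*} [CommRing k]
    {C : Type*} [Category* C] [Preadditive C] [CategoryTheory.Linear k C]
    [HasFiniteBiproducts C] [MonoidalCategory C] [MonoidalPreadditive C] [MonoidalLinear k C]
    [GCenterRibbon.PivotalCat C] [GCenterRibbon.GGraded G C] [GCenterRibbon.GPivotal G C]
    (hpre : GCenterRibbon.IsPreFusion G k C) (hsph : GCenterRibbon.IsSpherical C)
    [IsIdempotentComplete C] :
    (∃ (φ : GCenterRibbon.Crossing G k (GCenterRibbon.GCenter G C))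
        (τ : GCenterRibbon.GBraiding φ), GCenterRibbon.IsCanonical φ τ) ∧
      ∀ (φ : GCenterRibbon.Crossing G k (GCenterRibbon.GCenter G C))
        (τ : GCenterRibbon.GBraiding φ),
        GCenterRibbon.IsCanonical φ τ → GCenterRibbon.IsRibbon φ τ := by
  refine ⟨hpre.exists_isCanonical hsph, fun φ τ h => ?_⟩
  obtain ⟨S⟩ := h.nonempty_system hpre hsph
  obtain ⟨V, hV, r, -, hr⟩ := hpre.exists_invDim hsph
  exact ⟨S.isPivotal (fun α => (hV α).mem) hr, fun α X hX =>
    S.twist_selfDual α X hpre.splitSemisimple hpre.simple_unit hsph (hV α).mem (hr α) hX⟩
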